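/- Let $d\ge 3$, $l>0$, $\eta=\mathrm{diag}(-1,1,\dots,1,-1)$ on $\mathbb R^{d+1}$, and let $U\subset\mathbb R^d$ be a coordinate domain with coordinates $x^\mu$, carrying AdS background data in a local orthonormal frame: smooth $\omega_\mu{}^A{}_B$, $e_\mu^A$, $V^A$ ($A,B=0,\dots,d$) with $\omega=dx^\mu\omega_\mu$, $e=dx^\mu e_\mu$, satisfying $\omega\eta+\eta\omega^T=0$, $d\omega+\omega\omega=0$, $de+\omega e=0$, $dV+\omega V=e$, $V^AV_A+l^2=0$, and $e_0,\dots,e_{d-1}$ linearly independent at each point. Let $\Gamma(\mathcal H^{\rm T})$ be the space of formal power series in $Y^A$ with coefficients in polynomials in $a^{\dagger A}$ and in the Grassmann odd ghosts $c_0,c^\dagger,\xi,b^\dagger,\mu,\nu,\theta^\mu$, with coefficients smooth in $x\in U$; $b^\dagger$ has ghost number $-1$, all other ghosts have ghost number $1$, and all other variables have ghost number $0$. Put $$\Box=\partial_{Y^A}\partial_{Y_A},\quad S=\partial_{a^\dagger_A}\partial_{Y^A},\quad T=\partial_{a^{\dagger A}}\partial_{a^\dagger_A},\quad S^\dagger=a^{\dagger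 A}\partial_{Y^A},\quad \bar S^\dagger=(Y^A+V^A)\partial_{a^{\dagger A}},$$ $$h=a^{\dagger A}\partial_{a^{\dagger A}}-(Y^A+V^A)\partial_{Y^A},\qquad \nabla+\sigma=\theta^\mu\big(\partial_{x^\mu}-\omega_\mu{}^B{}_A(Y^A\partial_{Y^B}+a^{\dagger A}\partial_{a^{\dagger B}})-e_\mu^A\partial_{Y^A}\big).$$ Let $\Gamma(\tilde{\mathcal E})$ be the subspace of the $\phi\in\Gamma(\mathcal H^{\rm T})$ that are independent of $c_0,c^\dagger,\xi$ and satisfy $\Box\phi=S\phi=T\phi=0$, and let $$\tilde\Omega^{\rm T}=\nabla+\sigma+S^\dagger\partial_{b^\dagger}+\mu(h-2)+\nu\bar S^\dagger+2\mu b^\dagger\partial_{b^\dagger}+2\mu\nu\partial_\nu+\nu\partial_{b^\dagger}\partial_\mu .$$ Let $\Gamma(\hat{\mathcal E})\subset\Gamma(\tilde{\mathcal E})$ be the subspace of $\mu,\nu$-independent elements with $(h-2+2b^\dagger\partial_{b^\dagger})\phi=0$ and $\bar S^\dagger\phi=0$, and let $\hat\Omega^{\rm T}=\nabla+\sigma+S^\dagger\partial_{b^\dagger}$.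 Then $\tilde\Omega^{\rm T}$ preserves $\Gamma(\tilde{\mathcal E})$, $\hat\Omega^{\rm T}$ preserves $\Gamma(\hat{\mathcal E})$, both are there nilpotent differential operators of finite order and ghost number one, and the system $(\tilde\Omega^{\rm T},\Gamma(\tilde{\mathcal E}))$ can be consistently reduced to the intermediate system $(\hat\Omega^{\rm T},\Gamma(\hat{\mathcal E}))$. That is, there are $C^\infty(U)$-submodules $\Gamma(\mathcal F),\Gamma(\mathcal G)$, graded by ghost number, with $\Gamma(\tilde{\mathcal E})=\Gamma(\hat{\mathcal E})\oplus\Gamma(\mathcal F)\oplus\Gamma(\mathcal G)$ such that the component $\Omega^{\mathcal G\mathcal F}:\Gamma(\mathcal F)\to\Gamma(\mathcal G)$ of $\Omega=\tilde\Omega^{\rm T}$ has an inverse which is a differential operator of finite order, and $$\hat\Omega^{\rm T}=\Omega^{\hat{\mathcal E}\hat{\mathcal E}}-\Omega^{\hat{\mathcal E}\mathcal F}(\Omega^{\mathcal G\mathcal F})^{-1}\Omega^{\mathcal G\hat{\mathcal E}} .$$ Moreover, the elements of $\Gamma(\hat{\mathcal E})$ of ghost number zero are exactly the $\hat F+b^\dagger\hat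 A$ with a $0$-form $\hat F(x;Y,a^\dagger)$ and a $1$-form $\hat A=\theta^\mu\hat A_\mu(x;Y,a^\dagger)$, where $\hat F,\hat A_\mu$ are ghost-free, are annihilated by $\Box,S,T,\bar S^\dagger$, and satisfy $(h-2)\hat F=0$, $h\hat A_\mu=0$. The equation $\hat\Omega^{\rm T}(\hat F+b^\dagger\hat A)=0$ is equivalent to $(\nabla+\sigma)\hat A=0$ and $(\nabla+\sigma)\hat F=-S^\dagger\hat A$. The image under $\hat\Omega^{\rm T}$ of the elements of ghost number $-1$ consists exactly of the $\delta\hat F+b^\dagger\delta\hat A$ with $\delta\hat A=(\nabla+\sigma)\hat\lambda$, $\delta\hat F=-S^\dagger\hat\lambda$, where the parameter $\hat\lambda(x;Y,a^\dagger)$ is ghost-free, annihilated by $\Box,S,T,\bar S^\dagger$, and satisfies $h\hat\lambda=0$. -/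

import Mathlib

open scoped ContDiff

noncomputable section

namespace AdSParent

/-! ### First-quantized BRST systems and their consistent reductions

`R` plays the role of the algebra of smooth functions on space-time and an `R`-module that of the
space of sections of a vector bundle; bundle maps are the `R`-linear maps. -/

section Reduction

variable (R : Type*) [CommRing R] [Algebra ℝ R]

/-- The commutator of an `ℝ`-linear operator with the multiplication by a function. -/
def commFn {M N : Type*} [AddCommGroup M] [Module ℝ M] [Module R M] [IsScalarTower ℝ R M]
    [AddCommGroup N] [Module ℝ N] [Module R N] [IsScalarTower ℝ R N]
    (f : R) (D : M →ₗ[ℝ] N) : M →ₗ[ℝ] N :=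
  D ∘ₗ Algebra.lsmul ℝ ℝ M f - Algebra.lsmul ℝ ℝ N f ∘ₗ D

/-- Linear differential operators of order at most `k`: operators of order `0` commute with
functions, and `D` has order at most `k + 1` if all its commutators with functions have order at
most `k`. -/
def IsDiffOp {M N : Type*} [AddCommGroup M] [Module ℝ M] [Module R M] [IsScalarTower ℝ R M]
    [AddCommGroup N] [Module ℝ N] [Module R N] [IsScalarTower ℝ R N] :
    ℕ → (M →ₗ[ℝ] N) → Prop
  | 0, D => ∀ f : R, commFn R f D = 0
  | k + 1, D => ∀ f : R, IsDiffOp k (commFn R f D)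

variable {R}

/-- `(Ω, N)` is a BRST first-quantized system for the ghost-number grading `gr` of `N`: `Ω` is a
differential operator of finite order, has ghost number one and is nilpotent. (All ghost variables
are Grassmann odd and all other ones even, so that the Grassmann parity is the ghost number mod 2.)
-/
structure IsBRSTSystem {N : Type*} [AddCommGroup N] [Module ℝ N] [Module R N]
    [IsScalarTower ℝ R N] (gr : ℤ → Submodule R N) (Ω : N →ₗ[ℝ] N) : Prop where
  graded : ⨆ n, gr n = ⊤
  diffOp : ∃ k, IsDiffOp R k Ω
  ghost : ∀ n, ∀ φ ∈ gr n, Ω φ ∈ gr (n + 1)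
  nilpotent : ∀ φ, Ω (Ω φ) = 0

/-- The system `(Ω, N)` can be consistently reduced to the system `(Ω', E)`, where `ι` is the
inclusion of `E` in `N`: there is a decomposition `N = E ⊕ F ⊕ G` into graded subbundles such that
the component `Ω^{GF} : F → G` of `Ω` is algebraically invertible, i.e. has an inverse `K` that is a
differential operator of finite order, and `Ω' = Ω^{EE} - Ω^{EF} (Ω^{GF})⁻¹ Ω^{GE}`. -/
def IsConsistentReduction {N E : Type*}
    [AddCommGroup N] [Module ℝ N] [Module R N] [IsScalarTower ℝ R N]
    [AddCommGroup E] [Module ℝ E] [Module R E] [IsScalarTower ℝ R E]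
    (grN : ℤ → Submodule R N) (Ω : N →ₗ[ℝ] N)
    (grE : ℤ → Submodule R E) (Ω' : E →ₗ[ℝ] E) (ι : E →ₗ[R] N) : Prop :=
  ∃ (F G : Submodule R N) (dec : N ≃ₗ[R] E × F × G) (K : G →ₗ[ℝ] F),
    (∀ x : E × F × G, dec.symm x = ι x.1 + (x.2.1 : N) + (x.2.2 : N)) ∧
    (∀ n, grE n = (grN n).comap ι) ∧
    F = ⨆ n, F ⊓ grN n ∧
    G = ⨆ n, G ⊓ grN n ∧
    (∃ k, IsDiffOp R k K) ∧
    (∀ f : F, K (dec (Ω f)).2.2 = f) ∧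
    (∀ g : G, (dec (Ω (K g))).2.2 = g) ∧
    ∀ e : E, Ω' e = (dec (Ω (ι e))).1 - (dec (Ω (K (dec (Ω (ι e))).2.2))).1

/-- The restriction of an operator to an invariant submodule. -/
def restrictOp {M : Type*} [AddCommGroup M] [Module ℝ M] [Module R M] [IsScalarTower ℝ R M]
    (N : Submodule R M) (Ω : M →ₗ[ℝ] M) (h : ∀ φ ∈ N, Ω φ ∈ N) : N →ₗ[ℝ] N where
  toFun φ := ⟨Ω φ, h φ φ.2⟩
  map_add' φ ψ := by ext; simp
  map_smul' c φ := by
    ext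
    exact map_smul Ω c (φ : M)

end Reduction

/-! ### Smooth functions on a coordinate domain -/

/-- The algebra of smooth real functions on the open set `U` of `ℝ^d`. -/
def smoothFunctions {d : ℕ} (U : TopologicalSpace.Opens (Fin d → ℝ)) : Subalgebra ℝ (U → ℝ) where
  carrier := {f | ContDiffOn ℝ ∞ (Function.extend Subtype.val f 0) (U : Set (Fin d → ℝ))}
  mul_mem' {f g} hf hg := by
    refine (ContDiffOn.mul hf hg).congr fun x hx => ?_
    have h (k : U → ℝ) : Function.extend Subtype.val k 0 x = k ⟨x, hx⟩ :=
      Subtype.val_injective.extend_apply k 0 ⟨x, hx⟩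
    simp [h]
  add_mem' {f g} hf hg := by
    refine (ContDiffOn.add hf hg).congr fun x hx => ?_
    have h (k : U → ℝ) : Function.extend Subtype.val k 0 x = k ⟨x, hx⟩ :=
      Subtype.val_injective.extend_apply k 0 ⟨x, hx⟩
    simp [h]
  algebraMap_mem' r := by
    refine (contDiffOn_const (c := r)).congr fun x hx => ?_
    exact Subtype.val_injective.extend_apply (fun _ : U => r) (0 : (Fin d → ℝ) → ℝ) ⟨x, hx⟩

/-- `C^∞(U)`. -/
def Smooth {d : ℕ} (U : TopologicalSpace.Opens (Fin d → ℝ)) : Type := smoothFunctions U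

instance {d : ℕ} (U : TopologicalSpace.Opens (Fin d → ℝ)) : CommRing (Smooth U) :=
  inferInstanceAs (CommRing (smoothFunctions U))

instance {d : ℕ} (U : TopologicalSpace.Opens (Fin d → ℝ)) : Algebra ℝ (Smooth U) :=
  inferInstanceAs (Algebra ℝ (smoothFunctions U))

section Operators

variable {d : ℕ} {U : TopologicalSpace.Opens (Fin d → ℝ)}

/-- A smooth function on `U`, extended by zero to `ℝ^d`. -/
def Smooth.ext0 (f : Smooth U) : (Fin d → ℝ) → ℝ := Function.extend Subtype.val f.1 0

theorem Smooth.ext0_apply (f : Smooth U) (x : U) : f.ext0 x = f.1 x :=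
  Subtype.val_injective.extend_apply f.1 0 x

theorem Smooth.differentiableAt (f : Smooth U) (x : U) : DifferentiableAt ℝ f.ext0 x :=
  (ContDiffOn.contDiffAt f.2 (U.isOpen.mem_nhds x.2)).differentiableAt (by simp)

theorem Smooth.ext0_add (f g : Smooth U) : (f + g).ext0 = f.ext0 + g.ext0 := by
  have h := Function.extend_add (Subtype.val : U → Fin d → ℝ) f.1 g.1 0 0
  rw [add_zero] at h
  exact h

theorem Smooth.ext0_smul (c : ℝ) (f : Smooth U) : (c • f).ext0 = c • f.ext0 := by
  have h := Function.extend_smul c (Subtype.val : U → Fin d → ℝ) f.1 0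
  rw [smul_zero] at h
  exact h

/-- The partial derivative `∂/∂x^μ` of smooth functions on `U`. -/
def partialX (μ : Fin d) : Smooth U →ₗ[ℝ] Smooth U where
  toFun f := ⟨fun x => fderiv ℝ f.ext0 x (Pi.single μ 1), by
    have h1 : ContDiffOn ℝ ∞ (fun x => fderiv ℝ f.ext0 x) (U : Set (Fin d → ℝ)) :=
      ContDiffOn.fderiv_of_isOpen f.2 U.isOpen (by simp)
    have h2 : ContDiffOn ℝ ∞ (fun x => fderiv ℝ f.ext0 x (Pi.single μ 1))
        (U : Set (Fin d → ℝ)) := h1.clm_apply contDiffOn_const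
    refine h2.congr fun x hx => ?_
    exact Subtype.val_injective.extend_apply
      (fun x : U => fderiv ℝ f.ext0 x (Pi.single μ 1)) (0 : (Fin d → ℝ) → ℝ) ⟨x, hx⟩⟩
  map_add' f g := by
    apply Subtype.ext
    funext x
    change fderiv ℝ (f + g).ext0 x _ = fderiv ℝ f.ext0 x _ + fderiv ℝ g.ext0 x _
    rw [Smooth.ext0_add, fderiv_add (f.differentiableAt x) (g.differentiableAt x)]
    rfl
  map_smul' c f := by
    apply Subtype.ext
    funext x
    change fderiv ℝ (c • f).ext0 x _ = c • fderiv ℝ f.ext0 x _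
    rw [Smooth.ext0_smul, fderiv_const_smul (f.differentiableAt x) c]
    rfl

/-! ### Ghosts and states -/

/-- The ghost variables `c₀, c†, ξ, b†, μ, ν, θ^μ` (in the coordinate representation). -/
inductive Ghost (d : ℕ) : Type
  | c0
  | cdag
  | xi
  | bdag
  | mu
  | nu
  | theta (i : Fin d)
  deriving DecidableEq

namespace Ghost

/-- The position of a ghost variable in the ordering of the Grassmann monomials. -/
def rank : Ghost d → ℕ
  | c0 => 0
  | cdag => 1
  | xi => 2
  | bdag => 3
  | mu => 4
  | nu => 5
  | theta i => 6 + i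

/-- The ghost number of a ghost variable. -/
def gh : Ghost d → ℤ
  | bdag => -1
  | _ => 1

end Ghost

/-- The internal functions without ghosts: formal power series in `Y^A` whose coefficients are
polynomials in the oscillators `a^{†A}` (`A = 0, …, d`), with coefficients smooth in `x`. -/
def Fiber (U : TopologicalSpace.Opens (Fin d → ℝ)) : Type :=
  MvPowerSeries (Fin (d + 1)) (MvPolynomial (Fin (d + 1)) (Smooth U))

instance : AddCommGroup (Fiber U) :=
  inferInstanceAs (AddCommGroup (MvPowerSeries (Fin (d + 1)) (MvPolynomial _ (Smooth U))))

instance : Module (Smooth U) (Fiber U) :=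
  inferInstanceAs (Module (Smooth U) (MvPowerSeries (Fin (d + 1)) (MvPolynomial _ (Smooth U))))

instance : Module ℝ (Fiber U) :=
  inferInstanceAs (Module ℝ (MvPowerSeries (Fin (d + 1)) (MvPolynomial _ (Smooth U))))

instance : IsScalarTower ℝ (Smooth U) (Fiber U) :=
  inferInstanceAs (IsScalarTower ℝ (Smooth U)
    (MvPowerSeries (Fin (d + 1)) (MvPolynomial _ (Smooth U))))

/-- The series as an element of Mathlib's ring of formal power series. -/
def Fiber.series (φ : Fiber U) :
    MvPowerSeries (Fin (d + 1)) (MvPolynomial (Fin (d + 1)) (Smooth U)) := φ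

/-- The coefficient of the monomial `Y^n`, a polynomial in `a^{†A}`. -/
def Fiber.coeff (φ : Fiber U) (n : Fin (d + 1) →₀ ℕ) : MvPolynomial (Fin (d + 1)) (Smooth U) :=
  MvPowerSeries.coeff n φ.series

/-- The series with given coefficients. -/
def Fiber.mk (c : (Fin (d + 1) →₀ ℕ) → MvPolynomial (Fin (d + 1)) (Smooth U)) : Fiber U := c

theorem Fiber.ext {φ χ : Fiber U} (h : ∀ n, φ.coeff n = χ.coeff n) : φ = χ := MvPowerSeries.ext h

/-- The representation space `Γ(H^T)`: `ψ S` is the coefficient of the Grassmann monomial that is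
the product of the ghosts in `S`, ordered by increasing rank. -/
abbrev State (U : TopologicalSpace.Opens (Fin d → ℝ)) : Type :=
  Finset (Ghost d) → Fiber U

/-- The sign for moving the ghost `g` to its place in the monomial labelled by `S`. -/
def ghostSign (g : Ghost d) (S : Finset (Ghost d)) : ℤ :=
  (-1) ^ (S.filter fun k => k.rank < g.rank).card

/-- Multiplication from the left by the ghost variable `g`. -/
def gmul (g : Ghost d) : Module.End (Smooth U) (State U) where
  toFun ψ S := if g ∈ S then ghostSign g S • ψ (S.erase g) else 0
  map_add' ψ χ := by
    funext S
    by_cases h : g ∈ S <;> simp [h, smul_add]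
  map_smul' f ψ := by
    funext S
    by_cases h : g ∈ S <;> simp [h, smul_comm (ghostSign g S) f]

/-- The left derivative with respect to the ghost variable `g`. -/
def gder (g : Ghost d) : Module.End (Smooth U) (State U) where
  toFun ψ S := if g ∈ S then 0 else ghostSign g S • ψ (insert g S)
  map_add' ψ χ := by
    funext S
    by_cases h : g ∈ S <;> simp [h, smul_add]
  map_smul' f ψ := by
    funext S
    by_cases h : g ∈ S <;> simp [h, smul_comm (ghostSign g S) f]

/-- The sections of ghost number `n`. -/
def ghostGr (U : TopologicalSpace.Opens (Fin d → ℝ)) (n : ℤ) : Submodule (Smooth U) (State U) where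
  carrier := {ψ | ∀ S : Finset (Ghost d), ∑ g ∈ S, g.gh ≠ n → ψ S = 0}
  add_mem' {ψ χ} hψ hχ S hS := by simp [hψ S hS, hχ S hS]
  zero_mem' _ _ := rfl
  smul_mem' f ψ hψ S hS := by simp [hψ S hS]

/-- Multiplication by `Y^A`. -/
def mulY (A : Fin (d + 1)) : Module.End (Smooth U) (Fiber U) where
  toFun φ := MvPowerSeries.X A * φ.series
  map_add' φ χ := mul_add (MvPowerSeries.X A) φ.series χ.series
  map_smul' f φ := mul_smul_comm f (MvPowerSeries.X A) φ.series

/-- Multiplication by `a^{†A}`. -/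
def mulA (A : Fin (d + 1)) : Module.End (Smooth U) (Fiber U) where
  toFun φ := Fiber.mk fun n => MvPolynomial.X A * φ.coeff n
  map_add' φ χ := by
    funext n
    exact mul_add (MvPolynomial.X A) (φ.coeff n) (χ.coeff n)
  map_smul' f φ := by
    funext n
    exact mul_smul_comm f (MvPolynomial.X A) (φ.coeff n)

/-- `∂/∂Y^A`. -/
def derY (A : Fin (d + 1)) : Module.End (Smooth U) (Fiber U) where
  toFun φ := MvPowerSeries.pderiv (MvPolynomial (Fin (d + 1)) (Smooth U)) A φ.series
  map_add' φ χ :=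
    map_add (MvPowerSeries.pderiv (MvPolynomial (Fin (d + 1)) (Smooth U)) A) φ.series χ.series
  map_smul' f φ := by
    apply MvPowerSeries.ext
    intro n
    have h := MvPowerSeries.coeff_pderiv (i := A) (f • φ.series) n
    have h' := MvPowerSeries.coeff_pderiv (i := A) φ.series n
    refine h.trans (Eq.trans ?_ (congrArg (f • ·) h'.symm))
    exact smul_mul_assoc f (φ.coeff (n + Finsupp.single A 1)) _

/-- `∂/∂a^{†A}`. -/
def derA (A : Fin (d + 1)) : Module.End (Smooth U) (Fiber U) where
  toFun φ := Fiber.mk fun n => MvPolynomial.pderiv A (φ.coeff n)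
  map_add' φ χ := by
    funext n
    exact map_add (MvPolynomial.pderiv A) (φ.coeff n) (χ.coeff n)
  map_smul' f φ := by
    funext n
    exact (MvPolynomial.pderiv A).map_smul f (φ.coeff n)

/-- `∂/∂x^μ`, acting on all coefficients of a function of `x, Y, a†`. -/
def derX (μ : Fin d) : Fiber U →ₗ[ℝ] Fiber U where
  toFun φ := Fiber.mk fun n => AddMonoidAlgebra.map (partialX μ).toAddMonoidHom (φ.coeff n)
  map_add' φ χ := by
    funext n
    apply AddMonoidAlgebra.coeff_injective
    ext1 m
    exact map_add (partialX μ) ((φ.coeff n).coeff m) ((χ.coeff n).coeff m)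
  map_smul' c φ := by
    funext n
    apply AddMonoidAlgebra.coeff_injective
    ext1 m
    exact map_smul (partialX μ) c ((φ.coeff n).coeff m)

/-- An operator on functions of `x, Y, a†`, acting on all coefficients of a state. -/
def onState (D : Module.End (Smooth U) (Fiber U)) : Module.End (Smooth U) (State U) where
  toFun ψ S := D (ψ S)
  map_add' ψ χ := by funext S; simp
  map_smul' f ψ := by funext S; simp

/-- `∂/∂x^μ` on states. -/
def derXState (μ : Fin d) : State U →ₗ[ℝ] State U where
  toFun ψ S := derX μ (ψ S)
  map_add' ψ χ := by funext S; simp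
  map_smul' c ψ := by funext S; simp

/-- The diagonal of the metric `η = diag(-1, 1, …, 1, -1)` on `ℝ^{d+1}`. -/
def eta (A : Fin (d + 1)) : ℝ := if A = 0 ∨ A = Fin.last d then -1 else 1

/-! ### The AdS background -/

/-- The background fields over the coordinate domain `U` of AdS space of radius `l`, in a local
orthonormal frame of the bundle with fiber `ℝ^{d+1}`: `omega μ A B` is `ω_μ{}^A{}_B`, `e μ A` is
`e_μ{}^A` and `V A` is `V^A`. The laws read `ωη + ηω^T = 0`, `dω + ω² = 0`, `de + ωe = 0`,
`dV + ωV = e`, `V² + l² = 0`, and the vielbein is nondegenerate. -/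
structure Background (U : TopologicalSpace.Opens (Fin d → ℝ)) (l : ℝ) where
  omega : Fin d → Fin (d + 1) → Fin (d + 1) → Smooth U
  e : Fin d → Fin (d + 1) → Smooth U
  V : Fin (d + 1) → Smooth U
  metric : ∀ μ A B, eta B • omega μ A B + eta A • omega μ B A = 0
  flat : ∀ μ ν A B, partialX μ (omega ν A B) - partialX ν (omega μ A B)
    + ∑ C, (omega μ A C * omega ν C B - omega ν A C * omega μ C B) = 0
  torsion : ∀ μ ν A, partialX μ (e ν A) - partialX ν (e μ A)
    + ∑ B, (omega μ A B * e ν B - omega ν A B * e μ B) = 0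
  vielbein : ∀ μ A, partialX μ (V A) + ∑ B, omega μ A B * V B = e μ A
  radius : ∑ A, eta A • (V A * V A) + algebraMap ℝ (Smooth U) (l ^ 2) = 0
  nondegenerate : ∀ x : U, LinearIndependent ℝ fun μ A => (e μ A).1 x

/-! ### The constraints, acting on functions of `x, Y, a†` -/

/-- `□ = ∂²/∂Y^A∂Y_A`. -/
def box : Module.End (Smooth U) (Fiber U) := ∑ A, eta A • (derY A * derY A)

/-- `S = ∂²/∂a^†_A ∂Y^A`. -/
def opS : Module.End (Smooth U) (Fiber U) := ∑ A, eta A • (derA A * derY A)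

/-- `T = ∂²/∂a^{†A}∂a^†_A`. -/
def opT : Module.End (Smooth U) (Fiber U) := ∑ A, eta A • (derA A * derA A)

/-- `S† = a^{†A} ∂/∂Y^A`. -/
def opSd : Module.End (Smooth U) (Fiber U) := ∑ A, mulA A * derY A

namespace Background

variable {l : ℝ} (B : Background U l)

/-- `S̄† = (Y^A + V^A) ∂/∂a^{†A}`. -/
def opSbd : Module.End (Smooth U) (Fiber U) := ∑ A, (mulY A + B.V A • 1) * derA A

/-- `h = a^{†A} ∂/∂a^{†A} - (Y^A + V^A) ∂/∂Y^A`. -/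
def opH : Module.End (Smooth U) (Fiber U) :=
  ∑ A, mulA A * derA A - ∑ A, (mulY A + B.V A • 1) * derY A

/-- The coefficient of `θ^μ` in the zeroth order part of `∇ + σ`:
`- ω_μ{}^B{}_A Y^A ∂/∂Y^B - ω_μ{}^B{}_A a^{†A} ∂/∂a^{†B} - e_μ^A ∂/∂Y^A`. -/
def connection (μ : Fin d) : Module.End (Smooth U) (Fiber U) :=
  - ∑ A, ∑ C, B.omega μ C A • (mulY A * derY C + mulA A * derA C) - ∑ A, B.e μ A • derY A

/-- `∇ + σ = θ^μ (∂/∂x^μ - ω_μ{}^B{}_A (Y^A ∂/∂Y^B + a^{†A} ∂/∂a^{†B}) - e_μ^A ∂/∂Y^A)`. -/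
def nablaSigma : Module.End ℝ (State U) :=
  ∑ μ, (gmul (Ghost.theta μ)).restrictScalars ℝ *
    (derXState μ + (onState (B.connection μ)).restrictScalars ℝ)

/-! ### The totally traceless system -/

open Ghost in
/-- `Ω̃ = S† ∂/∂b† + μ (h - 2) + ν S̄† + 2 μ b† ∂/∂b† + 2 μ ν ∂/∂ν + ν ∂/∂b† ∂/∂μ`. -/
def omegaTilde : Module.End (Smooth U) (State U) :=
  onState opSd * gder bdag + gmul mu * (onState B.opH - 2) + gmul nu * onState B.opSbd
    + 2 * (gmul mu * gmul bdag * gder bdag) + 2 * (gmul mu * gmul nu * gder nu)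
    + gmul nu * gder bdag * gder mu

/-- `Ω̃^T = ∇ + σ + Ω̃`. -/
def omegaTildeT : Module.End ℝ (State U) := B.nablaSigma + B.omegaTilde.restrictScalars ℝ

end Background

open Ghost in
/-- `Γ(Ẽ)`: the sections that do not depend on `c₀, c†, ξ` and are totally traceless,
`□φ = Sφ = Tφ = 0`. -/
def tracelessSections (U : TopologicalSpace.Opens (Fin d → ℝ)) :
    Submodule (Smooth U) (State U) :=
  LinearMap.ker (gder c0) ⊓ LinearMap.ker (gder cdag) ⊓ LinearMap.ker (gder xi) ⊓
    LinearMap.ker (onState box) ⊓ LinearMap.ker (onState opS) ⊓ LinearMap.ker (onState opT)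

/-! ### The intermediate system -/

namespace Background

variable {l : ℝ} (B : Background U l)

open Ghost in
/-- `Γ(Ê)`: the sections in `Γ(Ẽ)` that do not depend on `μ, ν` and satisfy
`(h - 2 + 2 b† ∂/∂b†) φ = 0` and `S̄† φ = 0`. -/
def intermediateSections : Submodule (Smooth U) (State U) :=
  tracelessSections U ⊓ LinearMap.ker (gder mu) ⊓ LinearMap.ker (gder nu) ⊓
    LinearMap.ker (onState B.opH - 2 + 2 * (gmul bdag * gder bdag)) ⊓
    LinearMap.ker (onState B.opSbd)

theorem intermediate_le : B.intermediateSections ≤ tracelessSections U :=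
  inf_le_left.trans (inf_le_left.trans (inf_le_left.trans inf_le_left))

/-- `Ω̂^T = ∇ + σ + S† ∂/∂b†`. -/
def omegaHatT : Module.End ℝ (State U) :=
  B.nablaSigma + (onState opSd * gder Ghost.bdag).restrictScalars ℝ

/-- The ghost-free traceless functions of `x, Y, a†` with `(h - m) φ = 0` and `S̄† φ = 0`. -/
def fields (m : ℤ) : Submodule (Smooth U) (Fiber U) :=
  LinearMap.ker (box (U := U)) ⊓ LinearMap.ker (opS (U := U)) ⊓ LinearMap.ker (opT (U := U)) ⊓
    LinearMap.ker (B.opH - (m : Module.End (Smooth U) (Fiber U))) ⊓ LinearMap.ker B.opSbd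

end Background

/-- A ghost-free function, as a state. -/
def zeroForm (φ : Fiber U) : State U := Pi.single ∅ φ

/-- The one-form `θ^μ A_μ`, as a state. -/
def oneForm (A : Fin d → Fiber U) : State U := ∑ μ, gmul (Ghost.theta μ) (zeroForm (A μ))

end Operators

end AdSParent

end

/-! Put N = h - 2 + 2b†∂_{b†} + 2ν∂_ν. The proof inverts the terms δ = μN + νS̄† of the BRST
operator by an explicit homotopy and treats all other terms as a nilpotent perturbation.

The main input is that, on traceless functions, h - m is onto, and that S̄† maps the kernel of h - m
onto the kernel of h - (m - 2), both with C^∞(U)-linear right inverses (`exists_rightInverses`).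
Through its Taylor coefficients a function of Y, a† becomes a functional on polynomials over C^∞(U)
in dual variables p, q (`pairing`). The transposes of □, S, T are the multiplications by p², pq, q²;
those of h - m and S̄† are first order operators whose leading parts multiply by -p_V and q_V. A
smooth frame containing V and two null vectors (`exists_null_frame`) gives coordinates in which the
five constraints have the pairwise coprime leading monomials p₂², p₀q₁, q₂², p_V, q_V. A triangular
change of basis (`theta`) therefore replaces monomials by products of powers of constraints applied
to reduced monomials. Division by p_V or q_V in the new basis is a left inverse of the transposed
operator, modulo the constraints that come before it, and transposing back gives the right inverses.
Bounds on the p- and q-degrees keep the results power series in Y with coefficients polynomial in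
a†.

From these right inverses one builds a homotopy k (`HomotopyData.hom`) with δ² = k² = 0, δkδ = δ,
kδk = k and ker δ ∩ ker k = Γ(Ê). Then F = im k and G = im δ complete Γ(Ê) to a decomposition of
Γ(Ẽ). The remaining terms of the BRST operator Ω raise the number of θ minus the number of b†, which
lies between -1 and d. Hence 1 - kΩ is nilpotent on F, and a finite Neumann series, which is a
differential operator, inverts Ω^{GF} (`isConsistentReduction_of_homotopy`). On Γ(Ê) the full
operator already equals Ω̂, so Ω^{GE} = 0 and the correction term vanishes.

Nilpotency holds because the covariant derivatives commute with each other (flatness and torsion)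
and with the sl(2) triple S†, S̄†, h (because dV + ωV = e). The statements on fields, equations and
gauge transformations follow by expanding in ghost monomials. -/

noncomputable section

set_option linter.unusedSectionVars false
set_option linter.unusedSimpArgs false

namespace AdSParent

/-! ### Leading monomials and triangular operators on polynomials. -/

section LeadingTerms

open MvPolynomial

variable {σ R : Type*} [CommRing R] (w p q : σ → ℕ)

/-- Exponents of smaller weight `w`, of `p`-degree at most and `q`-degree at least that of `γ`. -/
def lowSet (γ : σ →₀ ℕ) : Set (σ →₀ ℕ) :=
  {δ | Finsupp.weight w δ < Finsupp.weight w γ ∧ Finsupp.weight p δ ≤ Finsupp.weight p γ ∧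
    Finsupp.weight q γ ≤ Finsupp.weight q δ}

variable (R) in
/-- The span of the monomials that are lower than `γ`. -/
def low (γ : σ →₀ ℕ) : Submodule R (MvPolynomial σ R) := restrictSupport R (lowSet w p q γ)

variable (R) in
/-- The span of the monomials of `p`-degree at most `n` and `q`-degree at least `s`. -/
def degreeSpan (n s : ℕ) : Submodule R (MvPolynomial σ R) :=
  restrictSupport R {γ | Finsupp.weight p γ ≤ n ∧ s ≤ Finsupp.weight q γ}

/-- The operator `X` multiplies monomials by `u` times the monomial `δ`, up to lower terms. -/
def HasLead (X : Module.End R (MvPolynomial σ R)) (δ : σ →₀ ℕ) (u : R) : Prop :=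
  ∀ γ, X (monomial γ 1) - u • monomial (γ + δ) 1 ∈ low R w p q (γ + δ)

variable {w p q}

theorem monomial_mem_low {γ δ : σ →₀ ℕ} (h : δ ∈ lowSet w p q γ) (r : R) :
    monomial δ r ∈ low R w p q γ :=
  (monomial_mem_restrictSupport R).2 (Or.inl h)

theorem lowSet_trans {γ δ ε : σ →₀ ℕ} (h : δ ∈ lowSet w p q γ) (h' : ε ∈ lowSet w p q δ) :
    ε ∈ lowSet w p q γ :=
  ⟨h'.1.trans h.1, h'.2.1.trans h.2.1, h.2.2.trans h'.2.2⟩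

theorem lowSet_add {γ δ : σ →₀ ℕ} (ε : σ →₀ ℕ) (h : δ ∈ lowSet w p q γ) :
    δ + ε ∈ lowSet w p q (γ + ε) := by
  obtain ⟨h1, h2, h3⟩ := h
  simp only [lowSet, Set.mem_ofPred_eq, map_add]
  omega

theorem low_le {γ δ : σ →₀ ℕ} (h : δ ∈ lowSet w p q γ) : low R w p q δ ≤ low R w p q γ :=
  restrictSupport_mono R fun _ => lowSet_trans h

theorem low_induction {γ : σ →₀ ℕ} {N : Submodule R (MvPolynomial σ R)}
    (X : Module.End R (MvPolynomial σ R))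
    (h : ∀ δ ∈ lowSet w p q γ, X (monomial δ 1) ∈ N) {f : MvPolynomial σ R}
    (hf : f ∈ low R w p q γ) : X f ∈ N := by
  rw [low, restrictSupport_eq_span] at hf
  have : Submodule.span R ((fun x => monomial x (1 : R)) '' lowSet w p q γ) ≤ N.comap X := by
    rw [Submodule.span_le]
    rintro _ ⟨δ, hδ, rfl⟩
    exact h δ hδ
  exact this hf

theorem HasLead.map_low {X : Module.End R (MvPolynomial σ R)} {δ : σ →₀ ℕ} {u : R}
    (h : HasLead w p q X δ u) {γ : σ →₀ ℕ} {f : MvPolynomial σ R} (hf : f ∈ low R w p q γ) :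
    X f ∈ low R w p q (γ + δ) := by
  refine low_induction X (fun ε hε => ?_) hf
  have h1 := lowSet_add δ hε
  rw [← sub_add_cancel (X (monomial ε 1)) (u • monomial (ε + δ) 1)]
  exact add_mem (low_le h1 (h ε)) (Submodule.smul_mem _ _ (monomial_mem_low h1 1))

theorem HasLead.mul {X Y : Module.End R (MvPolynomial σ R)} {δ ε : σ →₀ ℕ} {u v : R}
    (hX : HasLead w p q X δ u) (hY : HasLead w p q Y ε v) :
    HasLead w p q (X * Y) (ε + δ) (v * u) := by
  intro γ
  have h1 := hX.map_low (hY γ)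
  have h2 := Submodule.smul_mem _ v (hX (γ + ε))
  rw [← add_assoc]
  convert add_mem h1 h2 using 1
  simp only [Module.End.mul_apply, map_sub, map_smul, smul_sub, mul_smul]
  abel

theorem HasLead.one : HasLead w p q (1 : Module.End R (MvPolynomial σ R)) 0 1 := by
  intro γ
  simp

theorem HasLead.pow {X : Module.End R (MvPolynomial σ R)} {δ : σ →₀ ℕ} {u : R}
    (hX : HasLead w p q X δ u) (n : ℕ) : HasLead w p q (X ^ n) (n • δ) (u ^ n) := by
  induction n with
  | zero => simpa using HasLead.one
  | succ n ih =>
    rw [pow_succ, pow_succ', succ_nsmul']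
    exact ih.mul hX

theorem hasLead_mulLeft {f : MvPolynomial σ R} {δ : σ →₀ ℕ} {u : R}
    (h : f - monomial δ u ∈ low R w p q δ) :
    HasLead w p q (LinearMap.mulLeft R f) δ u := by
  intro γ
  have h1 : (LinearMap.mulLeft R (monomial γ (1 : R))) (f - monomial δ u)
      ∈ low R w p q (γ + δ) := by
    refine low_induction _ (fun ε hε => ?_) h
    rw [LinearMap.mulLeft_apply, monomial_mul, add_comm γ, add_comm γ]
    exact monomial_mem_low (lowSet_add γ hε) _
  convert h1 using 1
  simp only [LinearMap.mulLeft_apply, mul_sub, monomial_mul, smul_monomial, one_mul, smul_eq_mul,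
    mul_one]
  rw [mul_comm]

theorem monomial_mem_degreeSpan {γ : σ →₀ ℕ} {n s : ℕ} (h1 : Finsupp.weight p γ ≤ n)
    (h2 : s ≤ Finsupp.weight q γ) (r : R) : monomial γ r ∈ degreeSpan R p q n s :=
  (monomial_mem_restrictSupport R).2 (Or.inl ⟨h1, h2⟩)

theorem degreeSpan_induction {n s : ℕ} {S : Type*} [CommRing S] {τ : Type*} [Algebra R S]
    {N : Submodule R (MvPolynomial τ S)} (X : MvPolynomial σ R →ₗ[R] MvPolynomial τ S)
    (h : ∀ δ, Finsupp.weight p δ ≤ n → s ≤ Finsupp.weight q δ → X (monomial δ 1) ∈ N)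
    {f : MvPolynomial σ R} (hf : f ∈ degreeSpan R p q n s) : X f ∈ N := by
  rw [degreeSpan, restrictSupport_eq_span] at hf
  refine (Submodule.span_le (p := N.comap X)).2 ?_ hf
  rintro _ ⟨δ, hδ, rfl⟩
  exact h δ hδ.1 hδ.2

theorem degreeSpan_mono {n n' s s' : ℕ} (h : n ≤ n') (h' : s' ≤ s) :
    degreeSpan R p q n s ≤ degreeSpan R p q n' s' :=
  restrictSupport_mono R fun _ hγ => ⟨hγ.1.trans h, h'.trans hγ.2⟩

theorem mul_mem_degreeSpan {n n' s s' : ℕ} {f g : MvPolynomial σ R}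
    (hf : f ∈ degreeSpan R p q n s) (hg : g ∈ degreeSpan R p q n' s') :
    f * g ∈ degreeSpan R p q (n + n') (s + s') := by
  have h := Submodule.mul_mem_mul hf hg
  rw [degreeSpan, degreeSpan, ← restrictSupport_add] at h
  refine restrictSupport_mono R ?_ h
  rintro _ ⟨a, ha, b, hb, rfl⟩
  simp only [Set.mem_ofPred_eq, map_add] at *
  omega

section Triangular

variable (w p q) in
/-- The operator `Θ` is diagonal with invertible entries on monomials, up to lower terms. -/
def IsTriangular (Θ : Module.End R (MvPolynomial σ R)) : Prop :=
  ∀ γ, ∃ u : R, IsUnit u ∧ Θ (monomial γ 1) - u • monomial γ 1 ∈ low R w p q γ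

variable {Θ : Module.End R (MvPolynomial σ R)}

/-- At a monomial of maximal weight in the support of f, the other terms of f contribute nothing to
Θ f, so its coefficient is merely multiplied by a unit. -/
theorem triangular_injective (hΘ : IsTriangular w p q Θ) : Function.Injective Θ := by
  classical
  rw [injective_iff_map_eq_zero]
  intro f hf
  by_contra hne
  obtain ⟨γ, hγ, hmax⟩ := f.support.exists_max_image (Finsupp.weight w)
    (Finset.nonempty_iff_ne_empty.2 fun h => hne (support_eq_empty.1 h))
  have h1 : ∀ δ ∈ f.support, δ ≠ γ → coeff γ (Θ (monomial δ 1)) = 0 := by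
    intro δ hδ hne'
    obtain ⟨v, -, hv⟩ := hΘ δ
    rw [← sub_add_cancel (Θ (monomial δ 1)) (v • monomial δ 1), coeff_add, coeff_smul,
      coeff_monomial, if_neg hne', smul_zero, add_zero]
    by_contra hc
    exact absurd (hv (mem_support_iff.2 hc)).1 (not_lt.2 (hmax δ hδ))
  obtain ⟨v, hv, hv'⟩ := hΘ γ
  have h2 : coeff γ (Θ (monomial γ 1)) = v := by
    rw [← sub_add_cancel (Θ (monomial γ 1)) (v • monomial γ 1), coeff_add, coeff_smul,
      coeff_monomial, if_pos rfl, smul_eq_mul, mul_one, add_eq_right]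
    by_contra hc
    exact absurd (hv' (mem_support_iff.2 hc)).1 (lt_irrefl _)
  have h3 : Θ f = ∑ δ ∈ f.support, coeff δ f • Θ (monomial δ 1) := by
    conv_lhs => rw [f.as_sum]
    rw [map_sum]
    refine Finset.sum_congr rfl fun δ _ => ?_
    rw [← map_smul, smul_monomial, smul_eq_mul, mul_one]
  have h4 : coeff γ (Θ f) = coeff γ f * v := by
    rw [h3, coeff_sum, Finset.sum_eq_single γ]
    · rw [coeff_smul, h2, smul_eq_mul]
    · intro δ hδ hne'
      rw [coeff_smul, h1 δ hδ hne', smul_zero]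
    · intro h
      exact absurd hγ h
  rw [hf, coeff_zero] at h4
  exact mem_support_iff.1 hγ (hv.mul_left_eq_zero.1 h4.symm)

/-- Induction on the weight. Besides surjectivity it gives a preimage within the same degree bounds,
which is why the inverse of Θ also respects `degreeSpan`. -/
theorem triangular_monomial_mem (hΘ : IsTriangular w p q Θ) (γ : σ →₀ ℕ) : monomial γ (1 : R) ∈
    (degreeSpan R p q (Finsupp.weight p γ) (Finsupp.weight q γ)).map Θ := by
  induction hn : Finsupp.weight w γ using Nat.strong_induction_on generalizing γ with
  | _ n ih =>
    obtain ⟨u, hu, h⟩ := hΘ γ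
    have h1 : low R w p q γ ≤
        (degreeSpan R p q (Finsupp.weight p γ) (Finsupp.weight q γ)).map Θ := by
      intro f hf
      refine low_induction 1 (fun δ hδ => ?_) hf
      exact Submodule.map_mono (degreeSpan_mono hδ.2.1 hδ.2.2) (ih _ (hn ▸ hδ.1) δ rfl)
    have h2 : u • monomial γ (1 : R) ∈
        (degreeSpan R p q (Finsupp.weight p γ) (Finsupp.weight q γ)).map Θ := by
      rw [← sub_sub_cancel (Θ (monomial γ 1)) (u • monomial γ 1)]
      exact sub_mem (Submodule.mem_map_of_mem (monomial_mem_degreeSpan le_rfl le_rfl 1)) (h1 h)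
    obtain ⟨u, rfl⟩ := hu
    have h3 := Submodule.smul_mem _ (↑u⁻¹ : R) h2
    rwa [smul_smul, Units.inv_mul, one_smul] at h3

theorem triangular_surjective (hΘ : IsTriangular w p q Θ) : Function.Surjective Θ := by
  intro f
  have h : f ∈ LinearMap.range Θ := by
    rw [f.as_sum]
    refine sum_mem fun γ _ => ?_
    obtain ⟨g, -, hg⟩ := triangular_monomial_mem hΘ γ
    exact ⟨coeff γ f • g, by rw [map_smul, hg, smul_monomial, smul_eq_mul, mul_one]⟩
  exact h

/-- A triangular operator, as an equivalence. -/
def triangularEquiv (hΘ : IsTriangular w p q Θ) : MvPolynomial σ R ≃ₗ[R] MvPolynomial σ R :=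
  LinearEquiv.ofBijective Θ ⟨triangular_injective hΘ, triangular_surjective hΘ⟩

theorem triangularEquiv_apply (hΘ : IsTriangular w p q Θ) (f : MvPolynomial σ R) : triangularEquiv hΘ f = Θ f := rfl

theorem triangular_mem_degreeSpan (hΘ : IsTriangular w p q Θ) {n s : ℕ} {f : MvPolynomial σ R}
    (hf : f ∈ degreeSpan R p q n s) : Θ f ∈ degreeSpan R p q n s := by
  refine degreeSpan_induction Θ (fun δ h1 h2 => ?_) hf
  obtain ⟨u, -, hu⟩ := hΘ δ
  rw [← sub_add_cancel (Θ (monomial δ 1)) (u • monomial δ 1)]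
  refine add_mem (restrictSupport_mono R (fun ε hε => ?_) hu)
    (Submodule.smul_mem _ _ (monomial_mem_degreeSpan h1 h2 1))
  exact ⟨hε.2.1.trans h1, h2.trans hε.2.2⟩

theorem triangularEquiv_symm_mem_degreeSpan (hΘ : IsTriangular w p q Θ)
    {n s : ℕ} {f : MvPolynomial σ R}
    (hf : f ∈ degreeSpan R p q n s) : (triangularEquiv hΘ).symm f ∈ degreeSpan R p q n s := by
  refine degreeSpan_induction (triangularEquiv hΘ).symm.toLinearMap (fun δ h1 h2 => ?_) hf
  obtain ⟨g, hg, hg'⟩ := triangular_monomial_mem hΘ δ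
  rw [← hg', ← triangularEquiv_apply hΘ]
  simpa using degreeSpan_mono h1 h2 hg

end Triangular

end LeadingTerms

/-! ### The transposed constraints in a null frame and their leading terms. -/

section NullFrame

open MvPolynomial

/-- Four distinguished indices: two null directions, a space-like one and a time-like one. -/
structure NullFrameIndices (ι : Type*) where
  i0 : ι
  i1 : ι
  i2 : ι
  iV : ι
  ne01 : i0 ≠ i1
  ne02 : i0 ≠ i2
  ne0V : i0 ≠ iV
  ne12 : i1 ≠ i2
  ne1V : i1 ≠ iV
  ne2V : i2 ≠ iV

variable {ι R : Type*} [Fintype ι] [DecidableEq ι] [CommRing R] (s : NullFrameIndices ι)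

namespace NullFrameIndices

/-- The bilinear form `f₀ g₁ + f₁ g₀ + f₂ g₂ + ∑ cᵢ fᵢ gᵢ`. -/
def form (c : ι → R) (f g : ι → MvPolynomial (ι ⊕ ι) R) : MvPolynomial (ι ⊕ ι) R :=
  f s.i0 * g s.i1 + f s.i1 * g s.i0 + f s.i2 * g s.i2 +
    ∑ i ∈ Finset.univ.filter fun i => i ≠ s.i0 ∧ i ≠ s.i1 ∧ i ≠ s.i2, C (c i) * (f i * g i)

/-- The weights of the variables. -/
def wt : ι ⊕ ι → ℕ := Sum.elim
  (fun i => if i = s.i0 then 6 else if i = s.i1 then 3 else if i = s.i2 then 5 else 4)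
  (fun i => if i = s.i0 then 0 else if i = s.i1 then 3 else if i = s.i2 then 2 else 1)

end NullFrameIndices

/-- The degree in the first set of variables. -/
def degP : ι ⊕ ι → ℕ := Sum.elim (fun _ => 1) (fun _ => 0)

/-- The degree in the second set of variables. -/
def degQ : ι ⊕ ι → ℕ := Sum.elim (fun _ => 0) (fun _ => 1)

variable (ι R) in
/-- The variables of the first set. -/
def varP (i : ι) : MvPolynomial (ι ⊕ ι) R := X (Sum.inl i)

variable (ι R) in
/-- The variables of the second set. -/
def varQ (i : ι) : MvPolynomial (ι ⊕ ι) R := X (Sum.inr i)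

variable (ι R) in
/-- The derivation `q ∂_q - p ∂_p`. -/
def derEuler : Derivation R (MvPolynomial (ι ⊕ ι) R) (MvPolynomial (ι ⊕ ι) R) :=
  mkDerivation R (Sum.elim (fun i => - varP ι R i) (varQ ι R))

variable (ι R) in
/-- The derivation `q ∂_p`. -/
def derPQ : Derivation R (MvPolynomial (ι ⊕ ι) R) (MvPolynomial (ι ⊕ ι) R) :=
  mkDerivation R (Sum.elim (varQ ι R) 0)

/-- The operator `q ∂_q - p ∂_p - v_p - m`. -/
def transH (v : MvPolynomial (ι ⊕ ι) R) (m : ℤ) : Module.End R (MvPolynomial (ι ⊕ ι) R) :=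
  (derEuler ι R).toLinearMap - LinearMap.mulLeft R v - (m : Module.End R _)

/-- The operator `q ∂_p + v_q`. -/
def transS (v : MvPolynomial (ι ⊕ ι) R) : Module.End R (MvPolynomial (ι ⊕ ι) R) :=
  (derPQ ι R).toLinearMap + LinearMap.mulLeft R v

theorem transH_apply (v : MvPolynomial (ι ⊕ ι) R) (m : ℤ) (f : MvPolynomial (ι ⊕ ι) R) :
    transH v m f = derEuler ι R f - v * f - m • f := by
  simp [transH]

theorem transS_apply (v f : MvPolynomial (ι ⊕ ι) R) :
    transS v f = derPQ ι R f + v * f := by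
  simp [transS]

theorem derEuler_varP (i : ι) : derEuler ι R (varP ι R i) = - varP ι R i := by
  simp [derEuler, varP]

theorem derEuler_varQ (i : ι) : derEuler ι R (varQ ι R i) = varQ ι R i := by
  simp [derEuler, varQ]

theorem derPQ_varP (i : ι) : derPQ ι R (varP ι R i) = varQ ι R i := by
  simp [derPQ, varP]

theorem derPQ_varQ (i : ι) : derPQ ι R (varQ ι R i) = 0 := by
  simp [derPQ, varQ]

/-- The transpose of [h, S̄†] = -2S̄†: the derivations satisfy the sl(2) relation on generators, and
the hypotheses on `v`, `w` extend it to the multiplication terms. -/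
theorem transS_transH {v w : MvPolynomial (ι ⊕ ι) R} (hv : derPQ ι R v = w)
    (hw : derEuler ι R w = w) (m : ℤ) (f : MvPolynomial (ι ⊕ ι) R) :
    transS w (transH v (m - 2) f) = transH v m (transS w f) := by
  have h : ⁅derEuler ι R, derPQ ι R⁆ = 2 • derPQ ι R := by
    refine MvPolynomial.derivation_ext fun i => ?_
    rcases i with i | i
    · change derEuler ι R (derPQ ι R (varP ι R i)) - derPQ ι R (derEuler ι R (varP ι R i)) =
        2 • derPQ ι R (varP ι R i)
      rw [derPQ_varP, derEuler_varP, derEuler_varQ, map_neg, derPQ_varP]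
      ring
    · change derEuler ι R (derPQ ι R (varQ ι R i)) - derPQ ι R (derEuler ι R (varQ ι R i)) =
        2 • derPQ ι R (varQ ι R i)
      rw [derPQ_varQ, derEuler_varQ, derPQ_varQ]
      simp
  have h1 := congrArg (fun D => D f) h
  simp only [Derivation.commutator_apply, Derivation.smul_apply] at h1
  simp only [transS_apply, transH_apply, map_sub, map_add, Derivation.leibniz, map_zsmul, hv, hw,
    smul_eq_mul]
  simp only [zsmul_eq_mul, Int.cast_sub, Int.cast_ofNat, nsmul_eq_mul, Nat.cast_ofNat] at h1 ⊢
  linear_combination -h1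

namespace NullFrameIndices

variable (c : ι → R)

/-- The ideal generated by `p²`, `pq`, `q²`. -/
def quadIdeal : Ideal (MvPolynomial (ι ⊕ ι) R) :=
  Ideal.span {s.form c (varP ι R) (varP ι R), s.form c (varP ι R) (varQ ι R),
    s.form c (varQ ι R) (varQ ι R)}

theorem form_comm (f g : ι → MvPolynomial (ι ⊕ ι) R) : s.form c f g = s.form c g f := by
  simp only [form, mul_comm (g _)]
  ring

theorem derivation_form (D : Derivation R (MvPolynomial (ι ⊕ ι) R) (MvPolynomial (ι ⊕ ι) R))
    (f g : ι → MvPolynomial (ι ⊕ ι) R) :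
    D (s.form c f g) = s.form c (fun i => D (f i)) g + s.form c f (fun i => D (g i)) := by
  simp only [form, map_add, map_sum, Derivation.leibniz, derivation_C, smul_eq_mul, mul_zero,
    add_zero, mul_add, Finset.sum_add_distrib, mul_comm (g _) (D _)]
  ring

theorem form_neg_left (f g : ι → MvPolynomial (ι ⊕ ι) R) :
    s.form c (fun i => - f i) g = - s.form c f g := by
  simp only [form, neg_mul, mul_neg, Finset.sum_neg_distrib]
  ring

theorem form_zero_left (g : ι → MvPolynomial (ι ⊕ ι) R) :
    s.form c (fun _ => 0) g = 0 := by
  simp [form]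

theorem derivation_mem_quadIdeal
    (D : Derivation R (MvPolynomial (ι ⊕ ι) R) (MvPolynomial (ι ⊕ ι) R))
    (h1 : D (s.form c (varP ι R) (varP ι R)) ∈ s.quadIdeal c)
    (h2 : D (s.form c (varP ι R) (varQ ι R)) ∈ s.quadIdeal c)
    (h3 : D (s.form c (varQ ι R) (varQ ι R)) ∈ s.quadIdeal c)
    {f : MvPolynomial (ι ⊕ ι) R} (hf : f ∈ s.quadIdeal c) : D f ∈ s.quadIdeal c := by
  have hf' := hf
  rw [quadIdeal, Ideal.span, Submodule.mem_span_triple] at hf'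
  obtain ⟨a, b, e, rfl⟩ := hf'
  simp only [map_add, smul_eq_mul, Derivation.leibniz]
  have m1 : s.form c (varP ι R) (varP ι R) ∈ s.quadIdeal c := Ideal.subset_span (by simp)
  have m2 : s.form c (varP ι R) (varQ ι R) ∈ s.quadIdeal c := Ideal.subset_span (by simp)
  have m3 : s.form c (varQ ι R) (varQ ι R) ∈ s.quadIdeal c := Ideal.subset_span (by simp)
  refine add_mem (add_mem (add_mem ?_ ?_) (add_mem ?_ ?_)) (add_mem ?_ ?_)
  exacts [Ideal.mul_mem_left _ _ h1, Ideal.mul_mem_right _ _ m1, Ideal.mul_mem_left _ _ h2,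
    Ideal.mul_mem_right _ _ m2, Ideal.mul_mem_left _ _ h3, Ideal.mul_mem_right _ _ m3]

/-- The generators p², pq, q² are eigenvectors of q∂_q - p∂_p with eigenvalues -2, 0, 2. -/
theorem transH_mem_quadIdeal (v : MvPolynomial (ι ⊕ ι) R) (m : ℤ) {f : MvPolynomial (ι ⊕ ι) R}
    (hf : f ∈ s.quadIdeal c) : transH v m f ∈ s.quadIdeal c := by
  rw [transH_apply]
  have m1 : s.form c (varP ι R) (varP ι R) ∈ s.quadIdeal c := Ideal.subset_span (by simp)
  have m2 : s.form c (varP ι R) (varQ ι R) ∈ s.quadIdeal c := Ideal.subset_span (by simp)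
  have m3 : s.form c (varQ ι R) (varQ ι R) ∈ s.quadIdeal c := Ideal.subset_span (by simp)
  refine sub_mem (sub_mem (s.derivation_mem_quadIdeal c _ ?_ ?_ ?_ hf) (Ideal.mul_mem_left _ _ hf))
    (zsmul_mem hf _)
  · rw [derivation_form, form_comm s c (varP ι R) fun i => _]
    simp only [derEuler_varP, form_neg_left]
    exact add_mem (neg_mem m1) (neg_mem m1)
  · rw [derivation_form]
    simp only [derEuler_varP, derEuler_varQ, form_neg_left]
    exact add_mem (neg_mem m2) m2
  · rw [derivation_form]
    simp only [derEuler_varQ]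
    exact add_mem m3 m3

/-- The derivation q∂_p sends p² to 2pq, pq to q², and q² to 0. -/
theorem transS_mem_quadIdeal (v : MvPolynomial (ι ⊕ ι) R) {f : MvPolynomial (ι ⊕ ι) R}
    (hf : f ∈ s.quadIdeal c) : transS v f ∈ s.quadIdeal c := by
  rw [transS_apply]
  have m2 : s.form c (varP ι R) (varQ ι R) ∈ s.quadIdeal c := Ideal.subset_span (by simp)
  have m3 : s.form c (varQ ι R) (varQ ι R) ∈ s.quadIdeal c := Ideal.subset_span (by simp)
  refine add_mem (s.derivation_mem_quadIdeal c _ ?_ ?_ ?_ hf) (Ideal.mul_mem_left _ _ hf)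
  · rw [derivation_form, form_comm s c (fun i => _)]
    simp only [derPQ_varP]
    exact add_mem m2 m2
  · rw [derivation_form, form_comm s c (varP ι R) fun i => _]
    simp only [derPQ_varP, derPQ_varQ, form_zero_left, add_zero]
    exact m3
  · rw [derivation_form, form_comm s c (varQ ι R) fun i => _]
    simp only [derPQ_varQ, form_zero_left, add_zero]
    exact zero_mem _

/-! ### Leading terms -/

theorem mul_mem_low {x y z t : ι ⊕ ι} (h1 : s.wt x + s.wt y < s.wt z + s.wt t)
    (h2 : degP x + degP y = degP z + degP t) (h3 : degQ x + degQ y = degQ z + degQ t) :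
    (X x * X y : MvPolynomial (ι ⊕ ι) R) ∈
      low R s.wt degP degQ (Finsupp.single z 1 + Finsupp.single t 1) := by
  rw [X, X, monomial_mul]
  refine monomial_mem_low ?_ _
  simp only [lowSet, Set.mem_ofPred_eq, map_add, Finsupp.weight_single, smul_eq_mul, one_mul]
  omega

theorem sum_mem_low {f g : ι → ι ⊕ ι} {z t : ι ⊕ ι}
    (h : ∀ i, i ≠ s.i0 → i ≠ s.i1 → i ≠ s.i2 → s.wt (f i) + s.wt (g i) < s.wt z + s.wt t ∧
      degP (f i) + degP (g i) = degP z + degP t ∧ degQ (f i) + degQ (g i) = degQ z + degQ t) :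
    (∑ i ∈ Finset.univ.filter fun i => i ≠ s.i0 ∧ i ≠ s.i1 ∧ i ≠ s.i2,
      C (c i) * (X (f i) * X (g i)) : MvPolynomial (ι ⊕ ι) R) ∈
      low R s.wt degP degQ (Finsupp.single z 1 + Finsupp.single t 1) := by
  refine sum_mem fun i hi => ?_
  obtain ⟨h0, h1, h2⟩ := (Finset.mem_filter.1 hi).2
  obtain ⟨h3, h4, h5⟩ := h i h0 h1 h2
  rw [← smul_eq_C_mul]
  exact Submodule.smul_mem _ _ (s.mul_mem_low h3 h4 h5)

theorem hasLead_mulLeft_of_eq {f g : MvPolynomial (ι ⊕ ι) R} {z t : ι ⊕ ι}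
    (h : f = X z * X t + g)
    (hg : g ∈ low R s.wt degP degQ (Finsupp.single z 1 + Finsupp.single t 1)) :
    HasLead s.wt degP degQ (LinearMap.mulLeft R f)
      (Finsupp.single z 1 + Finsupp.single t 1) 1 := by
  refine hasLead_mulLeft ?_
  rwa [h, X, X, monomial_mul, one_mul, add_sub_cancel_left]

/-- The values of `wt` single out one monomial in each form: p₂² of weight 10 against 9 and 8 in p²,
p₀q₁ of weight 9 against 7, 5 and 3 in pq, q₂² of weight 4 against 3 and 2 in q². No variable is
shared by these three monomials and p_V, q_V. -/
theorem hasLead_formPP : HasLead s.wt degP degQ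
    (LinearMap.mulLeft R (s.form c (varP ι R) (varP ι R)))
    (Finsupp.single (Sum.inl s.i2) 1 + Finsupp.single (Sum.inl s.i2) 1) 1 := by
  have h12 := s.ne12.symm
  have h02 := s.ne02.symm
  have h01 := s.ne01.symm
  refine s.hasLead_mulLeft_of_eq (g := X (Sum.inl s.i0) * X (Sum.inl s.i1) +
    X (Sum.inl s.i1) * X (Sum.inl s.i0) + _) ?_ (add_mem (add_mem (s.mul_mem_low ?_ rfl rfl)
      (s.mul_mem_low ?_ rfl rfl)) (s.sum_mem_low c (f := Sum.inl) (g := Sum.inl) ?_))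
  · simp only [form, varP]
    ring
  · simp [wt, *]
  · simp [wt, *]
  · intro i h0 h1 h2
    simp [wt, degP, degQ, *]

theorem hasLead_formPQ : HasLead s.wt degP degQ
    (LinearMap.mulLeft R (s.form c (varP ι R) (varQ ι R)))
    (Finsupp.single (Sum.inl s.i0) 1 + Finsupp.single (Sum.inr s.i1) 1) 1 := by
  have h12 := s.ne12.symm
  have h02 := s.ne02.symm
  have h01 := s.ne01.symm
  refine s.hasLead_mulLeft_of_eq (g := X (Sum.inl s.i1) * X (Sum.inr s.i0) +
    X (Sum.inl s.i2) * X (Sum.inr s.i2) + _) ?_ (add_mem (add_mem (s.mul_mem_low ?_ rfl rfl)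
      (s.mul_mem_low ?_ rfl rfl)) (s.sum_mem_low c (f := Sum.inl) (g := Sum.inr) ?_))
  · simp only [form, varP, varQ]
    ring
  · simp [wt, *]
  · simp [wt, *]
  · intro i h0 h1 h2
    simp [wt, degP, degQ, *]

theorem hasLead_formQQ : HasLead s.wt degP degQ
    (LinearMap.mulLeft R (s.form c (varQ ι R) (varQ ι R)))
    (Finsupp.single (Sum.inr s.i2) 1 + Finsupp.single (Sum.inr s.i2) 1) 1 := by
  have h12 := s.ne12.symm
  have h02 := s.ne02.symm
  have h01 := s.ne01.symm
  refine s.hasLead_mulLeft_of_eq (g := X (Sum.inr s.i0) * X (Sum.inr s.i1) +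
    X (Sum.inr s.i1) * X (Sum.inr s.i0) + _) ?_ (add_mem (add_mem (s.mul_mem_low ?_ rfl rfl)
      (s.mul_mem_low ?_ rfl rfl)) (s.sum_mem_low c (f := Sum.inr) (g := Sum.inr) ?_))
  · simp only [form, varQ]
    ring
  · simp [wt, *]
  · simp [wt, *]
  · intro i h0 h1 h2
    simp [wt, degP, degQ, *]

theorem derivation_monomial_mem {N : Submodule R (MvPolynomial (ι ⊕ ι) R)}
    (f : ι ⊕ ι → MvPolynomial (ι ⊕ ι) R) (γ : ι ⊕ ι →₀ ℕ)
    (h : ∀ x γ', γ = γ' + Finsupp.single x 1 → monomial γ' 1 * f x ∈ N) :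
    mkDerivation R f (monomial γ 1) ∈ N := by
  rw [mkDerivation_monomial, one_smul]
  refine sum_mem fun x hx => ?_
  have h1 : γ x ≠ 0 := Finsupp.mem_support_iff.1 hx
  have h2 := h x (γ - Finsupp.single x 1) (by
    rw [tsub_add_cancel_of_le]
    rw [Finsupp.single_le_iff]
    omega)
  have h3 := N.smul_mem (γ x : R) h2
  rwa [← smul_mul_assoc, smul_monomial, smul_eq_mul, mul_one] at h3

/-- The Euler operator and the constant only rescale a monomial, while p_V adds weight 4 and one
unit of p-degree. -/
theorem hasLead_transH (m : ℤ) :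
    HasLead s.wt degP degQ (transH (varP ι R s.iV) m) (Finsupp.single (Sum.inl s.iV) 1) (-1) := by
  intro γ
  have hlow : γ ∈ lowSet s.wt degP degQ (γ + Finsupp.single (Sum.inl s.iV) 1) := by
    simp [lowSet, Finsupp.weight_single, wt, degP, degQ, s.ne0V.symm, s.ne1V.symm, s.ne2V.symm]
  have e : transH (varP ι R s.iV) m (monomial γ 1) -
      (-1 : R) • monomial (γ + Finsupp.single (Sum.inl s.iV) 1) 1 =
      derEuler ι R (monomial γ 1) - m • monomial γ 1 := by
    rw [transH_apply, varP, X, monomial_mul, add_comm (Finsupp.single _ _), neg_smul, one_smul,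
      one_mul]
    abel
  rw [e]
  refine sub_mem (derivation_monomial_mem _ _ fun x γ' h => ?_)
    (zsmul_mem (monomial_mem_low hlow _) _)
  rcases x with i | i
  · rw [Sum.elim_inl, varP, mul_neg, X, monomial_mul, ← h]
    exact neg_mem (monomial_mem_low hlow _)
  · rw [Sum.elim_inr, varQ, X, monomial_mul, ← h]
    exact monomial_mem_low hlow _

/-- Replacing p_i by q_i changes the weight by -6, 0 or -3, while q_V adds 1, so multiplication by
q_V dominates. The replacement lowers the p-degree and raises the q-degree by one, in agreement with
the inequalities in `lowSet`. -/
theorem hasLead_transS :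
    HasLead s.wt degP degQ (transS (varQ ι R s.iV)) (Finsupp.single (Sum.inr s.iV) 1) 1 := by
  intro γ
  have e : transS (varQ ι R s.iV) (monomial γ 1) -
      (1 : R) • monomial (γ + Finsupp.single (Sum.inr s.iV) 1) 1 = derPQ ι R (monomial γ 1) := by
    rw [transS_apply, varQ, X, monomial_mul, add_comm (Finsupp.single _ _)]
    simp
  rw [e]
  refine derivation_monomial_mem _ _ fun x γ' h => ?_
  rcases x with i | i
  · rw [Sum.elim_inl, varQ, X, monomial_mul]
    refine monomial_mem_low ?_ _
    rw [h]
    have := s.ne01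
    have := s.ne02
    have := s.ne12
    simp only [lowSet, Set.mem_ofPred_eq, map_add, Finsupp.weight_single, wt, degP, degQ,
      Sum.elim_inl, Sum.elim_inr, s.ne0V.symm, s.ne1V.symm, s.ne2V.symm, smul_eq_mul, if_false]
    refine ⟨?_, by omega, by omega⟩
    split_ifs <;> omega
  · simp

end NullFrameIndices

end NullFrame

/-! ### A basis adapted to the constraints, and division by p_V and q_V. -/

section Staircase

open MvPolynomial

variable {ι R : Type*} [Fintype ι] [DecidableEq ι] [CommRing R]

theorem linearMap_ext_monomial {σ M : Type*} [AddCommGroup M] [Module R M]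
    {X Y : MvPolynomial σ R →ₗ[R] M} (h : ∀ γ, X (monomial γ 1) = Y (monomial γ 1)) : X = Y :=
  (basisMonomials σ R).ext fun γ => by simpa using h γ

theorem mem_of_monomial_mem {σ M : Type*} [AddCommGroup M] [Module R M] {N : Submodule R M}
    (X : MvPolynomial σ R →ₗ[R] M) (h : ∀ γ, X (monomial γ 1) ∈ N) (f : MvPolynomial σ R) :
    X f ∈ N := by
  have h1 : N.mkQ ∘ₗ X = 0 := linearMap_ext_monomial fun γ => by
    simpa using h γ
  have h2 := LinearMap.congr_fun h1 f
  simpa using h2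

/-- Division by the variable `X x`, discarding the monomials that are not divisible by it. -/
def divX (x : ι ⊕ ι) : Module.End R (MvPolynomial (ι ⊕ ι) R) :=
  (basisMonomials (ι ⊕ ι) R).constr R fun γ =>
    if γ x = 0 then 0 else monomial (γ - Finsupp.single x 1) 1

theorem divX_monomial (x : ι ⊕ ι) (γ : ι ⊕ ι →₀ ℕ) : divX (R := R) x (monomial γ 1) =
    if γ x = 0 then 0 else monomial (γ - Finsupp.single x 1) 1 := by
  have := (basisMonomials (ι ⊕ ι) R).constr_basis R (fun γ : ι ⊕ ι →₀ ℕ =>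
    if γ x = 0 then 0 else (monomial (γ - Finsupp.single x 1) 1 : MvPolynomial (ι ⊕ ι) R)) γ
  rwa [coe_basisMonomials] at this

theorem divX_X_mul (x : ι ⊕ ι) (f : MvPolynomial (ι ⊕ ι) R) : divX x (X x * f) = f := by
  have : divX x ∘ₗ LinearMap.mulLeft R (X x) = (LinearMap.id : Module.End R _) := by
    refine linearMap_ext_monomial fun γ => ?_
    simp only [LinearMap.comp_apply, LinearMap.mulLeft_apply, LinearMap.id_apply, X, monomial_mul,
      one_mul, divX_monomial]
    simp
  exact LinearMap.congr_fun this f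

theorem divX_X_mul_of_ne {x y : ι ⊕ ι} (h : x ≠ y) (f : MvPolynomial (ι ⊕ ι) R) :
    divX x (X y * f) = X y * divX x f := by
  have : divX x ∘ₗ LinearMap.mulLeft R (X y) =
      LinearMap.mulLeft R (X y : MvPolynomial (ι ⊕ ι) R) ∘ₗ divX x := by
    refine linearMap_ext_monomial fun γ => ?_
    simp only [LinearMap.comp_apply, LinearMap.mulLeft_apply, X, monomial_mul,
      one_mul, divX_monomial]
    by_cases h0 : γ x = 0
    · simp [h0, h.symm]
    · have h1 : Finsupp.single x 1 ≤ γ := by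
        rw [Finsupp.single_le_iff]
        omega
      have h2 : (Finsupp.single y 1 + γ : ι ⊕ ι →₀ ℕ) x ≠ 0 := by
        simp [h0]
      rw [if_neg h0, if_neg h2, monomial_mul, one_mul, add_tsub_assoc_of_le h1]
  exact LinearMap.congr_fun this f

theorem divX_inl_mem_degreeSpan (i : ι) {n t : ℕ} {f : MvPolynomial (ι ⊕ ι) R}
    (hf : f ∈ degreeSpan R degP degQ n t) :
    divX (Sum.inl i) f ∈ degreeSpan R degP degQ n t := by
  refine degreeSpan_induction (divX (Sum.inl i)) (fun δ h1 h2 => ?_) hf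
  rw [divX_monomial]
  split_ifs with h
  · exact zero_mem _
  · obtain ⟨δ, rfl⟩ : ∃ ε, δ = Finsupp.single (Sum.inl i) 1 + ε :=
      le_iff_exists_add.1 (Finsupp.single_le_iff.2 (Nat.one_le_iff_ne_zero.2 h))
    rw [add_tsub_cancel_left]
    simp only [map_add, Finsupp.weight_single, degP, degQ, Sum.elim_inl, smul_eq_mul] at h1 h2
    exact monomial_mem_degreeSpan (by simp only [degP]; omega) (by simp only [degQ]; omega) _

theorem divX_inr_mem_degreeSpan (i : ι) {n t : ℕ} {f : MvPolynomial (ι ⊕ ι) R}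
    (hf : f ∈ degreeSpan R degP degQ n (t + 1)) :
    divX (Sum.inr i) f ∈ degreeSpan R degP degQ n t := by
  refine degreeSpan_induction (divX (Sum.inr i)) (fun δ h1 h2 => ?_) hf
  rw [divX_monomial]
  split_ifs with h
  · exact zero_mem _
  · obtain ⟨δ, rfl⟩ : ∃ ε, δ = Finsupp.single (Sum.inr i) 1 + ε :=
      le_iff_exists_add.1 (Finsupp.single_le_iff.2 (Nat.one_le_iff_ne_zero.2 h))
    rw [add_tsub_cancel_left]
    simp only [map_add, Finsupp.weight_single, degP, degQ, Sum.elim_inr, smul_eq_mul] at h1 h2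
    exact monomial_mem_degreeSpan (by simp only [degP]; omega) (by simp only [degQ]; omega) _

namespace NullFrameIndices

variable (s : NullFrameIndices ι) (c : ι → R)

/-- The part of an exponent that is accounted for by the leading terms of the constraints. -/
def leadPart (γ : ι ⊕ ι →₀ ℕ) : ι ⊕ ι →₀ ℕ :=
  γ (Sum.inr s.iV) • Finsupp.single (Sum.inr s.iV) 1 +
  γ (Sum.inl s.iV) • Finsupp.single (Sum.inl s.iV) 1 +
  (γ (Sum.inr s.i2) / 2) • (Finsupp.single (Sum.inr s.i2) 1 + Finsupp.single (Sum.inr s.i2) 1) +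
  min (γ (Sum.inl s.i0)) (γ (Sum.inr s.i1)) •
    (Finsupp.single (Sum.inl s.i0) 1 + Finsupp.single (Sum.inr s.i1) 1) +
  (γ (Sum.inl s.i2) / 2) • (Finsupp.single (Sum.inl s.i2) 1 + Finsupp.single (Sum.inl s.i2) 1)

/-- The product of powers of the constraints whose leading term is `leadPart γ`. -/
def thetaOp (m : ℤ) (γ : ι ⊕ ι →₀ ℕ) : Module.End R (MvPolynomial (ι ⊕ ι) R) :=
  LinearMap.mulLeft R (s.form c (varP ι R) (varP ι R)) ^ (γ (Sum.inl s.i2) / 2) *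
  (LinearMap.mulLeft R (s.form c (varP ι R) (varQ ι R)) ^
    min (γ (Sum.inl s.i0)) (γ (Sum.inr s.i1)) *
  (LinearMap.mulLeft R (s.form c (varQ ι R) (varQ ι R)) ^ (γ (Sum.inr s.i2) / 2) *
  (transH (varP ι R s.iV) m ^ γ (Sum.inl s.iV) * transS (varQ ι R s.iV) ^ γ (Sum.inr s.iV))))

/-- The change of basis from monomials to products of powers of the constraints, applied to
monomials that are not divisible by any leading term. -/
def theta (m : ℤ) : Module.End R (MvPolynomial (ι ⊕ ι) R) :=
  (basisMonomials (ι ⊕ ι) R).constr R fun γ => s.thetaOp c m γ (monomial (γ - s.leadPart γ) 1)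

theorem theta_monomial (m : ℤ) (γ : ι ⊕ ι →₀ ℕ) :
    s.theta c m (monomial γ 1) = s.thetaOp c m γ (monomial (γ - s.leadPart γ) 1) := by
  have := (basisMonomials (ι ⊕ ι) R).constr_basis R
    (fun γ => s.thetaOp c m γ (monomial (γ - s.leadPart γ) 1)) γ
  rwa [coe_basisMonomials] at this

/-- The five leading monomials involve distinct variables, so their maximal powers can be split off
simultaneously. -/
theorem leadPart_le (γ : ι ⊕ ι →₀ ℕ) : s.leadPart γ ≤ γ := by
  have h12 := s.ne12
  have h02 := s.ne02
  have h0V := s.ne0V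
  have h1V := s.ne1V
  have h2V := s.ne2V
  have h12' := h12.symm
  have h02' := h02.symm
  have h0V' := h0V.symm
  have h1V' := h1V.symm
  have h2V' := h2V.symm
  intro x
  rcases x with x | x
  · simp only [leadPart, Finsupp.add_apply, Finsupp.smul_apply, Finsupp.single_apply, smul_eq_mul,
      Sum.inl.injEq, reduceCtorEq, if_false]
    split_ifs with a b e e <;> subst_vars <;> first | contradiction | omega
  · simp only [leadPart, Finsupp.add_apply, Finsupp.smul_apply, Finsupp.single_apply, smul_eq_mul,
      Sum.inr.injEq, reduceCtorEq, if_false]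
    split_ifs with a b e e <;> subst_vars <;> first | contradiction | omega

/-- Leading terms multiply under composition. The unit is a power of -1 and comes from the factors
`transH`. -/
theorem hasLead_thetaOp (m : ℤ) (γ : ι ⊕ ι →₀ ℕ) :
    ∃ u, IsUnit u ∧ HasLead s.wt degP degQ (s.thetaOp c m γ) (s.leadPart γ) u :=
  ⟨_, by simp only [one_pow, one_mul, mul_one]; exact isUnit_one.neg.pow _,
    ((s.hasLead_formPP c).pow _).mul (((s.hasLead_formPQ c).pow _).mul
    (((s.hasLead_formQQ c).pow _).mul (((s.hasLead_transH m).pow _).mul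
    ((s.hasLead_transS).pow _))))⟩

theorem isTriangular_theta (m : ℤ) : IsTriangular s.wt degP degQ (s.theta c m) := by
  intro γ
  obtain ⟨u, hu, h⟩ := s.hasLead_thetaOp c m γ
  have h1 := h (γ - s.leadPart γ)
  rw [tsub_add_cancel_of_le (s.leadPart_le γ), ← theta_monomial] at h1
  exact ⟨u, hu, h1⟩

/-- `theta` as an equivalence. -/
def thetaEquiv (m : ℤ) : MvPolynomial (ι ⊕ ι) R ≃ₗ[R] MvPolynomial (ι ⊕ ι) R :=
  triangularEquiv (s.isTriangular_theta c m)

theorem thetaEquiv_apply (m : ℤ) (f : MvPolynomial (ι ⊕ ι) R) :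
    s.thetaEquiv c m f = s.theta c m f := rfl

/-- Under `theta`, multiplication by a leading monomial becomes multiplication by the constraint
that it leads. The residual monomial is unchanged because `leadPart` absorbs δ. -/
theorem theta_mul_of_monomial {m : ℤ} {g : MvPolynomial (ι ⊕ ι) R} {δ : ι ⊕ ι →₀ ℕ}
    (h1 : ∀ γ, s.thetaOp c m (γ + δ) = LinearMap.mulLeft R g * s.thetaOp c m γ)
    (h2 : ∀ γ, s.leadPart (γ + δ) = s.leadPart γ + δ) (f : MvPolynomial (ι ⊕ ι) R) :
    s.theta c m (monomial δ 1 * f) = g * s.theta c m f := by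
  have : s.theta c m ∘ₗ LinearMap.mulLeft R (monomial δ 1) =
      LinearMap.mulLeft R g ∘ₗ s.theta c m := by
    refine linearMap_ext_monomial fun γ => ?_
    simp only [LinearMap.comp_apply, LinearMap.mulLeft_apply, monomial_mul, one_mul,
      theta_monomial]
    rw [add_comm δ, h1, h2, add_tsub_add_eq_tsub_right]
    rfl
  exact LinearMap.congr_fun this f

theorem theta_formPP (m : ℤ) (f : MvPolynomial (ι ⊕ ι) R) :
    s.theta c m (monomial (Finsupp.single (Sum.inl s.i2) 1 + Finsupp.single (Sum.inl s.i2) 1) 1 * f)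
      = s.form c (varP ι R) (varP ι R) * s.theta c m f := by
  have h12 := s.ne12
  have h02 := s.ne02
  have h2V := s.ne2V
  refine s.theta_mul_of_monomial c (fun γ => ?_) (fun γ => ?_) f
  · simp only [thetaOp, Finsupp.add_apply, Finsupp.single_apply, Sum.inl.injEq, reduceCtorEq,
      if_false, if_true, h02.symm, h2V, add_zero]
    rw [show (γ (Sum.inl s.i2) + (1 + 1)) / 2 = γ (Sum.inl s.i2) / 2 + 1 by omega, pow_succ',
      mul_assoc]
  · simp only [leadPart, Finsupp.add_apply, Finsupp.single_apply, Sum.inl.injEq, reduceCtorEq,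
      if_false, if_true, h02.symm, h2V, add_zero]
    rw [show (γ (Sum.inl s.i2) + (1 + 1)) / 2 = γ (Sum.inl s.i2) / 2 + 1 by omega, succ_nsmul]
    abel

theorem theta_formPQ (m : ℤ) (f : MvPolynomial (ι ⊕ ι) R) :
    s.theta c m (monomial (Finsupp.single (Sum.inl s.i0) 1 + Finsupp.single (Sum.inr s.i1) 1) 1 * f)
      = s.form c (varP ι R) (varQ ι R) * s.theta c m f := by
  have h12 := s.ne12
  have h02 := s.ne02
  have h0V := s.ne0V
  have h1V := s.ne1V
  refine s.theta_mul_of_monomial c (fun γ => ?_) (fun γ => ?_) f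
  · simp only [thetaOp, Finsupp.add_apply, Finsupp.single_apply, Sum.inl.injEq, Sum.inr.injEq,
      reduceCtorEq, if_false, if_true, h02, h12, h0V, h1V, add_zero, zero_add]
    rw [min_add_add_right, pow_succ', mul_assoc, ← mul_assoc, ← mul_assoc (LinearMap.mulLeft R _)]
    congr 1
    refine (Commute.pow_left ?_ _).eq
    exact LinearMap.ext fun f => mul_left_comm _ _ _
  · simp only [leadPart, Finsupp.add_apply, Finsupp.single_apply, Sum.inl.injEq, Sum.inr.injEq,
      reduceCtorEq, if_false, if_true, h02, h12, h0V, h1V, add_zero, zero_add]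
    rw [min_add_add_right, succ_nsmul]
    abel

theorem theta_formQQ (m : ℤ) (f : MvPolynomial (ι ⊕ ι) R) :
    s.theta c m (monomial (Finsupp.single (Sum.inr s.i2) 1 + Finsupp.single (Sum.inr s.i2) 1) 1 * f)
      = s.form c (varQ ι R) (varQ ι R) * s.theta c m f := by
  have h12 := s.ne12
  have h02 := s.ne02
  have h2V := s.ne2V
  refine s.theta_mul_of_monomial c (fun γ => ?_) (fun γ => ?_) f
  · simp only [thetaOp, Finsupp.add_apply, Finsupp.single_apply, Sum.inr.injEq, reduceCtorEq,
      if_false, if_true, h12.symm, h2V, add_zero]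
    rw [show (γ (Sum.inr s.i2) + (1 + 1)) / 2 = γ (Sum.inr s.i2) / 2 + 1 by omega, pow_succ']
    have hc : ∀ (a b : MvPolynomial (ι ⊕ ι) R) (n : ℕ),
        Commute (LinearMap.mulLeft R a ^ n) (LinearMap.mulLeft R b) := fun a b n =>
      Commute.pow_left (LinearMap.ext fun f => mul_left_comm _ _ _) _
    rw [mul_assoc (LinearMap.mulLeft R (s.form c (varQ ι R) (varQ ι R))), (hc _ _ _).left_comm,
      (hc _ _ _).left_comm]
  · simp only [leadPart, Finsupp.add_apply, Finsupp.single_apply, Sum.inr.injEq, reduceCtorEq,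
      if_false, if_true, h12.symm, h2V, add_zero]
    rw [show (γ (Sum.inr s.i2) + (1 + 1)) / 2 = γ (Sum.inr s.i2) / 2 + 1 by omega, succ_nsmul]
    abel

/-- The exponents that are divisible by the leading term of a quadratic constraint. -/
def leadSet : Set (ι ⊕ ι →₀ ℕ) :=
  {γ | 2 ≤ γ (Sum.inl s.i2) ∨ 2 ≤ γ (Sum.inr s.i2) ∨ (1 ≤ γ (Sum.inl s.i0) ∧ 1 ≤ γ (Sum.inr s.i1))}

theorem monomial_mul_mem_leadSpan {δ : ι ⊕ ι →₀ ℕ} (hδ : δ ∈ s.leadSet)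
    (f : MvPolynomial (ι ⊕ ι) R) : monomial δ 1 * f ∈ restrictSupport R s.leadSet := by
  refine mem_of_monomial_mem (LinearMap.mulLeft R (monomial δ 1)) (fun γ => ?_) f
  rw [LinearMap.mulLeft_apply, monomial_mul]
  refine (monomial_mem_restrictSupport R).2 (Or.inl ?_)
  simp only [leadSet, Set.mem_ofPred_eq, Finsupp.add_apply] at hδ ⊢
  omega

theorem theta_monomial_mem_quadIdeal (m : ℤ) {γ : ι ⊕ ι →₀ ℕ} (hγ : γ ∈ s.leadSet) :
    s.theta c m (monomial γ 1) ∈ s.quadIdeal c := by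
  have h02 := s.ne02
  have h12 := s.ne12
  have key : ∀ δ g, g ∈ s.quadIdeal c → δ ≤ γ →
      (∀ f, s.theta c m (monomial δ 1 * f) = g * s.theta c m f) →
      s.theta c m (monomial γ 1) ∈ s.quadIdeal c := by
    intro δ g hg hle h
    have h1 := h (monomial (γ - δ) 1)
    rw [monomial_mul, one_mul, add_tsub_cancel_of_le hle] at h1
    rw [h1]
    exact Ideal.mul_mem_right _ _ hg
  rcases hγ with h | h | h
  · refine key _ _ (Ideal.subset_span (by simp)) ?_ (s.theta_formPP c m)
    rw [← Finsupp.single_add, Finsupp.single_le_iff]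
    exact h
  · refine key _ _ (Ideal.subset_span (by simp)) ?_ (s.theta_formQQ c m)
    rw [← Finsupp.single_add, Finsupp.single_le_iff]
    exact h
  · refine key _ _ (Ideal.subset_span (by simp)) ?_ (s.theta_formPQ c m)
    intro x
    simp only [Finsupp.add_apply, Finsupp.single_apply]
    split_ifs <;> subst_vars <;> first | contradiction | omega

/-- In the new coordinates the ideal is spanned by monomials: every element a p² + b pq + e q² can
be rewritten, after replacing a, b, e by their preimages, as the image of a combination of multiples
of the leading monomials. Operators can thus be tested on the ideal monomial by monomial. -/
theorem thetaEquiv_mem_quadIdeal (m : ℤ) (f : MvPolynomial (ι ⊕ ι) R) :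
    s.thetaEquiv c m f ∈ s.quadIdeal c ↔ f ∈ restrictSupport R s.leadSet := by
  constructor
  · intro h
    rw [quadIdeal, Ideal.span, Submodule.mem_span_triple] at h
    obtain ⟨a, b, e, h⟩ := h
    obtain ⟨a, rfl⟩ := (s.thetaEquiv c m).surjective a
    obtain ⟨b, rfl⟩ := (s.thetaEquiv c m).surjective b
    obtain ⟨e, rfl⟩ := (s.thetaEquiv c m).surjective e
    simp only [smul_eq_mul, thetaEquiv_apply] at h
    rw [mul_comm, mul_comm _ (s.form c _ _), mul_comm _ (s.form c _ _), ← theta_formPP,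
      ← theta_formPQ, ← theta_formQQ, ← map_add, ← map_add, ← thetaEquiv_apply,
      ← thetaEquiv_apply] at h
    rw [← (s.thetaEquiv c m).injective h]
    refine add_mem (add_mem ?_ ?_) ?_ <;> refine s.monomial_mul_mem_leadSpan ?_ _ <;>
      simp [leadSet]
  · intro h
    rw [restrictSupport_eq_span] at h
    refine (Submodule.span_le (p := ((s.quadIdeal c).restrictScalars R).comap
      (s.thetaEquiv c m).toLinearMap)).2 ?_ h
    rintro _ ⟨γ, hγ, rfl⟩
    exact s.theta_monomial_mem_quadIdeal c m hγ

theorem thetaOp_of_not_mem (m : ℤ) {γ : ι ⊕ ι →₀ ℕ} (hγ : γ ∉ s.leadSet) :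
    s.thetaOp c m γ = transH (varP ι R s.iV) m ^ γ (Sum.inl s.iV) *
      transS (varQ ι R s.iV) ^ γ (Sum.inr s.iV) := by
  simp only [leadSet, Set.mem_ofPred_eq, not_or] at hγ
  rw [thetaOp, show γ (Sum.inl s.i2) / 2 = 0 by omega, show γ (Sum.inr s.i2) / 2 = 0 by omega,
    show min (γ (Sum.inl s.i0)) (γ (Sum.inr s.i1)) = 0 by omega]
  simp

theorem leadSet_add_single {x : ι ⊕ ι} (h1 : x ≠ Sum.inl s.i2) (h2 : x ≠ Sum.inr s.i2)
    (h3 : x ≠ Sum.inl s.i0) (h4 : x ≠ Sum.inr s.i1) (γ : ι ⊕ ι →₀ ℕ) :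
    γ + Finsupp.single x 1 ∈ s.leadSet ↔ γ ∈ s.leadSet := by
  simp [leadSet, h1, h2, h3, h4]

theorem divX_mem_leadSpan {x : ι ⊕ ι} (h1 : x ≠ Sum.inl s.i2) (h2 : x ≠ Sum.inr s.i2)
    (h3 : x ≠ Sum.inl s.i0) (h4 : x ≠ Sum.inr s.i1) {f : MvPolynomial (ι ⊕ ι) R}
    (hf : f ∈ restrictSupport R s.leadSet) : divX x f ∈ restrictSupport R s.leadSet := by
  rw [restrictSupport_eq_span] at hf
  refine (Submodule.span_le (p := (restrictSupport R s.leadSet).comap (divX x))).2 ?_ hf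
  rintro _ ⟨γ, hγ, rfl⟩
  rw [SetLike.mem_coe, Submodule.mem_comap, divX_monomial]
  split_ifs with h
  · exact zero_mem _
  · refine (monomial_mem_restrictSupport R).2 (Or.inl ?_)
    rw [← s.leadSet_add_single h1 h2 h3 h4, tsub_add_cancel_of_le]
    · exact hγ
    · exact Finsupp.single_le_iff.2 (Nat.one_le_iff_ne_zero.2 h)

theorem leadPart_add_inl (γ : ι ⊕ ι →₀ ℕ) :
    s.leadPart (γ + Finsupp.single (Sum.inl s.iV) 1) =
      s.leadPart γ + Finsupp.single (Sum.inl s.iV) 1 := by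
  simp only [leadPart, Finsupp.add_apply, Finsupp.single_apply, Sum.inl.injEq,
    reduceCtorEq, if_false, if_true, s.ne0V.symm, s.ne2V.symm, add_zero, succ_nsmul]
  abel

theorem leadPart_add_inr (γ : ι ⊕ ι →₀ ℕ) :
    s.leadPart (γ + Finsupp.single (Sum.inr s.iV) 1) =
      s.leadPart γ + Finsupp.single (Sum.inr s.iV) 1 := by
  simp only [leadPart, Finsupp.add_apply, Finsupp.single_apply, Sum.inr.injEq,
    reduceCtorEq, if_false, if_true, s.ne1V.symm, s.ne2V.symm, add_zero, succ_nsmul]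
  abel

/-- On exponents outside `leadSet` the operator `transH` stands leftmost in `thetaOp`, so equality
is exact; on the others both terms lie in the ideal. -/
theorem transH_theta (m : ℤ) (f : MvPolynomial (ι ⊕ ι) R) :
    transH (varP ι R s.iV) m (s.theta c m f) - s.theta c m (varP ι R s.iV * f)
      ∈ s.quadIdeal c := by
  refine mem_of_monomial_mem (N := (s.quadIdeal c).restrictScalars R)
    (transH (varP ι R s.iV) m ∘ₗ s.theta c m -
    s.theta c m ∘ₗ LinearMap.mulLeft R (varP ι R s.iV)) (fun γ => ?_) f
  have hV := fun γ => s.leadSet_add_single (x := Sum.inl s.iV) (by simp [s.ne2V.symm]) (by simp)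
    (by simp [s.ne0V.symm]) (by simp) γ
  simp only [LinearMap.sub_apply, LinearMap.comp_apply, LinearMap.mulLeft_apply, varP, X,
    monomial_mul, one_mul, Submodule.restrictScalars_mem]
  rw [add_comm (Finsupp.single _ _)]
  by_cases h : γ ∈ s.leadSet
  · exact sub_mem (s.transH_mem_quadIdeal c _ m (s.theta_monomial_mem_quadIdeal c m h))
      (s.theta_monomial_mem_quadIdeal c m ((hV γ).2 h))
  · rw [theta_monomial, theta_monomial, s.thetaOp_of_not_mem c m h,
      s.thetaOp_of_not_mem c m (fun h' => h ((hV γ).1 h')), leadPart_add_inl,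
      add_tsub_add_eq_tsub_right]
    simp only [Finsupp.add_apply, Finsupp.single_apply, reduceCtorEq, if_false, if_true, add_zero,
      pow_succ', Module.End.mul_apply]
    simp only [varP, X]
    rw [sub_self]
    exact zero_mem _

/-- Outside `leadSet`, the two terms agree if no factor `transH` is present. Otherwise
`transS_transH` moves `transS` past one such factor, shifting its parameter from m - 2 to m, and
both terms lie in the range of `transH`. -/
theorem transS_theta (m : ℤ) (f : MvPolynomial (ι ⊕ ι) R) :
    transS (varQ ι R s.iV) (s.theta c (m - 2) f) - s.theta c m (varQ ι R s.iV * f)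
      ∈ (s.quadIdeal c).restrictScalars R ⊔ LinearMap.range (transH (varP ι R s.iV) m) := by
  refine mem_of_monomial_mem
    (transS (varQ ι R s.iV) ∘ₗ s.theta c (m - 2) -
    s.theta c m ∘ₗ LinearMap.mulLeft R (varQ ι R s.iV)) (fun γ => ?_) f
  have hV := fun γ => s.leadSet_add_single (x := Sum.inr s.iV) (by simp) (by simp [s.ne2V.symm])
    (by simp) (by simp [s.ne1V.symm]) γ
  simp only [LinearMap.sub_apply, LinearMap.comp_apply, LinearMap.mulLeft_apply, varQ, X,
    monomial_mul, one_mul]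
  rw [add_comm (Finsupp.single _ _)]
  by_cases h : γ ∈ s.leadSet
  · refine Submodule.mem_sup_left (sub_mem ?_ ?_)
    · exact s.transS_mem_quadIdeal c _ (s.theta_monomial_mem_quadIdeal c _ h)
    · exact s.theta_monomial_mem_quadIdeal c m ((hV γ).2 h)
  · rw [theta_monomial, theta_monomial, s.thetaOp_of_not_mem c _ h,
      s.thetaOp_of_not_mem c m (fun h' => h ((hV γ).1 h')), leadPart_add_inr,
      add_tsub_add_eq_tsub_right]
    simp only [Finsupp.add_apply, Finsupp.single_apply, reduceCtorEq, if_false, if_true, add_zero,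
      pow_succ' (transS _), Module.End.mul_apply]
    rcases γ (Sum.inl s.iV) with _ | k
    · simp only [pow_zero, Module.End.one_apply, varQ, X]
      rw [sub_self]
      exact zero_mem _
    · refine Submodule.mem_sup_right (sub_mem ?_ ?_)
      · rw [pow_succ', Module.End.mul_apply]
        have e := transS_transH (R := R) (derPQ_varP s.iV) (derEuler_varQ s.iV) m
        simp only [varQ, X, varP] at e ⊢
        rw [e]
        exact ⟨_, rfl⟩
      · rw [pow_succ', Module.End.mul_apply]
        exact ⟨_, rfl⟩

/-! ### Left inverses of the transposed constraints -/

/-- A left inverse of `transH` modulo the quadratic constraints. -/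
def leftInvH (m : ℤ) : Module.End R (MvPolynomial (ι ⊕ ι) R) :=
  (s.thetaEquiv c m).toLinearMap ∘ₗ divX (Sum.inl s.iV) ∘ₗ (s.thetaEquiv c m).symm.toLinearMap

/-- A left inverse of `transS` modulo the quadratic constraints and `transH`. -/
def leftInvS (m : ℤ) : Module.End R (MvPolynomial (ι ⊕ ι) R) :=
  (s.thetaEquiv c (m - 2)).toLinearMap ∘ₗ divX (Sum.inr s.iV) ∘ₗ
    (s.thetaEquiv c m).symm.toLinearMap

theorem leftInvH_mem_quadIdeal (m : ℤ) {f : MvPolynomial (ι ⊕ ι) R} (hf : f ∈ s.quadIdeal c) :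
    s.leftInvH c m f ∈ s.quadIdeal c := by
  obtain ⟨f, rfl⟩ := (s.thetaEquiv c m).surjective f
  simp only [leftInvH, LinearMap.comp_apply, LinearEquiv.coe_coe, LinearEquiv.symm_apply_apply,
    thetaEquiv_mem_quadIdeal] at hf ⊢
  exact s.divX_mem_leadSpan (by simp [s.ne2V.symm]) (by simp) (by simp [s.ne0V.symm]) (by simp) hf

theorem leftInvS_mem_quadIdeal (m : ℤ) {f : MvPolynomial (ι ⊕ ι) R} (hf : f ∈ s.quadIdeal c) :
    s.leftInvS c m f ∈ s.quadIdeal c := by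
  obtain ⟨f, rfl⟩ := (s.thetaEquiv c m).surjective f
  simp only [leftInvS, LinearMap.comp_apply, LinearEquiv.coe_coe, LinearEquiv.symm_apply_apply,
    thetaEquiv_mem_quadIdeal] at hf ⊢
  exact s.divX_mem_leadSpan (by simp) (by simp [s.ne2V.symm]) (by simp) (by simp [s.ne1V.symm]) hf

theorem leftInvH_transH (m : ℤ) (f : MvPolynomial (ι ⊕ ι) R) :
    s.leftInvH c m (transH (varP ι R s.iV) m f) - f ∈ s.quadIdeal c := by
  obtain ⟨f, rfl⟩ := (s.thetaEquiv c m).surjective f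
  have h := s.leftInvH_mem_quadIdeal c m (s.transH_theta c m f)
  have e : s.leftInvH c m (s.theta c m (varP ι R s.iV * f)) = s.thetaEquiv c m f := by
    rw [← thetaEquiv_apply]
    simp [leftInvH, varP, divX_X_mul]
  rwa [map_sub, e] at h

/-- Dividing by q_V commutes with multiplication by p_V. This makes the left inverse of `transS`
compatible with the quotient by `transH`; its transpose will then respect the eigenspaces of h. -/
theorem leftInvS_transH (m : ℤ) (f : MvPolynomial (ι ⊕ ι) R) :
    s.leftInvS c m (transH (varP ι R s.iV) m f) ∈
      (s.quadIdeal c).restrictScalars R ⊔ LinearMap.range (transH (varP ι R s.iV) (m - 2)) := by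
  obtain ⟨f, rfl⟩ := (s.thetaEquiv c m).surjective f
  have h := s.leftInvS_mem_quadIdeal c m (s.transH_theta c m f)
  have h' := s.transH_theta c (m - 2) (divX (Sum.inr s.iV) f)
  rw [map_sub] at h
  have e : s.leftInvS c m (s.theta c m (varP ι R s.iV * f)) =
      s.theta c (m - 2) (varP ι R s.iV * divX (Sum.inr s.iV) f) := by
    rw [← thetaEquiv_apply, ← thetaEquiv_apply]
    simp [leftInvS, varP, divX_X_mul_of_ne]
  rw [e] at h
  rw [thetaEquiv_apply, ← sub_add_cancel (s.leftInvS c m _) (transH (varP ι R s.iV) (m - 2)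
    (s.theta c (m - 2) (divX (Sum.inr s.iV) f)))]
  refine add_mem (Submodule.mem_sup_left ?_) (Submodule.mem_sup_right ⟨_, rfl⟩)
  have h'' := sub_mem h h'
  rwa [sub_sub_sub_cancel_right] at h''

theorem leftInvS_transS (m : ℤ) (f : MvPolynomial (ι ⊕ ι) R) :
    s.leftInvS c m (transS (varQ ι R s.iV) f) - f ∈
      (s.quadIdeal c).restrictScalars R ⊔ LinearMap.range (transH (varP ι R s.iV) (m - 2)) := by
  obtain ⟨f, rfl⟩ := (s.thetaEquiv c (m - 2)).surjective f
  have key : ∀ g ∈ (s.quadIdeal c).restrictScalars R ⊔ LinearMap.range (transH (varP ι R s.iV) m),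
      s.leftInvS c m g ∈ (s.quadIdeal c).restrictScalars R ⊔
        LinearMap.range (transH (varP ι R s.iV) (m - 2)) := by
    intro g hg
    obtain ⟨a, ha, b, ⟨b, rfl⟩, rfl⟩ := Submodule.mem_sup.1 hg
    rw [map_add]
    exact add_mem (Submodule.mem_sup_left (s.leftInvS_mem_quadIdeal c m ha))
      (s.leftInvS_transH c m b)
  have h := key _ (s.transS_theta c m f)
  have e : s.leftInvS c m (s.theta c m (varQ ι R s.iV * f)) = s.thetaEquiv c (m - 2) f := by
    rw [← thetaEquiv_apply]
    simp [leftInvS, varQ, divX_X_mul]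
  rwa [map_sub, e] at h

theorem leftInvH_mem_degreeSpan (m : ℤ) {n t : ℕ} {f : MvPolynomial (ι ⊕ ι) R}
    (hf : f ∈ degreeSpan R degP degQ n t) : s.leftInvH c m f ∈ degreeSpan R degP degQ n t := by
  have h1 := triangularEquiv_symm_mem_degreeSpan (s.isTriangular_theta c m) hf
  have h2 := divX_inl_mem_degreeSpan s.iV h1
  exact triangular_mem_degreeSpan (s.isTriangular_theta c m) h2

/-- Removing a factor q_V costs one unit of q-degree; dually, the right inverse of S̄† may add one
oscillator a†. -/
theorem leftInvS_mem_degreeSpan (m : ℤ) {n t : ℕ} {f : MvPolynomial (ι ⊕ ι) R}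
    (hf : f ∈ degreeSpan R degP degQ n (t + 1)) :
    s.leftInvS c m f ∈ degreeSpan R degP degQ n t := by
  have h1 := triangularEquiv_symm_mem_degreeSpan (s.isTriangular_theta c m) hf
  have h2 := divX_inr_mem_degreeSpan s.iV h1
  have h3 := triangular_mem_degreeSpan (s.isTriangular_theta c (m - 2)) h2
  have e : s.leftInvS c m f = s.theta c (m - 2) (divX (Sum.inr s.iV)
      ((triangularEquiv (s.isTriangular_theta c m)).symm f)) := rfl
  rw [e]
  exact h3

end NullFrameIndices

end Staircase

/-! ### Functions of Y, a† as functionals on dual polynomials. -/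

section Duality

open MvPolynomial Finsupp

variable {d : ℕ} {U : TopologicalSpace.Opens (Fin d → ℝ)}

theorem Smooth.isUnit_natCast {n : ℕ} (h : n ≠ 0) : IsUnit (n : Smooth U) := by
  have := (IsUnit.mk0 (n : ℝ) (by exact_mod_cast h)).map (algebraMap ℝ (Smooth U))
  simpa using this

theorem Fiber.coeff_mulY (A : Fin (d + 1)) (φ : Fiber U) (n : Fin (d + 1) →₀ ℕ) :
    (mulY A φ).coeff (n + single A 1) = φ.coeff n := by
  have h := MvPowerSeries.coeff_add_monomial_mul (single A 1) n φ.series 1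
  rw [one_mul, add_comm (single A 1) n] at h
  exact h

theorem Fiber.coeff_mulY_eq_zero (A : Fin (d + 1)) (φ : Fiber U) {n : Fin (d + 1) →₀ ℕ}
    (hn : n A = 0) : (mulY A φ).coeff n = 0 := by
  have h := MvPowerSeries.coeff_monomial_mul n (single A 1) φ.series 1
  rw [if_neg] at h
  · exact h
  · rw [single_le_iff]
    omega

theorem Fiber.coeff_derY (A : Fin (d + 1)) (φ : Fiber U) (n : Fin (d + 1) →₀ ℕ) :
    (derY A φ).coeff n = φ.coeff (n + single A 1) * (n A + 1 : ℕ) := by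
  have h := MvPowerSeries.coeff_pderiv (i := A) φ.series n
  push_cast
  exact h

theorem Fiber.coeff_mulA (A : Fin (d + 1)) (φ : Fiber U) (n : Fin (d + 1) →₀ ℕ) :
    (mulA A φ).coeff n = X A * φ.coeff n := rfl

theorem Fiber.coeff_derA (A : Fin (d + 1)) (φ : Fiber U) (n : Fin (d + 1) →₀ ℕ) :
    (derA A φ).coeff n = pderiv A (φ.coeff n) := rfl

theorem Fiber.coeff_add (φ χ : Fiber U) (n : Fin (d + 1) →₀ ℕ) :
    (φ + χ).coeff n = φ.coeff n + χ.coeff n := rfl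

theorem Fiber.coeff_smul (f : Smooth U) (φ : Fiber U) (n : Fin (d + 1) →₀ ℕ) :
    (f • φ).coeff n = f • φ.coeff n := rfl

/-- The product of the factorials of an exponent. -/
def multiFactorial (γ : Fin (d + 1) ⊕ Fin (d + 1) →₀ ℕ) : ℕ := ∏ i, (γ i).factorial

theorem multiFactorial_add_single (γ : Fin (d + 1) ⊕ Fin (d + 1) →₀ ℕ)
    (x : Fin (d + 1) ⊕ Fin (d + 1)) :
    multiFactorial (γ + single x 1) = (γ x + 1) * multiFactorial γ := by
  rw [multiFactorial, multiFactorial, ← Finset.mul_prod_erase _ _ (Finset.mem_univ x),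
    ← Finset.mul_prod_erase _ (fun i => (γ i).factorial) (Finset.mem_univ x), ← mul_assoc]
  congr 1
  · simp [Nat.factorial_succ]
  · refine Finset.prod_congr rfl fun i hi => ?_
    simp [(Finset.ne_of_mem_erase hi).symm]

theorem multiFactorial_ne_zero (γ : Fin (d + 1) ⊕ Fin (d + 1) →₀ ℕ) : multiFactorial γ ≠ 0 :=
  Finset.prod_ne_zero_iff.2 fun _ _ => Nat.factorial_ne_zero _

theorem sumEquiv_single_inl (A : Fin (d + 1)) : sumFinsuppAddEquivProdFinsupp
    (single (Sum.inl A : Fin (d + 1) ⊕ Fin (d + 1)) 1) = (single A 1, 0) := by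
  ext i
  · simp
  · simp

theorem sumEquiv_single_inr (A : Fin (d + 1)) : sumFinsuppAddEquivProdFinsupp
    (single (Sum.inr A : Fin (d + 1) ⊕ Fin (d + 1)) 1) = (0, single A 1) := by
  ext i
  · simp
  · simp

/-- The Taylor coefficients at the origin. -/
def taylor (φ : Fiber U) (γ : Fin (d + 1) ⊕ Fin (d + 1) →₀ ℕ) : Smooth U :=
  multiFactorial γ * coeff (sumFinsuppAddEquivProdFinsupp γ).2
    (φ.coeff (sumFinsuppAddEquivProdFinsupp γ).1)

/-- The factorials in `taylor` absorb the combinatorial factor, so that differentiation is a plain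
shift of exponents and its transpose is multiplication by a variable. -/
theorem taylor_derY (A : Fin (d + 1)) (φ : Fiber U) (γ) :
    taylor (derY A φ) γ = taylor φ (γ + single (Sum.inl A) 1) := by
  rw [taylor, taylor, multiFactorial_add_single, map_add, sumEquiv_single_inl, Fiber.coeff_derY,
    ← nsmul_eq_mul']
  simp only [Prod.fst_add, Prod.snd_add, add_zero, coeff_smul,
    fst_sumFinsuppAddEquivProdFinsupp]
  rw [nsmul_eq_mul]
  push_cast
  ring

theorem taylor_derA (A : Fin (d + 1)) (φ : Fiber U) (γ) :
    taylor (derA A φ) γ = taylor φ (γ + single (Sum.inr A) 1) := by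
  rw [taylor, taylor, multiFactorial_add_single, map_add, sumEquiv_single_inr, Fiber.coeff_derA,
    coeff_pderiv]
  simp only [Prod.fst_add, Prod.snd_add, add_zero, snd_sumFinsuppAddEquivProdFinsupp]
  push_cast
  ring

theorem taylor_mulY (A : Fin (d + 1)) (φ : Fiber U) (γ) :
    taylor (mulY A φ) γ = γ (Sum.inl A) * taylor φ (γ - single (Sum.inl A) 1) := by
  by_cases h : γ (Sum.inl A) = 0
  · rw [taylor, Fiber.coeff_mulY_eq_zero A φ (by simpa using h), h]
    simp
  · obtain ⟨γ, rfl⟩ : ∃ ε, γ = ε + single (Sum.inl A) 1 :=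
      ⟨_, (tsub_add_cancel_of_le (single_le_iff.2 (Nat.one_le_iff_ne_zero.2 h))).symm⟩
    rw [add_tsub_cancel_right, taylor, taylor, multiFactorial_add_single, map_add,
      sumEquiv_single_inl]
    simp only [Prod.fst_add, Prod.snd_add, add_zero, Fiber.coeff_mulY, Finsupp.add_apply,
      single_eq_same]
    push_cast
    ring

theorem taylor_mulA (A : Fin (d + 1)) (φ : Fiber U) (γ) :
    taylor (mulA A φ) γ = γ (Sum.inr A) * taylor φ (γ - single (Sum.inr A) 1) := by
  by_cases h : γ (Sum.inr A) = 0
  · rw [taylor, Fiber.coeff_mulA, coeff_X_mul', if_neg (by simpa using h), h]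
    simp
  · obtain ⟨γ, rfl⟩ : ∃ ε, γ = ε + single (Sum.inr A) 1 :=
      ⟨_, (tsub_add_cancel_of_le (single_le_iff.2 (Nat.one_le_iff_ne_zero.2 h))).symm⟩
    rw [add_tsub_cancel_right, taylor, taylor, multiFactorial_add_single, map_add,
      sumEquiv_single_inr]
    simp only [Prod.fst_add, Prod.snd_add, add_zero, Fiber.coeff_mulA, Finsupp.add_apply,
      single_eq_same]
    rw [add_comm _ (single A 1), coeff_X_mul]
    push_cast
    ring

/-- The pairing of functions of `Y, a†` with polynomials in the dual variables. -/
def pairing : Fiber U →ₗ[Smooth U]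
    MvPolynomial (Fin (d + 1) ⊕ Fin (d + 1)) (Smooth U) →ₗ[Smooth U] Smooth U where
  toFun φ := (basisMonomials _ (Smooth U)).constr (Smooth U) (taylor φ)
  map_add' φ χ := by
    rw [← map_add]
    congr 1
    funext γ
    simp [taylor, Fiber.coeff_add, mul_add]
  map_smul' f φ := by
    rw [RingHom.id_apply, ← map_smul]
    congr 1
    funext γ
    simp [taylor, Fiber.coeff_smul, mul_left_comm]

theorem pairing_monomial (φ : Fiber U) (γ) : pairing φ (monomial γ 1) = taylor φ γ := by
  have := (basisMonomials _ (Smooth U)).constr_basis (Smooth U) (taylor φ) γ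
  rwa [coe_basisMonomials] at this

theorem pairing_eq_of_monomial {φ χ : Fiber U}
    {X : Module.End (Smooth U) (MvPolynomial (Fin (d + 1) ⊕ Fin (d + 1)) (Smooth U))}
    (h : ∀ γ, taylor φ γ = pairing χ (X (monomial γ 1))) (f) : pairing φ f = pairing χ (X f) := by
  have : pairing φ = pairing χ ∘ₗ X := linearMap_ext_monomial fun γ => by
    rw [pairing_monomial, h, LinearMap.comp_apply]
  exact LinearMap.congr_fun this f

theorem pairing_derY (A : Fin (d + 1)) (φ : Fiber U) (f) :
    pairing (derY A φ) f = pairing φ (X (Sum.inl A) * f) := by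
  refine pairing_eq_of_monomial (X := LinearMap.mulLeft _ (X (Sum.inl A))) (fun γ => ?_) f
  rw [taylor_derY, LinearMap.mulLeft_apply, X, monomial_mul, one_mul, pairing_monomial, add_comm]

theorem pairing_derA (A : Fin (d + 1)) (φ : Fiber U) (f) :
    pairing (derA A φ) f = pairing φ (X (Sum.inr A) * f) := by
  refine pairing_eq_of_monomial (X := LinearMap.mulLeft _ (X (Sum.inr A))) (fun γ => ?_) f
  rw [taylor_derA, LinearMap.mulLeft_apply, X, monomial_mul, one_mul, pairing_monomial, add_comm]

theorem pairing_pderiv_monomial (φ : Fiber U) (x γ) :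
    pairing φ (pderiv x (monomial γ 1)) = γ x * taylor φ (γ - single x 1) := by
  rw [pderiv_monomial, one_mul, ← pairing_monomial, ← smul_eq_mul, ← map_smul, smul_monomial,
    smul_eq_mul, mul_one]

theorem pairing_mulY (A : Fin (d + 1)) (φ : Fiber U) (f) :
    pairing (mulY A φ) f = pairing φ (pderiv (Sum.inl A) f) := by
  refine pairing_eq_of_monomial (X := (pderiv (Sum.inl A)).toLinearMap) (fun γ => ?_) f
  rw [taylor_mulY, Derivation.coeFn_coe, pairing_pderiv_monomial]

theorem pairing_mulA (A : Fin (d + 1)) (φ : Fiber U) (f) :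
    pairing (mulA A φ) f = pairing φ (pderiv (Sum.inr A) f) := by
  refine pairing_eq_of_monomial (X := (pderiv (Sum.inr A)).toLinearMap) (fun γ => ?_) f
  rw [taylor_mulA, Derivation.coeFn_coe, pairing_pderiv_monomial]

/-- The factorials are invertible in C^∞(U), hence all coefficients are recovered from the
functional. -/
theorem pairing_injective : Function.Injective (pairing (U := U)) := by
  rw [injective_iff_map_eq_zero]
  intro φ h
  refine Fiber.ext fun n => MvPolynomial.ext _ _ fun k => ?_
  have h1 : taylor φ (sumFinsuppAddEquivProdFinsupp.symm (n, k)) = 0 := by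
    rw [← pairing_monomial, h, LinearMap.zero_apply]
  rw [taylor, AddEquiv.apply_symm_apply] at h1
  exact (Smooth.isUnit_natCast (multiFactorial_ne_zero _)).mul_right_eq_zero.1 h1

theorem weight_degP (γ : Fin (d + 1) ⊕ Fin (d + 1) →₀ ℕ) :
    weight degP γ = (sumFinsuppAddEquivProdFinsupp γ).1.degree := by
  rw [weight_eq_sum, degree_eq_sum]
  simp [degP]

theorem weight_degQ (γ : Fin (d + 1) ⊕ Fin (d + 1) →₀ ℕ) :
    weight degQ γ = (sumFinsuppAddEquivProdFinsupp γ).2.degree := by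
  rw [weight_eq_sum, degree_eq_sum]
  simp [degQ]

/-- The functionals that come from functions of `Y, a†`: in each degree in `Y` they are polynomial
in `a†`. -/
def IsAdmissible (ψ : MvPolynomial (Fin (d + 1) ⊕ Fin (d + 1)) (Smooth U) →ₗ[Smooth U] Smooth U) :
    Prop :=
  ∀ n, ∃ t, ∀ f ∈ degreeSpan (Smooth U) degP degQ n t, ψ f = 0

/-- Only finitely many monomials in Y have degree at most n, and each has a polynomial coefficient.
-/
theorem isAdmissible_pairing (φ : Fiber U) : IsAdmissible (pairing φ) := by
  intro n
  -- The bound is one more than the largest a†-degree among the coefficients of Y-degree at most n.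
  refine ⟨(finite_of_degree_le (σ := Fin (d + 1)) n).toFinset.sup
    (fun α => (φ.coeff α).totalDegree) + 1, fun f hf => ?_⟩
  rw [degreeSpan, restrictSupport_eq_span] at hf
  refine (Submodule.span_le (p := LinearMap.ker (pairing φ))).2 ?_ hf
  rintro _ ⟨γ, ⟨h1, h2⟩, rfl⟩
  rw [SetLike.mem_coe, LinearMap.mem_ker, pairing_monomial, taylor,
    coeff_eq_zero_of_totalDegree_lt, mul_zero]
  rw [weight_degP] at h1
  rw [weight_degQ, degree_apply] at h2
  have h3 := Finset.le_sup (f := fun α => (φ.coeff α).totalDegree)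
    (((finite_of_degree_le (σ := Fin (d + 1)) n).mem_toFinset).2 h1)
  omega

/-- Admissibility is exactly what makes the coefficient of each monomial in Y a polynomial in a†. -/
theorem exists_pairing_eq
    {ψ : MvPolynomial (Fin (d + 1) ⊕ Fin (d + 1)) (Smooth U) →ₗ[Smooth U] Smooth U}
    (h : IsAdmissible ψ) : ∃ φ, pairing φ = ψ := by
  choose t ht using h
  choose u hu using fun γ => (Smooth.isUnit_natCast (U := U) (multiFactorial_ne_zero (d := d) γ))
  -- The sum can stop below degree t(|n|), since ψ vanishes on monomials of q-degree at least t(|n|)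
  -- and p-degree at most |n|.
  refine ⟨Fiber.mk fun n => ∑ k ∈ (finite_of_degree_lt (σ := Fin (d + 1)) (t n.degree)).toFinset,
    monomial k (↑(u (sumFinsuppAddEquivProdFinsupp.symm (n, k)))⁻¹ *
      ψ (monomial (sumFinsuppAddEquivProdFinsupp.symm (n, k)) 1)), ?_⟩
  refine linearMap_ext_monomial fun γ => ?_
  obtain ⟨⟨n, k⟩, rfl⟩ := sumFinsuppAddEquivProdFinsupp.symm.surjective γ
  rw [pairing_monomial, taylor, AddEquiv.apply_symm_apply]
  change _ * coeff k (∑ k ∈ (finite_of_degree_lt (σ := Fin (d + 1)) (t n.degree)).toFinset, _) = _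
  rw [coeff_sum]
  simp only [coeff_monomial]
  rw [Finset.sum_ite_eq']
  split_ifs with hk
  · rw [← mul_assoc, ← hu, Units.mul_inv, one_mul]
  · rw [mul_zero]
    refine (ht n.degree _ (monomial_mem_degreeSpan ?_ ?_ 1)).symm
    · rw [weight_degP, AddEquiv.apply_symm_apply]
    · rw [weight_degQ, AddEquiv.apply_symm_apply]
      simpa using hk

/-- Operators on the dual polynomials with the appropriate bound on degrees have a transpose. -/
theorem exists_transpose
    (X : Module.End (Smooth U) (MvPolynomial (Fin (d + 1) ⊕ Fin (d + 1)) (Smooth U)))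
    (hX : ∀ n t, ∀ f ∈ degreeSpan (Smooth U) degP degQ n (t + 1),
      X f ∈ degreeSpan (Smooth U) degP degQ n t) :
    ∃ Z : Module.End (Smooth U) (Fiber U), ∀ φ f, pairing (Z φ) f = pairing φ (X f) := by
  have h1 : ∀ φ : Fiber U, ∃ χ : Fiber U, pairing χ = pairing φ ∘ₗ X := fun φ =>
    exists_pairing_eq fun n => by
      obtain ⟨t, ht⟩ := isAdmissible_pairing φ n
      exact ⟨t + 1, fun f hf => ht _ (hX _ _ _ hf)⟩
  choose Z hZ using h1
  refine ⟨⟨⟨Z, fun φ χ => pairing_injective ?_⟩, fun f φ => pairing_injective ?_⟩,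
    fun φ f => LinearMap.congr_fun (hZ φ) f⟩
  · rw [map_add, hZ, hZ, hZ, map_add, LinearMap.add_comp]
  · simp only [RingHom.id_apply]
    rw [map_smul, hZ, hZ, map_smul, LinearMap.smul_comp]

end Duality

/-! ### Linear changes of variables given by a frame. -/

section Frames

open MvPolynomial

variable {ι R : Type*} [Fintype ι] [DecidableEq ι] [CommRing R]

theorem derivation_sum_apply {σ κ : Type*} (t : Finset κ)
    (D : κ → Derivation R (MvPolynomial σ R) (MvPolynomial σ R)) (f : MvPolynomial σ R) :
    (∑ i ∈ t, D i) f = ∑ i ∈ t, D i f := by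
  classical
  induction t using Finset.induction_on with
  | empty => simp
  | insert a t ha ih => rw [Finset.sum_insert ha, Finset.sum_insert ha, Derivation.add_apply, ih]

theorem derEuler_apply (f : MvPolynomial (ι ⊕ ι) R) :
    derEuler ι R f = ∑ A, X (Sum.inr A) * pderiv (Sum.inr A) f -
      ∑ A, X (Sum.inl A) * pderiv (Sum.inl A) f := by
  have : derEuler ι R = ∑ A, (X (Sum.inr A) : MvPolynomial (ι ⊕ ι) R) • pderiv (Sum.inr A) -
      ∑ A, (X (Sum.inl A) : MvPolynomial (ι ⊕ ι) R) • pderiv (Sum.inl A) := by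
    refine MvPolynomial.derivation_ext fun i => ?_
    rcases i with i | i <;>
    simp [derEuler, varP, varQ, derivation_sum_apply, Pi.single_apply]
  rw [this]
  simp [derivation_sum_apply]

theorem derPQ_apply (f : MvPolynomial (ι ⊕ ι) R) :
    derPQ ι R f = ∑ A, X (Sum.inr A) * pderiv (Sum.inl A) f := by
  have : derPQ ι R = ∑ A, (X (Sum.inr A) : MvPolynomial (ι ⊕ ι) R) • pderiv (Sum.inl A) := by
    refine MvPolynomial.derivation_ext fun i => ?_
    rcases i with i | i <;>
    simp [derPQ, varQ, derivation_sum_apply, Pi.single_apply]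
  rw [this]
  simp [derivation_sum_apply]

theorem algHom_derivation_comm {σ : Type*} {D D' : Derivation R (MvPolynomial σ R)
    (MvPolynomial σ R)} {g : MvPolynomial σ R →ₐ[R] MvPolynomial σ R}
    (h : ∀ x, g (D (X x)) = D' (g (X x))) (f : MvPolynomial σ R) : g (D f) = D' (g f) := by
  induction f using MvPolynomial.induction_on with
  | C a => rw [derivation_C, map_zero, ← MvPolynomial.algebraMap_eq, AlgHom.commutes,
      Derivation.map_algebraMap]
  | add p q hp hq => rw [map_add, map_add, hp, hq, map_add, map_add]
  | mul_X p x hp => simp only [Derivation.leibniz, smul_eq_mul, map_add, map_mul, hp, h]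

/-- The linear change of variables defined by a frame. -/
def frameMap (F : ι → ι → R) : MvPolynomial (ι ⊕ ι) R →ₐ[R] MvPolynomial (ι ⊕ ι) R :=
  aeval (Sum.elim (fun i => ∑ A, F i A • X (Sum.inl A)) (fun i => ∑ A, F i A • X (Sum.inr A)))

theorem frameMap_varP (F : ι → ι → R) (i : ι) :
    frameMap F (varP ι R i) = ∑ A, F i A • varP ι R A := by
  simp [frameMap, varP]

theorem frameMap_varQ (F : ι → ι → R) (i : ι) :
    frameMap F (varQ ι R i) = ∑ A, F i A • varQ ι R A := by
  simp [frameMap, varQ]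

theorem frameMap_comp {F F' : ι → ι → R}
    (h : ∀ i j, ∑ A, F' i A * F A j = if i = j then 1 else 0) :
    (frameMap F).comp (frameMap F') = AlgHom.id R _ := by
  refine MvPolynomial.algHom_ext fun x => ?_
  rcases x with i | i
  · change frameMap F (frameMap F' (varP ι R i)) = varP ι R i
    simp only [frameMap_varP, map_sum, map_smul, Finset.smul_sum, smul_smul]
    rw [Finset.sum_comm]
    simp [← Finset.sum_smul, h]
  · change frameMap F (frameMap F' (varQ ι R i)) = varQ ι R i
    simp only [frameMap_varQ, map_sum, map_smul, Finset.smul_sum, smul_smul]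
    rw [Finset.sum_comm]
    simp [← Finset.sum_smul, h]

theorem frameMap_mem_degreeSpan (F : ι → ι → R) {n t : ℕ} {f : MvPolynomial (ι ⊕ ι) R}
    (hf : f ∈ degreeSpan R degP degQ n t) : frameMap F f ∈ degreeSpan R degP degQ n t := by
  refine degreeSpan_induction (frameMap F).toLinearMap (fun δ h1 h2 => ?_) hf
  refine degreeSpan_mono h1 h2 ?_
  clear h1 h2
  rw [AlgHom.toLinearMap_apply]
  induction δ using Finsupp.induction_linear with
  | zero =>
    rw [← C_apply, map_one, map_one, ← C_1, C_apply]
    exact monomial_mem_degreeSpan le_rfl le_rfl _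
  | add γ δ hγ hδ =>
    rw [← one_mul (1 : R), ← monomial_mul, map_mul, map_add, map_add]
    exact mul_mem_degreeSpan hγ hδ
  | single x k =>
    induction k with
    | zero =>
      rw [Finsupp.single_zero, ← C_apply, map_one, map_one, ← C_1, C_apply]
      exact monomial_mem_degreeSpan le_rfl le_rfl _
    | succ k ih =>
      rw [Finsupp.single_add, ← one_mul (1 : R), ← monomial_mul, map_mul, map_add, map_add]
      refine mul_mem_degreeSpan ih ?_
      rcases x with i | i
      · change frameMap F (varP ι R i) ∈ _
        rw [frameMap_varP]
        refine sum_mem fun A _ => Submodule.smul_mem _ _ (monomial_mem_degreeSpan ?_ ?_ _) <;>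
        simp [degP, degQ, Finsupp.weight_single]
      · change frameMap F (varQ ι R i) ∈ _
        rw [frameMap_varQ]
        refine sum_mem fun A _ => Submodule.smul_mem _ _ (monomial_mem_degreeSpan ?_ ?_ _) <;>
        simp [degP, degQ, Finsupp.weight_single]

theorem frameMap_derEuler (F : ι → ι → R) (f : MvPolynomial (ι ⊕ ι) R) :
    frameMap F (derEuler ι R f) = derEuler ι R (frameMap F f) := by
  refine algHom_derivation_comm (fun x => ?_) f
  rcases x with i | i
  · change frameMap F (derEuler ι R (varP ι R i)) = derEuler ι R (frameMap F (varP ι R i))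
    simp [derEuler_varP, frameMap_varP]
  · change frameMap F (derEuler ι R (varQ ι R i)) = derEuler ι R (frameMap F (varQ ι R i))
    simp [derEuler_varQ, frameMap_varQ]

theorem frameMap_derPQ (F : ι → ι → R) (f : MvPolynomial (ι ⊕ ι) R) :
    frameMap F (derPQ ι R f) = derPQ ι R (frameMap F f) := by
  refine algHom_derivation_comm (fun x => ?_) f
  rcases x with i | i
  · change frameMap F (derPQ ι R (varP ι R i)) = derPQ ι R (frameMap F (varP ι R i))
    simp [derPQ_varP, frameMap_varP, frameMap_varQ]
  · change frameMap F (derPQ ι R (varQ ι R i)) = derPQ ι R (frameMap F (varQ ι R i))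
    simp [derPQ_varQ, frameMap_varQ]

namespace NullFrameIndices

variable (s : NullFrameIndices ι) (c : ι → R)

/-- The frame dual to `F` with respect to the bilinear form. -/
def dualFrame (F : ι → ι → R) (i : ι) : ι → R :=
  if i = s.i0 then F s.i1 else if i = s.i1 then F s.i0 else if i = s.i2 then F s.i2 else
    fun A => c i * F i A

theorem sum_split {M : Type*} [AddCommMonoid M] (g : ι → M) : ∑ i, g i =
    g s.i0 + g s.i1 + g s.i2 +
      ∑ i ∈ Finset.univ.filter fun i => i ≠ s.i0 ∧ i ≠ s.i1 ∧ i ≠ s.i2, g i := by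
  have h : (Finset.univ.filter fun i => ¬(i ≠ s.i0 ∧ i ≠ s.i1 ∧ i ≠ s.i2)) =
      {s.i0, s.i1, s.i2} := by
    ext i
    simp
    tauto
  rw [← Finset.sum_filter_add_sum_filter_not Finset.univ
    (fun i => i ≠ s.i0 ∧ i ≠ s.i1 ∧ i ≠ s.i2), h, Finset.sum_insert (by simp [s.ne01, s.ne02]),
    Finset.sum_pair s.ne12, add_comm, add_assoc (g s.i0)]
  simp only [add_assoc]

/-- Summed over i, the products of dual frame and frame give the metric, so the null form becomes
the diagonal form defined by η after the substitution. -/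
theorem frameMap_form {F : ι → ι → R} {η : ι → R}
    (hF : ∀ A B, ∑ i, s.dualFrame c F i A * F i B = if A = B then η A else 0)
    {u v x y : ι → MvPolynomial (ι ⊕ ι) R}
    (hx : ∀ i, frameMap F (u i) = ∑ A, F i A • x A)
    (hy : ∀ i, frameMap F (v i) = ∑ A, F i A • y A) :
    frameMap F (s.form c u v) = ∑ A, η A • (x A * y A) := by
  have h1 : frameMap F (s.form c u v) =
      ∑ i, (∑ A, s.dualFrame c F i A • x A) * (∑ A, F i A • y A) := by
    rw [s.sum_split]
    have h3 : ∀ r : R, frameMap F (C r) = C r := fun r => by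
      rw [← MvPolynomial.algebraMap_eq, AlgHom.commutes]
    simp only [form, map_add, map_sum, map_mul, hx, hy, h3]
    have h0 := s.ne01.symm
    have h4 := s.ne02.symm
    have h5 := s.ne12.symm
    simp only [dualFrame, if_true, if_neg h0, if_neg h4, if_neg h5]
    have h2 : ∀ i ∈ Finset.univ.filter fun i => i ≠ s.i0 ∧ i ≠ s.i1 ∧ i ≠ s.i2,
        C (c i) * ((∑ A, F i A • x A) * ∑ A, F i A • y A) =
        (∑ A, (if i = s.i0 then F s.i1 else if i = s.i1 then F s.i0 else if i = s.i2 then F s.i2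
          else fun A => c i * F i A) A • x A) * (∑ A, F i A • y A) := by
      intro i hi
      obtain ⟨a, b, e⟩ := (Finset.mem_filter.1 hi).2
      simp only [if_neg a, if_neg b, if_neg e, mul_smul, ← Finset.smul_sum]
      rw [smul_mul_assoc, smul_eq_C_mul]
    rw [Finset.sum_congr rfl h2]
    ring
  rw [h1]
  simp only [Finset.sum_mul_sum, smul_mul_smul_comm]
  rw [Finset.sum_comm]
  refine Finset.sum_congr rfl fun A _ => ?_
  rw [Finset.sum_comm]
  simp [← Finset.sum_smul, hF]

end NullFrameIndices

end Frames

/-! ### Right inverses of h - m and S̄† by transposition. -/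

section TransposedConstraints

open MvPolynomial

variable {d : ℕ} {U : TopologicalSpace.Opens (Fin d → ℝ)}

/-- The metric as a constant smooth function. -/
def etaR (U : TopologicalSpace.Opens (Fin d → ℝ)) (A : Fin (d + 1)) : Smooth U :=
  algebraMap ℝ (Smooth U) (eta A)

theorem pairing_box (φ : Fiber U) (f) : pairing (box φ) f =
    pairing φ ((∑ A, etaR U A • (varP _ (Smooth U) A * varP _ (Smooth U) A)) * f) := by
  simp only [box, LinearMap.sum_apply, LinearMap.smul_apply, Module.End.mul_apply, map_sum,
    LinearMap.map_smul_of_tower, Finset.sum_mul, pairing_derY, smul_mul_assoc, varP, mul_assoc,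
    etaR, algebraMap_smul]

theorem pairing_opS (φ : Fiber U) (f) : pairing (opS φ) f =
    pairing φ ((∑ A, etaR U A • (varP _ (Smooth U) A * varQ _ (Smooth U) A)) * f) := by
  simp only [opS, LinearMap.sum_apply, LinearMap.smul_apply, Module.End.mul_apply, map_sum,
    LinearMap.map_smul_of_tower, Finset.sum_mul, pairing_derY, pairing_derA, smul_mul_assoc, varP,
    varQ, mul_assoc, etaR, algebraMap_smul]

theorem pairing_opT (φ : Fiber U) (f) : pairing (opT φ) f =
    pairing φ ((∑ A, etaR U A • (varQ _ (Smooth U) A * varQ _ (Smooth U) A)) * f) := by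
  simp only [opT, LinearMap.sum_apply, LinearMap.smul_apply, Module.End.mul_apply, map_sum,
    LinearMap.map_smul_of_tower, Finset.sum_mul, pairing_derA, smul_mul_assoc, varQ, mul_assoc,
    etaR, algebraMap_smul]

namespace Background

variable {l : ℝ} (B : Background U l)

theorem pairing_opH (m : ℤ) (φ : Fiber U) (f) :
    pairing ((B.opH - (m : Module.End (Smooth U) (Fiber U))) φ) f =
    pairing φ (transH (∑ A, B.V A • varP _ (Smooth U) A) m f) := by
  rw [transH_apply, derEuler_apply]
  simp only [opH, LinearMap.sub_apply, LinearMap.sum_apply, Module.End.mul_apply, map_sum, map_sub,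
    add_mul, LinearMap.add_apply, map_add, pairing_mulA, pairing_derA, pairing_mulY, pairing_derY,
    LinearMap.smul_apply, Module.End.one_apply, map_smul, Finset.sum_mul, smul_mul_assoc, varP,
    Finset.sum_add_distrib, Module.End.intCast_apply, map_zsmul, LinearMap.smul_apply, sub_sub,
    add_assoc]

theorem pairing_opSbd (φ : Fiber U) (f) : pairing (B.opSbd φ) f =
    pairing φ (transS (∑ A, B.V A • varQ _ (Smooth U) A) f) := by
  rw [transS_apply, derPQ_apply]
  simp only [opSbd, LinearMap.sum_apply, Module.End.mul_apply, map_sum,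
    add_mul, LinearMap.add_apply, map_add, pairing_derA, pairing_mulY,
    LinearMap.smul_apply, Module.End.one_apply, map_smul, Finset.sum_mul, smul_mul_assoc, varQ,
    Finset.sum_add_distrib]

end Background

/-- The functions of `x, Y, a†` that are totally traceless. -/
def tracelessFiber (U : TopologicalSpace.Opens (Fin d → ℝ)) : Submodule (Smooth U) (Fiber U) :=
  LinearMap.ker box ⊓ LinearMap.ker opS ⊓ LinearMap.ker opT

namespace Background

variable {l : ℝ} (B : Background U l)

/-- The traceless functions with `(h - m) φ = 0`. -/
def weightFiber (m : ℤ) : Submodule (Smooth U) (Fiber U) :=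
  tracelessFiber U ⊓ LinearMap.ker (B.opH - (m : Module.End (Smooth U) (Fiber U)))

/-- If there is a null frame containing `V`, then `h - m` has a right inverse on traceless
functions, and so has `S̄†` on those of definite weight. -/
theorem exists_rightInverses_of_frame (s : NullFrameIndices (Fin (d + 1)))
    (c : Fin (d + 1) → Smooth U) (F : Fin (d + 1) → Fin (d + 1) → Smooth U)
    (hF : ∀ A C, ∑ i, s.dualFrame c F i A * F i C = if A = C then etaR U A else 0)
    (hV : F s.iV = B.V) : ∃ J L : ℤ → Module.End (Smooth U) (Fiber U), ∀ m,
      (∀ φ ∈ tracelessFiber U, J m φ ∈ tracelessFiber U ∧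
        (B.opH - (m : Module.End (Smooth U) (Fiber U))) (J m φ) = φ) ∧
      (∀ φ ∈ tracelessFiber U, L m φ ∈ tracelessFiber U) ∧
      ∀ φ ∈ B.weightFiber (m - 2), L m φ ∈ B.weightFiber m ∧ B.opSbd (L m φ) = φ := by
  have hη : ∀ A, etaR U A * etaR U A = 1 := fun A => by
    rw [etaR, ← map_mul, eta]
    split_ifs <;> simp
  -- Since η² = 1, multiplying the dual frame by η gives the inverse matrix of the frame.
  let F' : Fin (d + 1) → Fin (d + 1) → Smooth U := fun A i => etaR U A * s.dualFrame c F i A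
  have h1 : Matrix.of F' * Matrix.of F = 1 := by
    ext A C
    rw [Matrix.mul_apply, Matrix.one_apply]
    simp only [Matrix.of_apply, F', mul_assoc, ← Finset.mul_sum, hF]
    split_ifs
    · exact hη A
    · exact mul_zero _
  have h2 : Matrix.of F * Matrix.of F' = 1 := mul_eq_one_comm.1 h1
  have h1' : (frameMap F).comp (frameMap F') = AlgHom.id _ _ :=
    frameMap_comp fun i j => by simpa [Matrix.mul_apply, Matrix.one_apply] using congr_fun₂ h1 i j
  have h2' : (frameMap F').comp (frameMap F) = AlgHom.id _ _ :=
    frameMap_comp fun i j => by simpa [Matrix.mul_apply, Matrix.one_apply] using congr_fun₂ h2 i j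
  have e1 : ∀ f, frameMap F (frameMap F' f) = f := fun f => AlgHom.congr_fun h1' f
  have e2 : ∀ f, frameMap F' (frameMap F f) = f := fun f => AlgHom.congr_fun h2' f
  have pbox : ∀ φ f, pairing (box φ) (frameMap F f) =
      pairing φ (frameMap F (s.form c (varP _ _) (varP _ _) * f)) := fun φ f => by
    rw [pairing_box, map_mul (frameMap F), s.frameMap_form c hF (frameMap_varP F) (frameMap_varP F)]
  have pS : ∀ φ f, pairing (opS φ) (frameMap F f) =
      pairing φ (frameMap F (s.form c (varP _ _) (varQ _ _) * f)) := fun φ f => by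
    rw [pairing_opS, map_mul (frameMap F), s.frameMap_form c hF (frameMap_varP F) (frameMap_varQ F)]
  have pT : ∀ φ f, pairing (opT φ) (frameMap F f) =
      pairing φ (frameMap F (s.form c (varQ _ _) (varQ _ _) * f)) := fun φ f => by
    rw [pairing_opT, map_mul (frameMap F), s.frameMap_form c hF (frameMap_varQ F) (frameMap_varQ F)]
  have pH : ∀ m φ f, pairing ((B.opH - ((m : ℤ) : Module.End (Smooth U) (Fiber U))) φ)
      (frameMap F f) = pairing φ (frameMap F (transH (varP _ _ s.iV) m f)) := fun m φ f => by
    rw [pairing_opH, transH_apply, transH_apply, map_sub (frameMap F), map_sub (frameMap F),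
      map_mul (frameMap F), frameMap_derEuler,
      frameMap_varP, hV, map_zsmul]
  have pSb : ∀ φ f, pairing (B.opSbd φ) (frameMap F f) =
      pairing φ (frameMap F (transS (varQ _ _ s.iV) f)) := fun φ f => by
    rw [pairing_opSbd, transS_apply, transS_apply, map_add (frameMap F), map_mul (frameMap F), frameMap_derPQ,
      frameMap_varQ, hV]
  have hzero : ∀ φ : Fiber U, (∀ f, pairing φ (frameMap F f) = 0) → φ = 0 := fun φ h =>
    pairing_injective (LinearMap.ext fun f => by
      rw [← e1 f, h, map_zero, LinearMap.zero_apply])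
  -- A function is traceless precisely when its functional annihilates the ideal of p², pq, q², here
  -- expressed in frame coordinates.
  have hT : ∀ φ : Fiber U, φ ∈ tracelessFiber U ↔
      ∀ f ∈ s.quadIdeal c, pairing φ (frameMap F f) = 0 := by
    intro φ
    simp only [tracelessFiber, Submodule.mem_inf, LinearMap.mem_ker]
    constructor
    · rintro ⟨⟨g1, g2⟩, g3⟩ f hf
      rw [NullFrameIndices.quadIdeal, Ideal.span, Submodule.mem_span_triple] at hf
      obtain ⟨x, y, z, rfl⟩ := hf
      simp only [smul_eq_mul, mul_comm _ (s.form _ _ _), map_add, ← pbox, ← pS, ← pT, g1, g2, g3,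
        map_zero, LinearMap.zero_apply, add_zero]
    · intro h
      refine ⟨⟨hzero _ fun f => ?_, hzero _ fun f => ?_⟩, hzero _ fun f => ?_⟩
      · rw [pbox]
        exact h _ (Ideal.mul_mem_right _ _ (Ideal.subset_span (by simp)))
      · rw [pS]
        exact h _ (Ideal.mul_mem_right _ _ (Ideal.subset_span (by simp)))
      · rw [pT]
        exact h _ (Ideal.mul_mem_right _ _ (Ideal.subset_span (by simp)))
  -- Transposition reverses products: left inverses on dual polynomials become right inverses on
  -- functions, and preservation of the ideal becomes preservation of tracelessness.
  have hJ : ∀ m, ∃ Z : Module.End (Smooth U) (Fiber U), ∀ φ f,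
      pairing (Z φ) f = pairing φ (frameMap F (s.leftInvH c m (frameMap F' f))) := fun m =>
    exists_transpose ((frameMap F).toLinearMap ∘ₗ s.leftInvH c m ∘ₗ (frameMap F').toLinearMap)
      fun n t f hf => frameMap_mem_degreeSpan F (s.leftInvH_mem_degreeSpan c m
        (frameMap_mem_degreeSpan F' (degreeSpan_mono le_rfl (Nat.le_succ t) hf)))
  have hL : ∀ m, ∃ Z : Module.End (Smooth U) (Fiber U), ∀ φ f,
      pairing (Z φ) f = pairing φ (frameMap F (s.leftInvS c m (frameMap F' f))) := fun m =>
    exists_transpose ((frameMap F).toLinearMap ∘ₗ s.leftInvS c m ∘ₗ (frameMap F').toLinearMap)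
      fun n t f hf => frameMap_mem_degreeSpan F (s.leftInvS_mem_degreeSpan c m
        (frameMap_mem_degreeSpan F' hf))
  choose J hJ using hJ
  choose L hL using hL
  have hLT : ∀ m, ∀ φ ∈ tracelessFiber U, L m φ ∈ tracelessFiber U := by
    intro m φ hφ
    rw [hT] at hφ ⊢
    intro f hf
    rw [hL, e2]
    exact hφ _ (s.leftInvS_mem_quadIdeal c m hf)
  refine ⟨J, L, fun m => ⟨fun φ hφ => ⟨?_, ?_⟩, hLT m, fun φ hφ => ?_⟩⟩
  · rw [hT] at hφ ⊢
    intro f hf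
    rw [hJ, e2]
    exact hφ _ (s.leftInvH_mem_quadIdeal c m hf)
  · rw [← sub_eq_zero]
    refine hzero _ fun f => ?_
    rw [map_sub, LinearMap.sub_apply, pH, hJ, e2, ← map_sub, ← map_sub]
    exact (hT φ).1 hφ _ (s.leftInvH_transH c m f)
  · obtain ⟨hφ, hφ'⟩ := hφ
    -- The functional of a traceless φ with h φ = (m - 2) φ vanishes on the ideal and on the range
    -- of the transposed h - (m - 2), which are the error terms of `leftInvS`.
    have key : ∀ f ∈ (s.quadIdeal c).restrictScalars (Smooth U) ⊔
        LinearMap.range (transH (varP _ _ s.iV) (m - 2)), pairing φ (frameMap F f) = 0 := by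
      intro f hf
      obtain ⟨a, ha, b, ⟨b, rfl⟩, rfl⟩ := Submodule.mem_sup.1 hf
      rw [map_add, map_add, (hT φ).1 hφ a ha, ← pH, LinearMap.mem_ker.1 hφ', map_zero,
        LinearMap.zero_apply, zero_add]
    refine ⟨⟨hLT m φ hφ, hzero _ fun f => ?_⟩, ?_⟩
    · rw [pH, hL, e2]
      exact key _ (s.leftInvS_transH c m f)
    · rw [← sub_eq_zero]
      refine hzero _ fun f => ?_
      rw [map_sub, LinearMap.sub_apply, pSb, hL, e2, ← map_sub, ← map_sub]
      exact key _ (s.leftInvS_transS c m f)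

end Background

end TransposedConstraints

/-! ### A smooth frame containing V and two null vectors. -/

section FrameExistence

variable {d : ℕ} {U : TopologicalSpace.Opens (Fin d → ℝ)}

theorem Smooth.ext' {f g : Smooth U} (h : ∀ x, f.1 x = g.1 x) : f = g := Subtype.ext (funext h)

theorem Smooth.exists_inv (f : Smooth U) (hf : ∀ x, f.1 x ≠ 0) : ∃ g : Smooth U, f * g = 1 := by
  refine ⟨⟨fun x => (f.1 x)⁻¹, ?_⟩, Smooth.ext' fun x => mul_inv_cancel₀ (hf x)⟩
  refine (ContDiffOn.inv f.2 fun x hx => ?_).congr fun x hx => ?_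
  · have := f.ext0_apply ⟨x, hx⟩
    rw [Smooth.ext0] at this
    rw [this]
    exact hf _
  · have h (k : U → ℝ) : Function.extend Subtype.val k 0 x = k ⟨x, hx⟩ :=
      Subtype.val_injective.extend_apply k 0 ⟨x, hx⟩
    simp [h]

theorem Smooth.exists_sqrt (f : Smooth U) (hf : ∀ x, 0 < f.1 x) :
    ∃ g : Smooth U, g * g = f ∧ ∀ x, 0 < g.1 x := by
  refine ⟨⟨fun x => √(f.1 x), ?_⟩, Smooth.ext' fun x => Real.mul_self_sqrt (hf x).le,
    fun x => Real.sqrt_pos.2 (hf x)⟩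
  refine (ContDiffOn.sqrt f.2 fun x hx => ?_).congr fun x hx => ?_
  · have := f.ext0_apply ⟨x, hx⟩
    rw [Smooth.ext0] at this
    rw [this]
    exact (hf _).ne'
  · have h (k : U → ℝ) : Function.extend Subtype.val k 0 x = k ⟨x, hx⟩ :=
      Subtype.val_injective.extend_apply k 0 ⟨x, hx⟩
    simp [h]

/-- Sums over all indices, with the two time-like ones split off. -/
theorem sum_split_ends (hd : 0 < d) {M : Type*} [AddCommMonoid M] (g : Fin (d + 1) → M) :
    ∑ i, g i = g 0 + g (Fin.last d) +
      ∑ i ∈ Finset.univ.filter fun i => ¬(i = 0 ∨ i = Fin.last d), g i := by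
  have h : (Finset.univ.filter fun i : Fin (d + 1) => i = 0 ∨ i = Fin.last d) =
      {0, Fin.last d} := by
    ext i
    simp
  have h0 : (0 : Fin (d + 1)) ≠ Fin.last d := by
    rw [Ne, Fin.ext_iff]
    simp only [Fin.val_zero, Fin.val_last]
    omega
  rw [← Finset.sum_filter_add_sum_filter_not Finset.univ (fun i => i = 0 ∨ i = Fin.last d), h,
    Finset.sum_pair h0]

/-- An algebraic form of the existence of a Lorentz transformation that takes a time-like vector
`V` to a multiple of a basis vector. -/
theorem exists_orthonormal_frame {R : Type*} [CommRing R] (hd : 0 < d) (V : Fin (d + 1) → R)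
    {ρ ρi l li k : R} (hρ : ρ * ρi = 1) (hl : l * li = 1) (hk : l * (ρ + l) * k = 1)
    (h1 : ρ * ρ = V 0 * V 0 + V (Fin.last d) * V (Fin.last d))
    (h2 : ∑ i ∈ Finset.univ.filter fun i : Fin (d + 1) => ¬(i = 0 ∨ i = Fin.last d), V i * V i =
      ρ * ρ - l * l) :
    ∃ (u : Fin (d + 1) → R) (E : Fin (d + 1) → Fin (d + 1) → R), ∀ A C,
      -(u A * u C) - li * li * (V A * V C) +
        ∑ i ∈ Finset.univ.filter fun i : Fin (d + 1) => ¬(i = 0 ∨ i = Fin.last d),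
          E i A * E i C =
      if A = C then (if A = 0 ∨ A = Fin.last d then -1 else 1) else 0 := by
  -- t is the normalized projection of V to the time-like plane, u is t rotated by a right angle in
  -- that plane, and v is the space-like part of V.
  let t : Fin (d + 1) → R := fun A => if A = 0 then V 0 * ρi else
    if A = Fin.last d then V (Fin.last d) * ρi else 0
  let u : Fin (d + 1) → R := fun A => if A = 0 then - V (Fin.last d) * ρi else
    if A = Fin.last d then V 0 * ρi else 0
  let v : Fin (d + 1) → R := fun A => if A = 0 ∨ A = Fin.last d then 0 else V A
  let w : Fin (d + 1) → R := fun A => k * v A + li * t A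
  have h0 : (0 : Fin (d + 1)) ≠ Fin.last d := by
    rw [Ne, Fin.ext_iff]
    simp only [Fin.val_zero, Fin.val_last]
    omega
  -- The boost that takes t to V/l fixes u and takes the basis vector e_i to e_i + v_i (k v + t/l).
  -- Writing its coefficient as k = 1/(l(ρ + l)) avoids dividing by v², which may vanish.
  refine ⟨u, fun i A => (if A = i then 1 else 0) + v i * w A, fun A C => ?_⟩
  have hV : ∀ A, V A = ρ * t A + v A := by
    intro A
    simp only [t, v]
    by_cases a : A = 0
    · subst a
      simp only [if_true, true_or]
      linear_combination -V 0 * hρ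
    · by_cases b : A = Fin.last d
      · subst b
        simp only [if_true, or_true, h0.symm, if_false]
        linear_combination -V (Fin.last d) * hρ
      · simp [a, b]
  have e1 : ∑ i ∈ Finset.univ.filter fun i : Fin (d + 1) => ¬(i = 0 ∨ i = Fin.last d),
      ((if A = i then 1 else 0) + v i * w A) * ((if C = i then 1 else 0) + v i * w C) =
      (if A = C then (if A = 0 ∨ A = Fin.last d then 0 else 1) else 0) + v A * w C + v C * w A +
        (ρ * ρ - l * l) * (w A * w C) := by
    have e2 : ∑ i ∈ Finset.univ.filter fun i : Fin (d + 1) => ¬(i = 0 ∨ i = Fin.last d),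
        v i * v i = ρ * ρ - l * l := by
      rw [← h2]
      refine Finset.sum_congr rfl fun i hi => ?_
      simp only [v, if_neg (Finset.mem_filter.1 hi).2]
    have e3 : ∀ i, ((if A = i then 1 else 0) + v i * w A) * ((if C = i then 1 else 0) + v i * w C)
        = (if A = i then (if C = i then 1 else 0) + v i * w C else 0) +
          (if C = i then v i * w A else 0) + v i * v i * (w A * w C) := by
      intro i
      split_ifs <;> ring
    simp only [e3]
    rw [Finset.sum_add_distrib, Finset.sum_add_distrib, ← Finset.sum_mul, e2, Finset.sum_ite_eq,
      Finset.sum_ite_eq]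
    simp only [Finset.mem_filter, Finset.mem_univ, true_and, v]
    by_cases a : A = 0 ∨ A = Fin.last d <;> by_cases b : C = 0 ∨ C = Fin.last d <;>
      simp only [a, b, if_true, if_false, not_true_eq_false, not_false_eq_true, zero_mul, add_zero,
        zero_add, ite_self, eq_comm (a := C) (b := A)]
  have e4 : u A * u C + t A * t C =
      if A = C then (if A = 0 ∨ A = Fin.last d then 1 else 0) else 0 := by
    have e5 : (V 0 * V 0 + V (Fin.last d) * V (Fin.last d)) * (ρi * ρi) = 1 := by
      rw [← h1]
      linear_combination (ρ * ρi + 1) * hρ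
    simp only [u, t]
    by_cases a : A = 0
    · subst a
      by_cases b : C = 0
      · subst b
        simp only [if_true, true_or]
        linear_combination e5
      · by_cases b' : C = Fin.last d
        · subst b'
          simp only [if_true, h0.symm, h0, if_false]
          ring
        · simp [b, b', eq_comm]
    · by_cases a' : A = Fin.last d
      · subst a'
        by_cases b : C = 0
        · subst b
          simp only [if_true, h0.symm, if_false]
          ring
        · by_cases b' : C = Fin.last d
          · subst b'
            simp only [if_true, h0.symm, if_false, or_true]
            linear_combination e5
          · simp [b, b', a, eq_comm]
      · simp [a, a']
  have e6 : (if A = C then (if A = 0 ∨ A = Fin.last d then (-1 : R) else 1) else 0) =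
      (if A = C then (if A = 0 ∨ A = Fin.last d then 0 else 1) else 0) -
        (if A = C then (if A = 0 ∨ A = Fin.last d then 1 else 0) else 0) := by
    split_ifs <;> ring
  rw [e1, e6, ← e4, hV A, hV C]
  simp only [w]
  -- From `r2` follow the three scalar identities that match the coefficients of v⊗v, of the mixed
  -- terms, and of t⊗t.
  have r2 : (ρ + l) * k = li := by linear_combination li * hk - (ρ + l) * k * hl
  have r3 : 2 * k + (ρ * ρ - l * l) * (k * k) - li * li = 0 := by
    linear_combination ((ρ - l) * k + li) * r2 - 2 * k * hl
  have r4 : li + (ρ * ρ - l * l) * (k * li) - ρ * (li * li) = 0 := by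
    linear_combination (ρ - l) * li * r2 - li * hl
  have r5 : (ρ * ρ - l * l) * (li * li) - ρ * ρ * (li * li) = -1 := by
    linear_combination -(l * li + 1) * hl
  linear_combination (v A * v C) * r3 + (v A * t C + v C * t A) * r4 + (t A * t C) * r5

namespace Background

variable {l : ℝ} (B : Background U l)

/-- An orthonormal frame whose time-like vectors are u and V/l is available over all of U; combining
u with one space-like vector gives two null directions. A second space-like vector is needed for the
index `i2`, whence d ≥ 3. -/
theorem exists_null_frame (hd : 3 ≤ d) (hl : 0 < l) :
    ∃ (s : NullFrameIndices (Fin (d + 1))) (c : Fin (d + 1) → Smooth U)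
      (F : Fin (d + 1) → Fin (d + 1) → Smooth U),
      (∀ A C, ∑ i, s.dualFrame c F i A * F i C = if A = C then etaR U A else 0) ∧
        F s.iV = B.V := by
  have hrad := B.radius
  have h0 : (0 : Fin (d + 1)) ≠ Fin.last d := by
    rw [Ne, Fin.ext_iff]
    simp only [Fin.val_zero, Fin.val_last]
    omega
  have hmid : ∑ i ∈ Finset.univ.filter fun i : Fin (d + 1) => ¬(i = 0 ∨ i = Fin.last d),
      B.V i * B.V i = B.V 0 * B.V 0 + B.V (Fin.last d) * B.V (Fin.last d) -
        algebraMap ℝ (Smooth U) l * algebraMap ℝ (Smooth U) l := by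
    rw [sum_split_ends (by omega)] at hrad
    have e : ∑ i ∈ Finset.univ.filter fun i : Fin (d + 1) => ¬(i = 0 ∨ i = Fin.last d),
        eta i • (B.V i * B.V i) =
        ∑ i ∈ Finset.univ.filter fun i : Fin (d + 1) => ¬(i = 0 ∨ i = Fin.last d),
          B.V i * B.V i :=
      Finset.sum_congr rfl fun i hi => by
        rw [eta, if_neg (Finset.mem_filter.1 hi).2, one_smul]
    rw [e] at hrad
    simp only [eta, true_or, or_true, if_true, neg_smul, one_smul, map_pow] at hrad
    linear_combination hrad
  -- V² = -l² makes the time-like part of V at least l in norm, so its square root ρ is smooth and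
  -- invertible.
  have hpos : ∀ x, 0 < (B.V 0 * B.V 0 + B.V (Fin.last d) * B.V (Fin.last d)).1 x := by
    intro x
    have e : B.V 0 * B.V 0 + B.V (Fin.last d) * B.V (Fin.last d) =
        (∑ i ∈ Finset.univ.filter fun i : Fin (d + 1) => ¬(i = 0 ∨ i = Fin.last d),
          B.V i * B.V i) + algebraMap ℝ (Smooth U) l * algebraMap ℝ (Smooth U) l := by
      rw [hmid]
      ring
    let ev : Smooth U →+* ℝ := (Pi.evalRingHom (fun _ : U => ℝ) x).comp
      (smoothFunctions U).val.toRingHom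
    change 0 < ev (B.V 0 * B.V 0 + B.V (Fin.last d) * B.V (Fin.last d))
    rw [e, map_add, map_sum]
    refine add_pos_of_nonneg_of_pos (Finset.sum_nonneg fun i _ => ?_) ?_
    · rw [map_mul]
      exact mul_self_nonneg _
    · rw [map_mul]
      exact mul_pos hl hl
  obtain ⟨ρ, hρ, hρpos⟩ := Smooth.exists_sqrt _ hpos
  obtain ⟨ρi, hρi⟩ := ρ.exists_inv fun x => (hρpos x).ne'
  obtain ⟨k, hk⟩ := Smooth.exists_inv (algebraMap ℝ (Smooth U) l * (ρ + algebraMap ℝ _ l))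
    fun x => (mul_pos hl (add_pos (hρpos x) hl)).ne'
  have hli : algebraMap ℝ (Smooth U) l * algebraMap ℝ (Smooth U) l⁻¹ = 1 := by
    rw [← map_mul, mul_inv_cancel₀ hl.ne', map_one]
  rw [← hρ] at hmid
  obtain ⟨u, E, h⟩ := exists_orthonormal_frame (by omega) B.V hρi hli hk hρ hmid
  let s : NullFrameIndices (Fin (d + 1)) :=
    { i0 := 0
      i1 := ⟨1, by omega⟩
      i2 := ⟨2, by omega⟩
      iV := Fin.last d
      ne01 := by simp [Fin.ext_iff]
      ne02 := by simp [Fin.ext_iff]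
      ne0V := h0
      ne12 := by simp [Fin.ext_iff]
      ne1V := by simp only [Ne, Fin.ext_iff, Fin.val_last]; omega
      ne2V := by simp only [Ne, Fin.ext_iff, Fin.val_last]; omega }
  -- With E₁ + u and (E₁ - u)/2, the off-diagonal part of the form contributes E₁⊗E₁ - u⊗u.
  let F : Fin (d + 1) → Fin (d + 1) → Smooth U := fun i =>
    if i = s.i0 then fun A => E s.i1 A + u A else
    if i = s.i1 then fun A => algebraMap ℝ _ (1 / 2) * (E s.i1 A - u A) else
    if i = s.iV then B.V else E i
  have hhalf : algebraMap ℝ (Smooth U) (1 / 2) + algebraMap ℝ (Smooth U) (1 / 2) = 1 := by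
    rw [← map_add, add_halves, map_one]
  let li := algebraMap ℝ (Smooth U) l⁻¹
  -- V is kept unnormalized in the frame, so its coefficient in the form is -1/l².
  refine ⟨s, fun i => if i = s.iV then -(li * li) else 1, F, fun A C => ?_, ?_⟩
  · have e1 : etaR U A = if A = 0 ∨ A = Fin.last d then -1 else 1 := by
      rw [etaR, eta]
      split_ifs <;> simp
    rw [e1, ← h A C]
    let g : Fin (d + 1) → Smooth U := fun i => if i = s.i0 then -(u A * u C) else
      if i = s.iV then -(li * li * (B.V A * B.V C)) else E i A * E i C
    have e2 : -(u A * u C) - li * li * (B.V A * B.V C) +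
        ∑ i ∈ Finset.univ.filter fun i : Fin (d + 1) => ¬(i = 0 ∨ i = Fin.last d),
          E i A * E i C = ∑ i, g i := by
      rw [sum_split_ends (by omega), sub_eq_add_neg]
      congr 1
      · simp only [g, s, if_true, if_neg h0.symm]
      · refine Finset.sum_congr rfl fun i hi => ?_
        have hi' := (Finset.mem_filter.1 hi).2
        rw [not_or] at hi'
        simp only [g, s, if_neg hi'.1, if_neg hi'.2]
    change _ = -(u A * u C) - li * li * (B.V A * B.V C) + _
    rw [e2, s.sum_split, s.sum_split]
    have e3 : ∀ i ∈ Finset.univ.filter fun i => i ≠ s.i0 ∧ i ≠ s.i1 ∧ i ≠ s.i2,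
        s.dualFrame (fun i => if i = s.iV then -(li * li) else 1) F i A * F i C = g i := by
      intro i hi
      obtain ⟨a, b, e⟩ := (Finset.mem_filter.1 hi).2
      simp only [NullFrameIndices.dualFrame, F, g, if_neg a, if_neg b, if_neg e]
      split_ifs <;> ring
    rw [Finset.sum_congr rfl e3]
    congr 1
    simp only [NullFrameIndices.dualFrame, F, g, if_true, if_neg s.ne01.symm, if_neg s.ne02.symm,
      if_neg s.ne12.symm, if_neg s.ne1V, if_neg s.ne2V]
    linear_combination (E s.i1 A * E s.i1 C - u A * u C) * hhalf
  · simp only [F, if_neg s.ne0V.symm, if_neg s.ne1V.symm, if_true]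

/-- Right inverses of `h - m` on traceless functions, and of `S̄†` on those of definite weight. -/
theorem exists_rightInverses (hd : 3 ≤ d) (hl : 0 < l) :
    ∃ J L : ℤ → Module.End (Smooth U) (Fiber U), ∀ m,
      (∀ φ ∈ tracelessFiber U, J m φ ∈ tracelessFiber U ∧
        (B.opH - (m : Module.End (Smooth U) (Fiber U))) (J m φ) = φ) ∧
      (∀ φ ∈ tracelessFiber U, L m φ ∈ tracelessFiber U) ∧
      ∀ φ ∈ B.weightFiber (m - 2), L m φ ∈ B.weightFiber m ∧ B.opSbd (L m φ) = φ := by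
  obtain ⟨s, c, F, hF, hV⟩ := B.exists_null_frame hd hl
  exact B.exists_rightInverses_of_frame s c F hF hV

end Background

end FrameExistence

/-! ### Commutators of first order operators and invariance of traceless functions. -/

section FirstOrder

open MvPolynomial

variable {d : ℕ} {U : TopologicalSpace.Opens (Fin d → ℝ)}

/-- The polynomials in the variables that are dual to `Y, a†`. -/
abbrev DualPoly (U : TopologicalSpace.Opens (Fin d → ℝ)) : Type :=
  MvPolynomial (Fin (d + 1) ⊕ Fin (d + 1)) (Smooth U)

/-- `P` is the transpose of the first order operator `f ↦ D f + g f`. -/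
def HasTranspose (P : Module.End (Smooth U) (Fiber U))
    (D : Derivation (Smooth U) (DualPoly U) (DualPoly U)) (g : DualPoly U) : Prop :=
  ∀ φ f, pairing (P φ) f = pairing φ (D f + g * f)

/-- The transpose of a commutator is the commutator in the opposite order, and derivations agree
once they agree on variables. All operator identities are thereby reduced to checks on p and q. -/
theorem HasTranspose.commutator {P Q Z : Module.End (Smooth U) (Fiber U)}
    {D D' D'' : Derivation (Smooth U) (DualPoly U) (DualPoly U)} {g g' g'' : DualPoly U}
    (hX : HasTranspose P D g) (hY : HasTranspose Q D' g') (hZ : HasTranspose Z D'' g'')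
    (h : ∀ x, D' (D (X x)) - D (D' (X x)) = D'' (X x)) (h' : D' g - D g' = g'') (φ : Fiber U) :
    P (Q φ) - Q (P φ) = Z φ := by
  have hD : ⁅D', D⁆ = D'' := MvPolynomial.derivation_ext h
  refine pairing_injective (LinearMap.ext fun f => ?_)
  have h1 := congrArg (fun E => E f) hD
  simp only [Derivation.commutator_apply] at h1
  rw [map_sub, LinearMap.sub_apply, hX, hY, hY, hX, hZ, ← map_sub, ← h', ← h1]
  congr 1
  simp only [map_add, Derivation.leibniz, smul_eq_mul]
  ring

theorem mkDerivation_apply_eq_sum {σ R : Type*} [Fintype σ] [CommRing R] (g : σ → MvPolynomial σ R)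
    (f : MvPolynomial σ R) : mkDerivation R g f = ∑ x, g x * pderiv x f := by
  classical
  have : mkDerivation R g = ∑ x, g x • pderiv x := by
    refine MvPolynomial.derivation_ext fun i => ?_
    simp [derivation_sum_apply, Pi.single_apply]
  rw [this]
  simp [derivation_sum_apply]

/-- The derivation `p ∂_q`. -/
def derQP : Derivation (Smooth U) (DualPoly U) (DualPoly U) :=
  mkDerivation _ (Sum.elim 0 (varP _ _))

/-- The derivation defined by a matrix. -/
def derMatrix (M : Fin (d + 1) → Fin (d + 1) → Smooth U) :
    Derivation (Smooth U) (DualPoly U) (DualPoly U) :=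
  mkDerivation _ (Sum.elim (fun A => ∑ C, M C A • varP _ _ C) (fun A => ∑ C, M C A • varQ _ _ C))

theorem derQP_varP (A : Fin (d + 1)) : derQP (U := U) (varP _ _ A) = 0 := by simp [derQP, varP]

theorem derQP_varQ (A : Fin (d + 1)) : derQP (U := U) (varQ _ _ A) = varP _ _ A := by
  simp [derQP, varQ]

theorem derMatrix_varP (M : Fin (d + 1) → Fin (d + 1) → Smooth U) (A : Fin (d + 1)) :
    derMatrix M (varP _ _ A) = ∑ C, M C A • varP _ _ C := by simp [derMatrix, varP]

theorem derMatrix_varQ (M : Fin (d + 1) → Fin (d + 1) → Smooth U) (A : Fin (d + 1)) :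
    derMatrix M (varQ _ _ A) = ∑ C, M C A • varQ _ _ C := by simp [derMatrix, varQ]

/-- The operator `-M^B{}_A (Y^A ∂_{Y^B} + a^A ∂_{a^B}) - v^A ∂_{Y^A}`. -/
def linOp (M : Fin (d + 1) → Fin (d + 1) → Smooth U) (v : Fin (d + 1) → Smooth U) :
    Module.End (Smooth U) (Fiber U) :=
  - ∑ A, ∑ C, M C A • (mulY A * derY C + mulA A * derA C) - ∑ A, v A • derY A

theorem hasTranspose_linOp (M : Fin (d + 1) → Fin (d + 1) → Smooth U)
    (v : Fin (d + 1) → Smooth U) :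
    HasTranspose (linOp M v) (-derMatrix M) (-∑ A, v A • varP _ (Smooth U) A) := by
  intro φ f
  rw [Derivation.neg_apply, derMatrix, mkDerivation_apply_eq_sum, Fintype.sum_sum_type]
  simp only [linOp, LinearMap.sub_apply, LinearMap.neg_apply, LinearMap.sum_apply,
    LinearMap.smul_apply, LinearMap.add_apply, Module.End.mul_apply, map_sub, map_neg, map_sum,
    Derivation.map_smul, map_smul, map_add, pairing_mulY, pairing_mulA, pairing_derY, pairing_derA, Sum.elim_inl,
    Sum.elim_inr, smul_add, Finset.sum_add_distrib, Finset.sum_mul, smul_mul_assoc, neg_mul, varP,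
    varQ]
  ring

theorem hasTranspose_opSd : HasTranspose (opSd (U := U)) derQP 0 := by
  intro φ f
  rw [derQP, mkDerivation_apply_eq_sum, Fintype.sum_sum_type]
  simp only [opSd, LinearMap.sum_apply, Module.End.mul_apply, map_sum, pairing_mulA, pairing_derY,
    Sum.elim_inl, Sum.elim_inr, varP, Pi.zero_apply, zero_mul, Finset.sum_const_zero, zero_add,
    add_zero]

theorem hasTranspose_smul_derY (v : Fin (d + 1) → Smooth U) :
    HasTranspose (∑ A, v A • derY A) 0 (∑ A, v A • varP _ (Smooth U) A) := by
  intro φ f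
  simp only [LinearMap.sum_apply, LinearMap.smul_apply, map_sum, Derivation.map_smul, map_smul, pairing_derY,
    Derivation.zero_apply, zero_add, Finset.sum_mul, smul_mul_assoc, varP]

theorem hasTranspose_smul_derA (v : Fin (d + 1) → Smooth U) :
    HasTranspose (∑ A, v A • derA A) 0 (∑ A, v A • varQ _ (Smooth U) A) := by
  intro φ f
  simp only [LinearMap.sum_apply, LinearMap.smul_apply, map_sum, Derivation.map_smul, map_smul, pairing_derA,
    Derivation.zero_apply, zero_add, Finset.sum_mul, smul_mul_assoc, varQ]

theorem HasTranspose.smul {P : Module.End (Smooth U) (Fiber U)}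
    {D : Derivation (Smooth U) (DualPoly U) (DualPoly U)} {g : DualPoly U}
    (hX : HasTranspose P D g) (r : Smooth U) : HasTranspose (r • P) (r • D) (r • g) := by
  intro φ f
  rw [LinearMap.smul_apply, map_smul, LinearMap.smul_apply, hX, Derivation.smul_apply,
    smul_mul_assoc, ← smul_add, map_smul]

namespace Background

variable {l : ℝ} (B : Background U l)

theorem hasTranspose_connection (μ : Fin d) : HasTranspose (B.connection μ)
    (-derMatrix (B.omega μ)) (-∑ A, B.e μ A • varP _ (Smooth U) A) :=
  hasTranspose_linOp _ _

theorem hasTranspose_opH :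
    HasTranspose B.opH (derEuler _ _) (-∑ A, B.V A • varP _ (Smooth U) A) := by
  intro φ f
  have h := B.pairing_opH 0 φ f
  rw [transH_apply, zero_smul, sub_zero, Int.cast_zero, sub_zero] at h
  rw [h, neg_mul, ← sub_eq_add_neg]

theorem hasTranspose_opSbd :
    HasTranspose B.opSbd (derPQ _ _) (∑ A, B.V A • varQ _ (Smooth U) A) := by
  intro φ f
  rw [B.pairing_opSbd, transS_apply]

end Background

/-! ### Commutators -/

theorem linOp_commutator (M N : Fin (d + 1) → Fin (d + 1) → Smooth U)
    (v w : Fin (d + 1) → Smooth U) (φ : Fiber U) :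
    linOp M v (linOp N w φ) - linOp N w (linOp M v φ) =
      linOp (fun A C => ∑ E, (M A E * N E C - N A E * M E C))
        (fun A => ∑ E, (M A E * w E - N A E * v E)) φ := by
  refine (hasTranspose_linOp M v).commutator (hasTranspose_linOp N w) (hasTranspose_linOp _ _)
    (fun x => ?_) ?_ φ
  · rcases x with A | A
    · change (-derMatrix N) ((-derMatrix M) (varP _ _ A)) - (-derMatrix M) ((-derMatrix N)
        (varP _ _ A)) = (-derMatrix _) (varP _ _ A)
      simp only [Derivation.neg_apply, derMatrix_varP, map_neg, map_sum, Derivation.map_smul, map_smul, smul_neg, Finset.sum_neg_distrib, neg_neg,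
        Finset.smul_sum, smul_smul, Finset.sum_smul, sub_smul, Finset.sum_sub_distrib, neg_sub]
      conv_rhs => arg 1; rw [Finset.sum_comm]
      conv_rhs => arg 2; rw [Finset.sum_comm]
      simp only [mul_comm (N _ A), mul_comm (M _ A)]
    · change (-derMatrix N) ((-derMatrix M) (varQ _ _ A)) - (-derMatrix M) ((-derMatrix N)
        (varQ _ _ A)) = (-derMatrix _) (varQ _ _ A)
      simp only [Derivation.neg_apply, derMatrix_varQ, map_neg, map_sum, Derivation.map_smul, map_smul, smul_neg, Finset.sum_neg_distrib, neg_neg,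
        Finset.smul_sum, smul_smul, Finset.sum_smul, sub_smul, Finset.sum_sub_distrib, neg_sub]
      conv_rhs => arg 1; rw [Finset.sum_comm]
      conv_rhs => arg 2; rw [Finset.sum_comm]
      simp only [mul_comm (N _ A), mul_comm (M _ A)]
  · simp only [Derivation.neg_apply, derMatrix_varP, map_neg, map_sum, Derivation.map_smul, map_smul, smul_neg, Finset.sum_neg_distrib, neg_neg,
        Finset.smul_sum, smul_smul, Finset.sum_smul, sub_smul, Finset.sum_sub_distrib, neg_sub]
    conv_rhs => arg 1; rw [Finset.sum_comm]
    conv_rhs => arg 2; rw [Finset.sum_comm]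
    simp only [mul_comm (w _), mul_comm (v _)]

/-- The matrix acts in the same way on Y and a†, and p∂_q annihilates the linear form in p defined
by v. -/
theorem opSd_linOp (M : Fin (d + 1) → Fin (d + 1) → Smooth U) (v : Fin (d + 1) → Smooth U)
    (φ : Fiber U) : opSd (linOp M v φ) = linOp M v (opSd φ) := by
  rw [← sub_eq_zero]
  refine hasTranspose_opSd.commutator (hasTranspose_linOp M v)
    (Z := 0) (D'' := 0) (g'' := 0) (fun φ f => by simp) (fun x => ?_) ?_ φ
  · rcases x with A | A
    · change (-derMatrix M) (derQP (varP _ _ A)) - derQP ((-derMatrix M) (varP _ _ A)) = 0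
      simp [derMatrix_varP, derQP_varP]
    · change (-derMatrix M) (derQP (varQ _ _ A)) - derQP ((-derMatrix M) (varQ _ _ A)) = 0
      simp [derMatrix_varP, derMatrix_varQ, derQP_varQ]
  · simp [derQP_varP]

namespace Background

variable {l : ℝ} (B : Background U l)

theorem opH_opSbd (φ : Fiber U) :
    B.opH (B.opSbd φ) = B.opSbd (B.opH φ) - (2 : ℤ) • B.opSbd φ := by
  have h := B.hasTranspose_opH.commutator B.hasTranspose_opSbd
    ((B.hasTranspose_opSbd).smul (-2 : Smooth U)) (fun x => ?_) ?_ φ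
  · rw [sub_eq_iff_eq_add] at h
    rw [h, LinearMap.smul_apply, neg_smul, ofNat_smul_eq_nsmul, neg_add_eq_sub]
    rfl
  · rcases x with A | A
    · change derPQ _ _ (derEuler _ _ (varP _ (Smooth U) A)) - derEuler _ _ (derPQ _ (Smooth U) (varP _ (Smooth U) A)) =
        (-2 : Smooth U) • derPQ _ (Smooth U) (varP _ (Smooth U) A)
      rw [derEuler_varP, derPQ_varP, derEuler_varQ, map_neg, derPQ_varP, neg_smul, two_smul]
      ring
    · change derPQ _ _ (derEuler _ _ (varQ _ (Smooth U) A)) - derEuler _ _ (derPQ _ (Smooth U) (varQ _ (Smooth U) A)) =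
        (-2 : Smooth U) • derPQ _ (Smooth U) (varQ _ (Smooth U) A)
      simp [derEuler_varQ, derPQ_varQ]
  · simp only [map_neg, map_sum, Derivation.map_smul, map_smul, derPQ_varP, derEuler_varQ, neg_smul, two_smul]
    ring

theorem opH_opSd (φ : Fiber U) :
    B.opH (opSd φ) = opSd (B.opH φ) + (2 : ℤ) • opSd φ := by
  have h := B.hasTranspose_opH.commutator hasTranspose_opSd
    (hasTranspose_opSd.smul (2 : Smooth U)) (fun x => ?_) ?_ φ
  · rw [sub_eq_iff_eq_add] at h
    rw [h, LinearMap.smul_apply, ofNat_smul_eq_nsmul, add_comm]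
    rfl
  · rcases x with A | A
    · change derQP (derEuler _ _ (varP _ (Smooth U) A)) - derEuler _ _ (derQP (varP _ (Smooth U) A)) =
        (2 : Smooth U) • derQP (varP _ (Smooth U) A)
      simp [derEuler_varP, derQP_varP]
    · change derQP (derEuler _ _ (varQ _ (Smooth U) A)) - derEuler _ _ (derQP (varQ _ (Smooth U) A)) =
        (2 : Smooth U) • derQP (varQ _ (Smooth U) A)
      rw [derEuler_varQ, derQP_varQ, derEuler_varP, two_smul]
      ring
  · simp [derQP_varP]

theorem opSd_opSbd (φ : Fiber U) : opSd (B.opSbd φ) = B.opSbd (opSd φ) + B.opH φ := by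
  have h := hasTranspose_opSd.commutator B.hasTranspose_opSbd B.hasTranspose_opH
    (fun x => ?_) ?_ φ
  · rw [← h]
    abel
  · rcases x with A | A
    · change derPQ _ _ (derQP (varP _ (Smooth U) A)) - derQP (derPQ _ (Smooth U) (varP _ (Smooth U) A)) =
        derEuler _ _ (varP _ (Smooth U) A)
      simp [derEuler_varP, derQP_varP, derPQ_varP, derQP_varQ]
    · change derPQ _ _ (derQP (varQ _ (Smooth U) A)) - derQP (derPQ _ (Smooth U) (varQ _ (Smooth U) A)) =
        derEuler _ _ (varQ _ (Smooth U) A)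
      simp [derEuler_varQ, derQP_varQ, derPQ_varP, derPQ_varQ]
  · simp [derQP_varQ]

/-- The shift of Y by V in h leaves the defect v - MV, which for the connection is ∂_μV and cancels
against the x-derivative of V. -/
theorem opH_linOp (M : Fin (d + 1) → Fin (d + 1) → Smooth U) (v : Fin (d + 1) → Smooth U)
    (φ : Fiber U) : linOp M v (B.opH φ) = B.opH (linOp M v φ) +
      (∑ A, (v A - ∑ C, M A C * B.V C) • derY A) φ := by
  have h := (hasTranspose_linOp M v).commutator B.hasTranspose_opH
    (hasTranspose_smul_derY fun A => v A - ∑ C, M A C * B.V C) (fun x => ?_) ?_ φ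
  · rw [← h]
    abel
  · rcases x with A | A
    · change derEuler _ _ ((-derMatrix M) (varP _ (Smooth U) A)) - (-derMatrix M) (derEuler _ _
        (varP _ (Smooth U) A)) = 0
      simp [derEuler_varP, derMatrix_varP]
    · change derEuler _ _ ((-derMatrix M) (varQ _ (Smooth U) A)) - (-derMatrix M) (derEuler _ _
        (varQ _ (Smooth U) A)) = 0
      simp [derEuler_varQ, derMatrix_varQ]
  · simp only [map_neg, map_sum, Derivation.map_smul, map_smul, Derivation.neg_apply, derEuler_varP, derMatrix_varP,
      smul_neg, Finset.sum_neg_distrib, neg_neg, sub_smul, Finset.sum_sub_distrib, Finset.sum_smul,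
      Finset.smul_sum, smul_smul]
    rw [Finset.sum_comm]
    simp only [mul_comm (B.V _)]

theorem opSbd_linOp (M : Fin (d + 1) → Fin (d + 1) → Smooth U) (v : Fin (d + 1) → Smooth U)
    (φ : Fiber U) : linOp M v (B.opSbd φ) = B.opSbd (linOp M v φ) -
      (∑ A, (v A - ∑ C, M A C * B.V C) • derA A) φ := by
  have h := B.hasTranspose_opSbd.commutator (hasTranspose_linOp M v)
    (hasTranspose_smul_derA fun A => v A - ∑ C, M A C * B.V C) (fun x => ?_) ?_ φ
  · rw [← h]
    abel
  · rcases x with A | A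
    · change (-derMatrix M) (derPQ _ (Smooth U) (varP _ (Smooth U) A)) - derPQ _ _ ((-derMatrix M)
        (varP _ (Smooth U) A)) = 0
      simp [derPQ_varP, derMatrix_varP, derMatrix_varQ]
    · change (-derMatrix M) (derPQ _ (Smooth U) (varQ _ (Smooth U) A)) - derPQ _ _ ((-derMatrix M)
        (varQ _ (Smooth U) A)) = 0
      simp [derPQ_varQ, derMatrix_varQ]
  · simp only [map_neg, map_sum, Derivation.map_smul, map_smul, Derivation.neg_apply, derPQ_varP, derMatrix_varQ,
      smul_neg, Finset.sum_neg_distrib, neg_neg, sub_smul, Finset.sum_sub_distrib, Finset.sum_smul,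
      Finset.smul_sum, smul_smul]
    rw [Finset.sum_comm]
    simp only [mul_comm (B.V _)]
    ring

end Background

/-! ### Invariance of the traceless functions -/

/-- The quadratic form of the metric. -/
def etaForm (x y : Fin (d + 1) → DualPoly U) : DualPoly U := ∑ A, etaR U A • (x A * y A)

/-- The ideal generated by the quadratic constraints. -/
def etaIdeal (U : TopologicalSpace.Opens (Fin d → ℝ)) : Ideal (DualPoly U) :=
  Ideal.span {etaForm (varP _ _) (varP _ _), etaForm (varP _ _) (varQ _ _),
    etaForm (varQ _ _) (varQ _ _)}

theorem mem_tracelessFiber_iff (φ : Fiber U) :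
    φ ∈ tracelessFiber U ↔ ∀ f ∈ etaIdeal U, pairing φ f = 0 := by
  simp only [tracelessFiber, Submodule.mem_inf, LinearMap.mem_ker]
  have pbox := fun f => pairing_box φ f
  have pS := fun f => pairing_opS φ f
  have pT := fun f => pairing_opT φ f
  constructor
  · rintro ⟨⟨g1, g2⟩, g3⟩ f hf
    rw [etaIdeal, Ideal.span, Submodule.mem_span_triple] at hf
    obtain ⟨x, y, z, rfl⟩ := hf
    rw [map_add, map_add, smul_eq_mul, smul_eq_mul, smul_eq_mul, mul_comm x, mul_comm y,
      mul_comm z, etaForm, etaForm, etaForm, ← pbox, ← pS, ← pT, g1, g2, g3]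
    simp
  · intro h
    refine ⟨⟨?_, ?_⟩, ?_⟩ <;> refine pairing_injective (LinearMap.ext fun f => ?_)
    · rw [pbox, map_zero, LinearMap.zero_apply]
      exact h _ (Ideal.mul_mem_right _ _ (Ideal.subset_span (by simp [etaForm])))
    · rw [pS, map_zero, LinearMap.zero_apply]
      exact h _ (Ideal.mul_mem_right _ _ (Ideal.subset_span (by simp [etaForm])))
    · rw [pT, map_zero, LinearMap.zero_apply]
      exact h _ (Ideal.mul_mem_right _ _ (Ideal.subset_span (by simp [etaForm])))

/-- By the Leibniz rule, D preserves the ideal as soon as it maps the three generators into it;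
multiplication by g preserves any ideal. -/
theorem HasTranspose.mem_tracelessFiber {P : Module.End (Smooth U) (Fiber U)}
    {D : Derivation (Smooth U) (DualPoly U) (DualPoly U)} {g : DualPoly U}
    (hX : HasTranspose P D g) (h1 : D (etaForm (varP _ _) (varP _ _)) ∈ etaIdeal U)
    (h2 : D (etaForm (varP _ _) (varQ _ _)) ∈ etaIdeal U)
    (h3 : D (etaForm (varQ _ _) (varQ _ _)) ∈ etaIdeal U) {φ : Fiber U}
    (hφ : φ ∈ tracelessFiber U) : P φ ∈ tracelessFiber U := by
  rw [mem_tracelessFiber_iff] at hφ ⊢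
  intro f hf
  rw [hX]
  refine hφ _ (add_mem ?_ (Ideal.mul_mem_left _ _ hf))
  rw [etaIdeal, Ideal.span, Submodule.mem_span_triple] at hf
  obtain ⟨a, b, e, rfl⟩ := hf
  simp only [map_add, smul_eq_mul, Derivation.leibniz]
  refine add_mem (add_mem (add_mem ?_ ?_) (add_mem ?_ ?_)) (add_mem ?_ ?_)
  exacts [Ideal.mul_mem_left _ _ h1, Ideal.mul_mem_right _ _ (Ideal.subset_span (by simp)),
    Ideal.mul_mem_left _ _ h2, Ideal.mul_mem_right _ _ (Ideal.subset_span (by simp)),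
    Ideal.mul_mem_left _ _ h3, Ideal.mul_mem_right _ _ (Ideal.subset_span (by simp))]

theorem etaForm_comm (x y : Fin (d + 1) → DualPoly U) : etaForm x y = etaForm y x := by
  simp only [etaForm, mul_comm]

theorem derivation_etaForm (D : Derivation (Smooth U) (DualPoly U) (DualPoly U))
    (x y : Fin (d + 1) → DualPoly U) :
    D (etaForm x y) = etaForm (fun A => D (x A)) y + etaForm x fun A => D (y A) := by
  simp only [etaForm, map_sum, Derivation.map_smul, map_smul, Derivation.leibniz, smul_eq_mul, smul_add,
    Finset.sum_add_distrib, mul_comm (y _)]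
  exact add_comm _ _

theorem etaForm_neg_left (x y : Fin (d + 1) → DualPoly U) :
    etaForm (fun A => - x A) y = - etaForm x y := by
  simp [etaForm]

theorem etaForm_neg_right (x y : Fin (d + 1) → DualPoly U) :
    etaForm x (fun A => - y A) = - etaForm x y := by
  simp [etaForm]

theorem etaForm_zero_left (y : Fin (d + 1) → DualPoly U) : etaForm (fun _ => 0) y = 0 := by
  simp [etaForm]

theorem etaForm_zero_right (y : Fin (d + 1) → DualPoly U) : etaForm y (fun _ => 0) = 0 := by
  simp [etaForm]

theorem etaPP_mem : etaForm (varP _ _) (varP _ _) ∈ etaIdeal U := Ideal.subset_span (by simp)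

theorem etaPQ_mem : etaForm (varP _ _) (varQ _ _) ∈ etaIdeal U := Ideal.subset_span (by simp)

theorem etaQQ_mem : etaForm (varQ _ _) (varQ _ _) ∈ etaIdeal U := Ideal.subset_span (by simp)

theorem opSd_mem_tracelessFiber {φ : Fiber U} (hφ : φ ∈ tracelessFiber U) :
    opSd φ ∈ tracelessFiber U := by
  refine hasTranspose_opSd.mem_tracelessFiber ?_ ?_ ?_ hφ <;> rw [derivation_etaForm] <;>
    simp only [derQP_varP, derQP_varQ, etaForm_zero_left, etaForm_zero_right, add_zero, zero_add]
  · exact zero_mem _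
  · exact etaPP_mem
  · rw [etaForm_comm (varQ _ _)]
    exact add_mem etaPQ_mem etaPQ_mem

namespace Background

variable {l : ℝ} (B : Background U l)

theorem opH_mem_tracelessFiber {φ : Fiber U} (hφ : φ ∈ tracelessFiber U) :
    B.opH φ ∈ tracelessFiber U := by
  refine B.hasTranspose_opH.mem_tracelessFiber ?_ ?_ ?_ hφ <;> rw [derivation_etaForm] <;>
    simp only [derEuler_varP, derEuler_varQ, etaForm_neg_left, etaForm_neg_right]
  · exact add_mem (neg_mem etaPP_mem) (neg_mem etaPP_mem)
  · exact add_mem (neg_mem etaPQ_mem) etaPQ_mem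
  · exact add_mem etaQQ_mem etaQQ_mem

theorem opSbd_mem_tracelessFiber {φ : Fiber U} (hφ : φ ∈ tracelessFiber U) :
    B.opSbd φ ∈ tracelessFiber U := by
  refine B.hasTranspose_opSbd.mem_tracelessFiber ?_ ?_ ?_ hφ <;> rw [derivation_etaForm] <;>
    simp only [derPQ_varP, derPQ_varQ, etaForm_zero_left, etaForm_zero_right, add_zero, zero_add]
  · rw [etaForm_comm (varQ _ _)]
    exact add_mem etaPQ_mem etaPQ_mem
  · exact etaQQ_mem
  · exact zero_mem _

/-- The condition ωη + ηω^T = 0 makes the derivation annihilate the three invariant forms. -/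
theorem connection_mem_tracelessFiber (μ : Fin d) {φ : Fiber U} (hφ : φ ∈ tracelessFiber U) :
    B.connection μ φ ∈ tracelessFiber U := by
  have key : ∀ x y : Fin (d + 1) → DualPoly U,
      etaForm (fun A => ∑ C, B.omega μ C A • x C) y +
        etaForm x (fun A => ∑ C, B.omega μ C A • y C) = 0 := by
    intro x y
    simp only [etaForm, Finset.sum_mul, Finset.mul_sum, Finset.smul_sum, smul_mul_assoc,
      mul_smul_comm, smul_smul]
    rw [Finset.sum_comm, ← Finset.sum_add_distrib]
    refine Finset.sum_eq_zero fun A _ => ?_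
    rw [← Finset.sum_add_distrib]
    refine Finset.sum_eq_zero fun C _ => ?_
    rw [← add_smul]
    have := B.metric μ A C
    simp only [etaR, ← Algebra.smul_def]
    rw [this, zero_smul]
  refine (B.hasTranspose_connection μ).mem_tracelessFiber ?_ ?_ ?_ hφ <;>
    rw [derivation_etaForm] <;>
    simp only [Derivation.neg_apply, derMatrix_varP, derMatrix_varQ, etaForm_neg_left,
      etaForm_neg_right] <;>
    rw [← neg_add, key, neg_zero] <;>
    exact zero_mem _

end Background

end FirstOrder

/-! ### The covariant derivative: flatness and commutation with h, S†, S̄†. -/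

section Covariant

variable {d : ℕ} {U : TopologicalSpace.Opens (Fin d → ℝ)}

/-! ### Partial derivatives -/

theorem partialX_apply (μ : Fin d) (f : Smooth U) (x : U) :
    (partialX μ f).1 x = fderiv ℝ f.ext0 x (Pi.single μ 1) := rfl

theorem Smooth.ext0_eqOn_mul (f g : Smooth U) :
    Set.EqOn (f * g).ext0 (fun y => f.ext0 y * g.ext0 y) U := fun y hy =>
  ((f * g).ext0_apply ⟨y, hy⟩).trans
    (congrArg₂ (· * ·) (f.ext0_apply ⟨y, hy⟩) (g.ext0_apply ⟨y, hy⟩)).symm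

/-- The extensions by zero multiply correctly on the open set U, which is all that a derivative at a
point of U sees. -/
theorem partialX_mul (μ : Fin d) (f g : Smooth U) :
    partialX μ (f * g) = f * partialX μ g + partialX μ f * g := by
  refine Smooth.ext' fun x => ?_
  have h1 : (f * g).ext0 =ᶠ[nhds (x : Fin d → ℝ)] fun y => f.ext0 y * g.ext0 y :=
    (Smooth.ext0_eqOn_mul f g).eventuallyEq_of_mem (U.isOpen.mem_nhds x.2)
  rw [partialX_apply, h1.fderiv_eq, fderiv_fun_mul (f.differentiableAt x) (g.differentiableAt x)]
  simp only [add_apply, smul_apply, smul_eq_mul,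
    f.ext0_apply, g.ext0_apply]
  rw [mul_comm (g.1 x)]
  rfl

theorem partialX_comm (μ ν : Fin d) (f : Smooth U) :
    partialX μ (partialX ν f) = partialX ν (partialX μ f) := by
  refine Smooth.ext' fun x => ?_
  have hf : ContDiffAt ℝ ∞ f.ext0 x := ContDiffOn.contDiffAt f.2 (U.isOpen.mem_nhds x.2)
  have key (i j : Fin d) : (partialX i (partialX j f)).1 x =
      fderiv ℝ (fderiv ℝ f.ext0) x (Pi.single i 1) (Pi.single j 1) := by
    have h1 : (partialX j f).ext0 =ᶠ[nhds (x : Fin d → ℝ)]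
        fun y => fderiv ℝ f.ext0 y (Pi.single j 1) :=
      Set.EqOn.eventuallyEq_of_mem (s := U)
        (fun y hy => Smooth.ext0_apply _ ⟨y, hy⟩) (U.isOpen.mem_nhds x.2)
    have h2 : DifferentiableAt ℝ (fderiv ℝ f.ext0) x :=
      (hf.fderiv_right (m := 1) (by norm_cast)).differentiableAt (by simp)
    rw [partialX_apply, h1.fderiv_eq, fderiv_clm_apply h2 (differentiableAt_const _)]
    simp
  rw [key, key]
  exact hf.isSymmSndFDerivAt (by rw [minSmoothness_of_isRCLikeNormedField]; norm_cast) _ _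

theorem Fiber.coeff_coeff_derX (μ : Fin d) (φ : Fiber U) (n m : Fin (d + 1) →₀ ℕ) :
    MvPolynomial.coeff m ((derX μ φ).coeff n) =
      partialX μ (MvPolynomial.coeff m (φ.coeff n)) := rfl

theorem Fiber.ext_coeff {φ χ : Fiber U} (h : ∀ n m : Fin (d + 1) →₀ ℕ,
    MvPolynomial.coeff m (φ.coeff n) = MvPolynomial.coeff m (χ.coeff n)) : φ = χ :=
  Fiber.ext fun n => MvPolynomial.ext _ _ fun m => h n m

theorem partialX_mul_natCast (μ : Fin d) (f : Smooth U) (n : ℕ) :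
    partialX μ (f * (n : Smooth U)) = partialX μ f * (n : Smooth U) := by
  rw [mul_comm, ← nsmul_eq_mul, map_nsmul, nsmul_eq_mul, mul_comm]

theorem derX_smul (μ : Fin d) (f : Smooth U) (φ : Fiber U) :
    derX μ (f • φ) = f • derX μ φ + partialX μ f • φ := by
  refine Fiber.ext_coeff fun n m => ?_
  simp only [Fiber.coeff_coeff_derX, Fiber.coeff_smul, Fiber.coeff_add, MvPolynomial.coeff_smul,
    MvPolynomial.coeff_add, smul_eq_mul, partialX_mul]

theorem derX_mulY (μ : Fin d) (A : Fin (d + 1)) (φ : Fiber U) :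
    derX μ (mulY A φ) = mulY A (derX μ φ) := by
  refine Fiber.ext_coeff fun n m => ?_
  rw [Fiber.coeff_coeff_derX]
  by_cases h : n A = 0
  · rw [Fiber.coeff_mulY_eq_zero A _ h, Fiber.coeff_mulY_eq_zero A _ h, MvPolynomial.coeff_zero,
      map_zero]
  · obtain ⟨k, rfl⟩ : ∃ k, n = k + Finsupp.single A 1 :=
      ⟨n - Finsupp.single A 1, (tsub_add_cancel_of_le (by simpa [Nat.one_le_iff_ne_zero])).symm⟩
    rw [Fiber.coeff_mulY, Fiber.coeff_mulY, Fiber.coeff_coeff_derX]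

theorem derX_derY (μ : Fin d) (A : Fin (d + 1)) (φ : Fiber U) :
    derX μ (derY A φ) = derY A (derX μ φ) := by
  refine Fiber.ext_coeff fun n m => ?_
  rw [Fiber.coeff_coeff_derX, Fiber.coeff_derY, Fiber.coeff_derY, mul_comm, ← nsmul_eq_mul,
    mul_comm, ← nsmul_eq_mul, MvPolynomial.coeff_smul, MvPolynomial.coeff_smul,
    Fiber.coeff_coeff_derX, map_nsmul]

theorem derX_mulA (μ : Fin d) (A : Fin (d + 1)) (φ : Fiber U) :
    derX μ (mulA A φ) = mulA A (derX μ φ) := by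
  refine Fiber.ext_coeff fun n m => ?_
  rw [Fiber.coeff_coeff_derX, Fiber.coeff_mulA, Fiber.coeff_mulA, MvPolynomial.coeff_X_mul',
    MvPolynomial.coeff_X_mul']
  split_ifs
  · rfl
  · exact map_zero _

theorem derX_derA (μ : Fin d) (A : Fin (d + 1)) (φ : Fiber U) :
    derX μ (derA A φ) = derA A (derX μ φ) := by
  refine Fiber.ext_coeff fun n m => ?_
  rw [Fiber.coeff_coeff_derX, Fiber.coeff_derA, Fiber.coeff_derA, MvPolynomial.coeff_pderiv,
    MvPolynomial.coeff_pderiv, Fiber.coeff_coeff_derX]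
  exact_mod_cast partialX_mul_natCast μ _ (m A + 1)

theorem derX_comm (μ ν : Fin d) (φ : Fiber U) : derX μ (derX ν φ) = derX ν (derX μ φ) :=
  Fiber.ext_coeff fun n m => by
    rw [Fiber.coeff_coeff_derX, Fiber.coeff_coeff_derX, partialX_comm]
    rfl

theorem derX_linOp (μ : Fin d) (M : Fin (d + 1) → Fin (d + 1) → Smooth U)
    (v : Fin (d + 1) → Smooth U) (φ : Fiber U) :
    derX μ (linOp M v φ) = linOp M v (derX μ φ) +
      linOp (fun A C => partialX μ (M A C)) (fun A => partialX μ (v A)) φ := by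
  simp only [linOp, LinearMap.sub_apply, LinearMap.neg_apply, LinearMap.sum_apply,
    LinearMap.smul_apply, LinearMap.add_apply, Module.End.mul_apply, map_sub, map_neg, map_sum,
    map_add, derX_smul, derX_mulY, derX_mulA, derX_derY, derX_derA, Finset.sum_add_distrib]
  abel

theorem linOp_add (M N : Fin (d + 1) → Fin (d + 1) → Smooth U)
    (v w : Fin (d + 1) → Smooth U) :
    linOp (M + N) (v + w) = linOp M v + linOp N w := by
  simp only [linOp, Pi.add_apply, add_smul, Finset.sum_add_distrib]
  abel

theorem linOp_neg (M : Fin (d + 1) → Fin (d + 1) → Smooth U)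
    (v : Fin (d + 1) → Smooth U) : linOp (-M) (-v) = - linOp M v := by
  simp only [linOp, Pi.neg_apply, neg_smul, Finset.sum_neg_distrib]
  abel

theorem linOp_zero : linOp (U := U) 0 0 = 0 := by simp [linOp]

theorem derX_opSd (μ : Fin d) (φ : Fiber U) : derX μ (opSd φ) = opSd (derX μ φ) := by
  simp only [opSd, LinearMap.sum_apply, Module.End.mul_apply, map_sum, derX_mulA, derX_derY]

theorem derX_eta_smul (μ : Fin d) (A : Fin (d + 1)) (φ : Fiber U) :
    derX μ (eta A • φ) = eta A • derX μ φ := map_smul _ _ _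

theorem derX_mem_tracelessFiber (μ : Fin d) {φ : Fiber U} (hφ : φ ∈ tracelessFiber U) :
    derX μ φ ∈ tracelessFiber U := by
  simp only [tracelessFiber, Submodule.mem_inf, LinearMap.mem_ker] at hφ ⊢
  obtain ⟨⟨h1, h2⟩, h3⟩ := hφ
  have e1 : derX μ (box φ) = box (derX μ φ) := by
    simp only [box, LinearMap.sum_apply, LinearMap.smul_apply, Module.End.mul_apply, map_sum,
      derX_eta_smul, derX_derY]
  have e2 : derX μ (opS φ) = opS (derX μ φ) := by
    simp only [opS, LinearMap.sum_apply, LinearMap.smul_apply, Module.End.mul_apply, map_sum,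
      derX_eta_smul, derX_derY, derX_derA]
  have e3 : derX μ (opT φ) = opT (derX μ φ) := by
    simp only [opT, LinearMap.sum_apply, LinearMap.smul_apply, Module.End.mul_apply, map_sum,
      derX_eta_smul, derX_derA]
  rw [← e1, ← e2, ← e3, h1, h2, h3]
  simp

namespace Background

variable {l : ℝ} (B : Background U l)

/-- The covariant derivative `∇_μ + σ_μ`. -/
def covDer (μ : Fin d) : Fiber U →ₗ[ℝ] Fiber U :=
  derX μ + (B.connection μ).restrictScalars ℝ

theorem covDer_apply (μ : Fin d) (φ : Fiber U) :
    B.covDer μ φ = derX μ φ + linOp (B.omega μ) (B.e μ) φ := rfl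

theorem covDer_smul (μ : Fin d) (f : Smooth U) (φ : Fiber U) :
    B.covDer μ (f • φ) = f • B.covDer μ φ + partialX μ f • φ := by
  rw [covDer_apply, covDer_apply, derX_smul, map_smul, smul_add]
  abel

theorem covDer_mem_tracelessFiber (μ : Fin d) {φ : Fiber U} (hφ : φ ∈ tracelessFiber U) :
    B.covDer μ φ ∈ tracelessFiber U :=
  add_mem (derX_mem_tracelessFiber μ hφ) (B.connection_mem_tracelessFiber μ hφ)

theorem covDer_opSd (μ : Fin d) (φ : Fiber U) : B.covDer μ (opSd φ) = opSd (B.covDer μ φ) := by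
  rw [covDer_apply, covDer_apply, derX_opSd, map_add, opSd_linOp]

theorem vielbein_sub (μ : Fin d) (A : Fin (d + 1)) :
    B.e μ A - ∑ C, B.omega μ A C * B.V C = partialX μ (B.V A) := by
  rw [← B.vielbein μ A, add_sub_cancel_right]

/-- The x-dependence of h is only through V, and ∂_μV + ω_μV = e_μ cancels its derivative against
the defect in `opH_linOp`. -/
theorem covDer_opH (μ : Fin d) (φ : Fiber U) : B.covDer μ (B.opH φ) = B.opH (B.covDer μ φ) := by
  have h : derX μ (B.opH φ) = B.opH (derX μ φ) - ∑ A, partialX μ (B.V A) • derY A φ := by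
    simp only [opH, LinearMap.sub_apply, LinearMap.add_apply, LinearMap.sum_apply,
      Module.End.mul_apply, map_sub, map_sum, LinearMap.smul_apply, Module.End.one_apply, map_add,
      derX_smul, derX_mulY, derX_mulA, derX_derY, derX_derA, Finset.sum_add_distrib]
    abel
  rw [covDer_apply, covDer_apply, h, opH_linOp, map_add]
  simp only [vielbein_sub, LinearMap.sum_apply, LinearMap.smul_apply]
  abel

theorem covDer_opSbd (μ : Fin d) (φ : Fiber U) :
    B.covDer μ (B.opSbd φ) = B.opSbd (B.covDer μ φ) := by
  have h : derX μ (B.opSbd φ) = B.opSbd (derX μ φ) + ∑ A, partialX μ (B.V A) • derA A φ := by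
    simp only [opSbd, LinearMap.add_apply, LinearMap.sum_apply,
      Module.End.mul_apply, map_sum, LinearMap.smul_apply, Module.End.one_apply, map_add,
      derX_smul, derX_mulY, derX_derA, Finset.sum_add_distrib]
    abel
  rw [covDer_apply, covDer_apply, h, opSbd_linOp, map_add]
  simp only [vielbein_sub, LinearMap.sum_apply, LinearMap.smul_apply]
  abel

/-- The curvature is `linOp` applied to dω + ωω and de + ωe, both of which vanish. -/
theorem covDer_comm (μ ν : Fin d) (φ : Fiber U) :
    B.covDer μ (B.covDer ν φ) = B.covDer ν (B.covDer μ φ) := by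
  rw [← sub_eq_zero]
  simp only [covDer_apply, map_add, derX_linOp]
  rw [derX_comm ν μ]
  have h := linOp_commutator (B.omega μ) (B.omega ν) (B.e μ) (B.e ν) φ
  have hM : (fun A C => partialX μ (B.omega ν A C)) + -(fun A C => partialX ν (B.omega μ A C)) +
      (fun A C => ∑ E, (B.omega μ A E * B.omega ν E C - B.omega ν A E * B.omega μ E C)) = 0 := by
    funext A C
    exact (congrArg (· + _) (sub_eq_add_neg _ _).symm).trans (B.flat μ ν A C)
  have hv : (fun A => partialX μ (B.e ν A)) + -(fun A => partialX ν (B.e μ A)) +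
      (fun A => ∑ E, (B.omega μ A E * B.e ν E - B.omega ν A E * B.e μ E)) = 0 := by
    funext A
    exact (congrArg (· + _) (sub_eq_add_neg _ _).symm).trans (B.torsion μ ν A)
  have key := congrArg (fun D => D φ)
    ((congrArg₂ linOp hM hv).trans linOp_zero)
  simp only [linOp_add, linOp_neg, LinearMap.add_apply, LinearMap.neg_apply,
    LinearMap.zero_apply] at key
  rw [← h] at key
  rw [← key]
  abel

end Background

end Covariant

/-! ### The Grassmann algebra of the ghosts and ghost-graded subspaces. -/

section Ghosts

variable {d : ℕ} {U : TopologicalSpace.Opens (Fin d → ℝ)}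

open Ghost

/-! ### The algebra of the ghost variables -/

theorem Ghost.rank_injective : Function.Injective (rank (d := d)) := by
  intro g g' h
  cases g <;> cases g' <;> simp_all [rank, Fin.ext_iff] <;> omega

/-- The sign that arises from moving ghost variables past each other. -/
def orderSign (g g' : Ghost d) : ℤ := if g'.rank < g.rank then -1 else 1

theorem orderSign_mul_self (g g' : Ghost d) : orderSign g g' * orderSign g g' = 1 := by
  rw [orderSign]
  split_ifs <;> rfl

theorem orderSign_swap {g g' : Ghost d} (h : g ≠ g') : orderSign g' g = - orderSign g g' := by
  have := Ghost.rank_injective.ne h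
  rw [orderSign, orderSign]
  rcases lt_or_gt_of_ne this with h | h
  · simp [h, h.le]
  · simp [h, h.le]

theorem orderSign_self (g : Ghost d) : orderSign g g = 1 := by simp [orderSign]

theorem ghostSign_mul_self (g : Ghost d) (S : Finset (Ghost d)) :
    ghostSign g S * ghostSign g S = 1 := by
  rw [ghostSign, ← pow_add, Even.neg_one_pow ⟨_, rfl⟩]

theorem ghostSign_smul_smul (g : Ghost d) (S : Finset (Ghost d)) (φ : Fiber U) :
    ghostSign g S • ghostSign g S • φ = φ := by
  rw [smul_smul, ghostSign_mul_self, one_smul]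

theorem ghostSign_insert (g : Ghost d) {g' : Ghost d} {S : Finset (Ghost d)} (h : g' ∉ S) :
    ghostSign g (insert g' S) = orderSign g g' * ghostSign g S := by
  rw [ghostSign, ghostSign, orderSign, Finset.filter_insert]
  split_ifs with h'
  · rw [Finset.card_insert_of_notMem (by simp [h]), pow_succ, mul_comm]
  · rw [one_mul]

theorem ghostSign_erase (g : Ghost d) {g' : Ghost d} {S : Finset (Ghost d)} (h : g' ∈ S) :
    ghostSign g (S.erase g') = orderSign g g' * ghostSign g S := by
  have := ghostSign_insert g (Finset.notMem_erase g' S)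
  rw [Finset.insert_erase h] at this
  rw [this, ← mul_assoc, orderSign_mul_self, one_mul]

theorem gmul_apply (g : Ghost d) (ψ : State U) (S : Finset (Ghost d)) :
    gmul g ψ S = if g ∈ S then ghostSign g S • ψ (S.erase g) else 0 := rfl

theorem gder_apply (g : Ghost d) (ψ : State U) (S : Finset (Ghost d)) :
    gder g ψ S = if g ∈ S then 0 else ghostSign g S • ψ (insert g S) := rfl

theorem gmul_apply_mem {g : Ghost d} {S : Finset (Ghost d)} (h : g ∈ S) (ψ : State U) :
    gmul g ψ S = ghostSign g S • ψ (S.erase g) := if_pos h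

theorem gmul_apply_notMem {g : Ghost d} {S : Finset (Ghost d)} (h : g ∉ S) (ψ : State U) :
    gmul g ψ S = 0 := if_neg h

theorem gder_apply_mem {g : Ghost d} {S : Finset (Ghost d)} (h : g ∈ S) (ψ : State U) :
    gder g ψ S = 0 := if_pos h

theorem gder_apply_notMem {g : Ghost d} {S : Finset (Ghost d)} (h : g ∉ S) (ψ : State U) :
    gder g ψ S = ghostSign g S • ψ (insert g S) := if_neg h

theorem gmul_gmul_self (g : Ghost d) (ψ : State U) : gmul g (gmul g ψ) = 0 := by
  funext S
  by_cases h : g ∈ S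
  · rw [gmul_apply_mem h, gmul_apply_notMem (Finset.notMem_erase g S), smul_zero]
    rfl
  · rw [gmul_apply_notMem h]
    rfl

theorem gder_gder_self (g : Ghost d) (ψ : State U) : gder g (gder g ψ) = 0 := by
  funext S
  by_cases h : g ∈ S
  · rw [gder_apply_mem h]
    rfl
  · rw [gder_apply_notMem h, gder_apply_mem (Finset.mem_insert_self g S), smul_zero]
    rfl

theorem gmul_gder_self_apply (g : Ghost d) (ψ : State U) (S : Finset (Ghost d)) :
    gmul g (gder g ψ) S = if g ∈ S then ψ S else 0 := by
  by_cases h : g ∈ S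
  · rw [gmul_apply_mem h, gder_apply_notMem (Finset.notMem_erase g S), ghostSign_erase g h,
      orderSign_self, one_mul, ghostSign_smul_smul, Finset.insert_erase h, if_pos h]
  · rw [gmul_apply_notMem h, if_neg h]

theorem gder_gmul_self_apply (g : Ghost d) (ψ : State U) (S : Finset (Ghost d)) :
    gder g (gmul g ψ) S = if g ∈ S then 0 else ψ S := by
  by_cases h : g ∈ S
  · rw [gder_apply_mem h, if_pos h]
  · rw [gder_apply_notMem h, gmul_apply_mem (Finset.mem_insert_self g S), ghostSign_insert g h,
      orderSign_self, one_mul, ghostSign_smul_smul, Finset.erase_insert h, if_neg h]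

theorem gder_gmul_self (g : Ghost d) (ψ : State U) :
    gder g (gmul g ψ) = ψ - gmul g (gder g ψ) := by
  funext S
  rw [Pi.sub_apply, gmul_gder_self_apply, gder_gmul_self_apply]
  split_ifs <;> simp

/-- Removing one ghost changes the sign of the other exactly when it stands before it; of two
distinct ghosts exactly one precedes the other. -/
theorem gmul_gmul {g g' : Ghost d} (hg : g ≠ g') (ψ : State U) :
    gmul g (gmul g' ψ) = - gmul g' (gmul g ψ) := by
  funext S
  rw [Pi.neg_apply]
  by_cases h : g ∈ S <;> by_cases h' : g' ∈ S
  · rw [gmul_apply_mem h, gmul_apply_mem h', gmul_apply_mem (Finset.mem_erase.2 ⟨hg.symm, h'⟩),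
      gmul_apply_mem (Finset.mem_erase.2 ⟨hg, h⟩), ghostSign_erase _ h, ghostSign_erase _ h',
      Finset.erase_right_comm, smul_smul, smul_smul, ← neg_smul, orderSign_swap hg]
    congr 1
    ring
  · rw [gmul_apply_mem h, gmul_apply_notMem h', gmul_apply_notMem (by simp [h']), smul_zero,
      neg_zero]
  · rw [gmul_apply_mem h', gmul_apply_notMem h, gmul_apply_notMem (by simp [h]), smul_zero,
      neg_zero]
  · rw [gmul_apply_notMem h, gmul_apply_notMem h', neg_zero]

theorem gder_gder {g g' : Ghost d} (hg : g ≠ g') (ψ : State U) :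
    gder g (gder g' ψ) = - gder g' (gder g ψ) := by
  funext S
  rw [Pi.neg_apply]
  by_cases h : g ∈ S <;> by_cases h' : g' ∈ S
  · rw [gder_apply_mem h, gder_apply_mem h', neg_zero]
  · rw [gder_apply_mem h, gder_apply_notMem h', gder_apply_mem (by simp [h]), smul_zero,
      neg_zero]
  · rw [gder_apply_mem h', gder_apply_notMem h, gder_apply_mem (by simp [h']), smul_zero,
      neg_zero]
  · rw [gder_apply_notMem h, gder_apply_notMem h', gder_apply_notMem (by simp [h', hg.symm]),
      gder_apply_notMem (by simp [h, hg]), ghostSign_insert _ h, ghostSign_insert _ h',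
      Finset.insert_comm, smul_smul, smul_smul, ← neg_smul, orderSign_swap hg]
    congr 1
    ring

theorem gder_gmul {g g' : Ghost d} (hg : g ≠ g') (ψ : State U) :
    gder g (gmul g' ψ) = - gmul g' (gder g ψ) := by
  funext S
  rw [Pi.neg_apply]
  by_cases h : g ∈ S <;> by_cases h' : g' ∈ S
  · rw [gder_apply_mem h, gmul_apply_mem h', gder_apply_mem (by simp [h, hg]), smul_zero,
      neg_zero]
  · rw [gder_apply_mem h, gmul_apply_notMem h', neg_zero]
  · rw [gder_apply_notMem h, gmul_apply_mem h', gmul_apply_mem (by simp [h']),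
      gder_apply_notMem (by simp [h]), ghostSign_insert _ h, ghostSign_erase _ h',
      Finset.erase_insert_of_ne hg, smul_smul, smul_smul, ← neg_smul, orderSign_swap hg]
    congr 1
    ring
  · rw [gder_apply_notMem h, gmul_apply_notMem h', gmul_apply_notMem (by simp [h', hg.symm]),
      smul_zero, neg_zero]

theorem gder_eq_zero_iff (g : Ghost d) (ψ : State U) :
    gder g ψ = 0 ↔ ∀ S, g ∈ S → ψ S = 0 := by
  constructor
  · intro h S hS
    have := gmul_gder_self_apply g ψ S
    rw [h, if_pos hS, map_zero] at this
    exact this.symm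
  · intro h
    funext S
    rw [gder_apply, h _ (Finset.mem_insert_self g S), smul_zero, ite_self]
    rfl

/-! ### Componentwise operators -/

/-- A family of operators, acting on the components of a state. -/
def diagOp (D : Finset (Ghost d) → Module.End (Smooth U) (Fiber U)) :
    Module.End (Smooth U) (State U) where
  toFun ψ S := D S (ψ S)
  map_add' ψ χ := by funext S; simp
  map_smul' f ψ := by funext S; simp

theorem diagOp_apply (D : Finset (Ghost d) → Module.End (Smooth U) (Fiber U)) (ψ : State U)
    (S : Finset (Ghost d)) : diagOp D ψ S = D S (ψ S) := rfl

theorem onState_apply (D : Module.End (Smooth U) (Fiber U)) (ψ : State U)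
    (S : Finset (Ghost d)) : onState D ψ S = D (ψ S) := rfl

theorem diagOp_gmul {D : Finset (Ghost d) → Module.End (Smooth U) (Fiber U)} {g : Ghost d}
    (h : ∀ S, g ∉ S → D (insert g S) = D S) (ψ : State U) :
    diagOp D (gmul g ψ) = gmul g (diagOp D ψ) := by
  funext S
  rw [diagOp_apply]
  by_cases hS : g ∈ S
  · have := h _ (Finset.notMem_erase g S)
    rw [Finset.insert_erase hS] at this
    rw [gmul_apply_mem hS, gmul_apply_mem hS, diagOp_apply, map_zsmul, this]
  · rw [gmul_apply_notMem hS, gmul_apply_notMem hS, map_zero]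

theorem diagOp_gder {D : Finset (Ghost d) → Module.End (Smooth U) (Fiber U)} {g : Ghost d}
    (h : ∀ S, g ∉ S → D (insert g S) = D S) (ψ : State U) :
    diagOp D (gder g ψ) = gder g (diagOp D ψ) := by
  funext S
  rw [diagOp_apply]
  by_cases hS : g ∈ S
  · rw [gder_apply_mem hS, gder_apply_mem hS, map_zero]
  · rw [gder_apply_notMem hS, gder_apply_notMem hS, diagOp_apply, map_zsmul, h S hS]

/-- A ghost cannot occur twice, even if the operator in between depends on the ghost content and so
does not commute with g. -/
theorem gmul_diagOp_gmul (D : Finset (Ghost d) → Module.End (Smooth U) (Fiber U)) (g : Ghost d)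
    (ψ : State U) : gmul g (diagOp D (gmul g ψ)) = 0 := by
  funext S
  by_cases h : g ∈ S
  · rw [gmul_apply_mem h, diagOp_apply, gmul_apply_notMem (Finset.notMem_erase g S), map_zero,
      smul_zero]
    rfl
  · rw [gmul_apply_notMem h]
    rfl

theorem gder_diagOp_gder (D : Finset (Ghost d) → Module.End (Smooth U) (Fiber U)) (g : Ghost d)
    (ψ : State U) : gder g (diagOp D (gder g ψ)) = 0 := by
  funext S
  by_cases h : g ∈ S
  · rw [gder_apply_mem h]
    rfl
  · rw [gder_apply_notMem h, diagOp_apply, gder_apply_mem (Finset.mem_insert_self g S), map_zero,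
      smul_zero]
    rfl

theorem onState_gmul (D : Module.End (Smooth U) (Fiber U)) (g : Ghost d) (ψ : State U) :
    onState D (gmul g ψ) = gmul g (onState D ψ) :=
  diagOp_gmul (D := fun _ => D) (fun _ _ => rfl) ψ

theorem onState_gder (D : Module.End (Smooth U) (Fiber U)) (g : Ghost d) (ψ : State U) :
    onState D (gder g ψ) = gder g (onState D ψ) :=
  diagOp_gder (D := fun _ => D) (fun _ _ => rfl) ψ

/-! ### Subspaces defined by the ghost content -/

/-- The states whose components have weights in `T`. -/
def supported (U : TopologicalSpace.Opens (Fin d → ℝ)) (w : Ghost d → ℤ) (T : Set ℤ) :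
    Submodule (Smooth U) (State U) where
  carrier := {ψ | ∀ S : Finset (Ghost d), ∑ g ∈ S, w g ∉ T → ψ S = 0}
  add_mem' {ψ χ} hψ hχ S hS := by simp [hψ S hS, hχ S hS]
  zero_mem' _ _ := rfl
  smul_mem' f ψ hψ S hS := by simp [hψ S hS]

theorem ghostGr_eq_supported (n : ℤ) : ghostGr U n = supported U gh {n} := rfl

theorem gmul_mem_supported {w : Ghost d → ℤ} {T T' : Set ℤ} {g : Ghost d}
    (h : ∀ t ∈ T, t + w g ∈ T') {ψ : State U} (hψ : ψ ∈ supported U w T) :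
    gmul g ψ ∈ supported U w T' := by
  intro S hS
  by_cases hg : g ∈ S
  · rw [gmul_apply_mem hg, hψ, smul_zero]
    intro ht
    refine hS ?_
    have := h _ ht
    rwa [Finset.sum_erase_add _ _ hg] at this
  · exact gmul_apply_notMem hg ψ

theorem gder_mem_supported {w : Ghost d → ℤ} {T T' : Set ℤ} {g : Ghost d}
    (h : ∀ t ∈ T, t - w g ∈ T') {ψ : State U} (hψ : ψ ∈ supported U w T) :
    gder g ψ ∈ supported U w T' := by
  intro S hS
  by_cases hg : g ∈ S
  · exact gder_apply_mem hg ψ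
  · rw [gder_apply_notMem hg, hψ, smul_zero]
    intro ht
    refine hS ?_
    have := h _ ht
    rwa [Finset.sum_insert hg, add_sub_cancel_left] at this

theorem diagOp_mem_supported {w : Ghost d → ℤ} {T : Set ℤ}
    (D : Finset (Ghost d) → Module.End (Smooth U) (Fiber U)) {ψ : State U}
    (hψ : ψ ∈ supported U w T) : diagOp D ψ ∈ supported U w T := fun S hS => by
  rw [diagOp_apply, hψ S hS, map_zero]

theorem onState_mem_supported {w : Ghost d → ℤ} {T : Set ℤ}
    (D : Module.End (Smooth U) (Fiber U)) {ψ : State U}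
    (hψ : ψ ∈ supported U w T) : onState D ψ ∈ supported U w T :=
  diagOp_mem_supported (fun _ => D) hψ

theorem mem_tracelessSections_iff (ψ : State U) : ψ ∈ tracelessSections U ↔
    gder c0 ψ = 0 ∧ gder cdag ψ = 0 ∧ gder xi ψ = 0 ∧ ∀ S, ψ S ∈ tracelessFiber U := by
  simp only [tracelessSections, tracelessFiber, Submodule.mem_inf, LinearMap.mem_ker, funext_iff,
    onState_apply, Pi.zero_apply, forall_and]
  exact ⟨fun ⟨⟨⟨⟨⟨h1, h2⟩, h3⟩, h4⟩, h5⟩, h6⟩ => ⟨h1, h2, h3, ⟨h4, h5⟩, h6⟩,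
    fun ⟨h1, h2, h3, ⟨h4, h5⟩, h6⟩ => ⟨⟨⟨⟨⟨h1, h2⟩, h3⟩, h4⟩, h5⟩, h6⟩⟩

theorem mem_fields_iff {l : ℝ} (B : Background U l) (m : ℤ) (φ : Fiber U) : φ ∈ B.fields m ↔
    φ ∈ tracelessFiber U ∧ B.opH φ = m • φ ∧ B.opSbd φ = 0 := by
  simp only [Background.fields, tracelessFiber, Submodule.mem_inf, LinearMap.mem_ker,
    LinearMap.sub_apply, sub_eq_zero, Module.End.intCast_apply]
  exact and_assoc

/-- The weight of the monomial labelled by `S` in the intermediate system. -/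
def bWeight (S : Finset (Ghost d)) : ℤ := if bdag ∈ S then 0 else 2

theorem mem_intermediateSections_iff {l : ℝ} (B : Background U l) (ψ : State U) :
    ψ ∈ B.intermediateSections ↔
    gder c0 ψ = 0 ∧ gder cdag ψ = 0 ∧ gder xi ψ = 0 ∧ gder mu ψ = 0 ∧ gder nu ψ = 0 ∧
      ∀ S, ψ S ∈ B.fields (bWeight S) := by
  have h : ∀ S, (onState B.opH - 2 + 2 * (gmul bdag * gder bdag) : Module.End (Smooth U) (State U))
      ψ S =
      B.opH (ψ S) - bWeight S • ψ S := by
    intro S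
    have h1 : (onState B.opH - 2 + 2 * (gmul bdag * gder bdag) :
      Module.End (Smooth U) (State U)) ψ =
      onState B.opH ψ - (2 : ℤ) • ψ + (2 : ℤ) • gmul bdag (gder bdag ψ) := by
      simp [LinearMap.add_apply, Module.End.mul_apply, two_smul, Module.End.ofNat_apply]
    rw [h1, Pi.add_apply, Pi.sub_apply, Pi.smul_apply, Pi.smul_apply, gmul_gder_self_apply,
      onState_apply, bWeight]
    split_ifs <;> simp
  simp only [Background.intermediateSections, Submodule.mem_inf, mem_tracelessSections_iff,
    LinearMap.mem_ker, mem_fields_iff]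
  have h' : (onState B.opH - 2 + 2 * (gmul bdag * gder bdag) :
      Module.End (Smooth U) (State U)) ψ = 0 ↔
      ∀ S, B.opH (ψ S) = bWeight S • ψ S := by
    rw [funext_iff]
    refine forall_congr' fun S => ?_
    rw [h, Pi.zero_apply, sub_eq_zero]
  have h'' : onState B.opSbd ψ = 0 ↔ ∀ S, B.opSbd (ψ S) = 0 := funext_iff
  rw [h', h'']
  simp only [forall_and]
  exact ⟨fun ⟨⟨⟨⟨⟨h1, h2, h3, h4⟩, h5⟩, h6⟩, h7⟩, h8⟩ => ⟨h1, h2, h3, h5, h6, h4, h7, h8⟩,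
    fun ⟨h1, h2, h3, h5, h6, h4, h7, h8⟩ => ⟨⟨⟨⟨⟨h1, h2, h3, h4⟩, h5⟩, h6⟩, h7⟩, h8⟩⟩

end Ghosts

/-! ### Nilpotency of the BRST operators. -/

section BRST

variable {d : ℕ} {U : TopologicalSpace.Opens (Fin d → ℝ)}

open Ghost

theorem gmul_mem_tracelessSections {g : Ghost d} (h0 : g ≠ c0) (h1 : g ≠ cdag) (h2 : g ≠ xi)
    {ψ : State U} (hψ : ψ ∈ tracelessSections U) : gmul g ψ ∈ tracelessSections U := by
  rw [mem_tracelessSections_iff] at hψ ⊢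
  obtain ⟨e0, e1, e2, h⟩ := hψ
  refine ⟨?_, ?_, ?_, fun S => ?_⟩
  · rw [gder_gmul h0.symm, e0, map_zero, neg_zero]
  · rw [gder_gmul h1.symm, e1, map_zero, neg_zero]
  · rw [gder_gmul h2.symm, e2, map_zero, neg_zero]
  · rw [gmul_apply]
    split_ifs
    · exact zsmul_mem (h _) _
    · exact zero_mem _

theorem gder_mem_tracelessSections (g : Ghost d) {ψ : State U} (hψ : ψ ∈ tracelessSections U) :
    gder g ψ ∈ tracelessSections U := by
  rw [mem_tracelessSections_iff] at hψ ⊢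
  obtain ⟨e0, e1, e2, h⟩ := hψ
  have key (g' : Ghost d) (e : gder g' ψ = 0) : gder g' (gder g ψ) = 0 := by
    by_cases h : g' = g
    · rw [h, gder_gder_self]
    · rw [gder_gder h, e, map_zero, neg_zero]
  refine ⟨key _ e0, key _ e1, key _ e2, fun S => ?_⟩
  rw [gder_apply]
  split_ifs
  · exact zero_mem _
  · exact zsmul_mem (h _) _

theorem mem_tracelessSections_of_component {ψ χ : State U} (hψ : ψ ∈ tracelessSections U)
    (h : ∀ S, ψ S = 0 → χ S = 0) (h' : ∀ S, χ S ∈ tracelessFiber U) :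
    χ ∈ tracelessSections U := by
  simp only [mem_tracelessSections_iff, gder_eq_zero_iff] at hψ ⊢
  exact ⟨fun S hS => h S (hψ.1 S hS), fun S hS => h S (hψ.2.1 S hS),
    fun S hS => h S (hψ.2.2.1 S hS), h'⟩

theorem diagOp_mem_tracelessSections {D : Finset (Ghost d) → Module.End (Smooth U) (Fiber U)}
    (hD : ∀ S, ∀ φ ∈ tracelessFiber U, D S φ ∈ tracelessFiber U) {ψ : State U}
    (hψ : ψ ∈ tracelessSections U) : diagOp D ψ ∈ tracelessSections U :=
  mem_tracelessSections_of_component hψ (fun S hS => by rw [diagOp_apply, hS, map_zero])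
    fun S => hD S _ (((mem_tracelessSections_iff ψ).1 hψ).2.2.2 S)

theorem onState_mem_tracelessSections {D : Module.End (Smooth U) (Fiber U)}
    (hD : ∀ φ ∈ tracelessFiber U, D φ ∈ tracelessFiber U) {ψ : State U}
    (hψ : ψ ∈ tracelessSections U) : onState D ψ ∈ tracelessSections U :=
  diagOp_mem_tracelessSections (fun _ => hD) hψ

theorem onState_opSd_opSbd {l : ℝ} (B : Background U l) (ψ : State U) :
    onState opSd (onState B.opSbd ψ) = onState B.opSbd (onState opSd ψ) + onState B.opH ψ := by
  funext S
  exact B.opSd_opSbd (ψ S)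

theorem onState_opH_opSd {l : ℝ} (B : Background U l) (ψ : State U) :
    onState B.opH (onState opSd ψ) = onState opSd (onState B.opH ψ) +
      (2 : ℤ) • onState opSd ψ := by
  funext S
  exact B.opH_opSd (ψ S)

theorem onState_opH_opSbd {l : ℝ} (B : Background U l) (ψ : State U) :
    onState B.opH (onState B.opSbd ψ) = onState B.opSbd (onState B.opH ψ) -
      (2 : ℤ) • onState B.opSbd ψ := by
  funext S
  exact B.opH_opSbd (ψ S)

namespace Background

variable {l : ℝ} (B : Background U l)

/-- The covariant derivative of a state. -/
def covState (i : Fin d) : State U →ₗ[ℝ] State U :=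
  derXState i + (onState (B.connection i)).restrictScalars ℝ

theorem covState_apply (i : Fin d) (ψ : State U) (S : Finset (Ghost d)) :
    B.covState i ψ S = B.covDer i (ψ S) := rfl

theorem nablaSigma_apply (ψ : State U) :
    B.nablaSigma ψ = ∑ i, gmul (theta i) (B.covState i ψ) := by
  rw [nablaSigma, LinearMap.sum_apply]
  rfl

theorem covState_gmul (i : Fin d) (g : Ghost d) (ψ : State U) :
    B.covState i (gmul g ψ) = gmul g (B.covState i ψ) := by
  funext S
  rw [covState_apply, gmul_apply, gmul_apply]
  split_ifs
  · rw [map_zsmul, covState_apply]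
  · exact map_zero _

theorem covState_gder (i : Fin d) (g : Ghost d) (ψ : State U) :
    B.covState i (gder g ψ) = gder g (B.covState i ψ) := by
  funext S
  rw [covState_apply, gder_apply, gder_apply]
  split_ifs
  · exact map_zero _
  · rw [map_zsmul, covState_apply]

theorem nablaSigma_gmul {g : Ghost d} (hg : ∀ i, theta i ≠ g) (ψ : State U) :
    B.nablaSigma (gmul g ψ) = - gmul g (B.nablaSigma ψ) := by
  simp only [nablaSigma_apply, covState_gmul, gmul_gmul (hg _), map_sum, Finset.sum_neg_distrib]

theorem nablaSigma_gder {g : Ghost d} (hg : ∀ i, theta i ≠ g) (ψ : State U) :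
    B.nablaSigma (gder g ψ) = - gder g (B.nablaSigma ψ) := by
  simp only [nablaSigma_apply, covState_gder, gder_gmul (hg _).symm, map_sum,
    Finset.sum_neg_distrib, neg_neg]

theorem nablaSigma_onState {D : Module.End (Smooth U) (Fiber U)}
    (hD : ∀ i φ, B.covDer i (D φ) = D (B.covDer i φ)) (ψ : State U) :
    B.nablaSigma (onState D ψ) = onState D (B.nablaSigma ψ) := by
  have h (i : Fin d) : B.covState i (onState D ψ) = onState D (B.covState i ψ) := by
    funext S
    exact hD i _
  simp only [nablaSigma_apply, h, map_sum, onState_gmul]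

theorem nablaSigma_nablaSigma (ψ : State U) : B.nablaSigma (B.nablaSigma ψ) = 0 := by
  set t : Fin d → Fin d → State U := fun i j =>
    gmul (theta i) (gmul (theta j) (B.covState i (B.covState j ψ))) with ht
  have hsum : B.nablaSigma (B.nablaSigma ψ) = ∑ i, ∑ j, t i j := by
    simp only [nablaSigma_apply, map_sum, covState_gmul, ht]
    exact Finset.sum_comm
  have hanti (i j : Fin d) : t i j = - t j i := by
    have hc : B.covState i (B.covState j ψ) = B.covState j (B.covState i ψ) := by
      funext S
      exact B.covDer_comm i j _
    by_cases h : i = j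
    · simp only [ht, h, gmul_gmul_self, neg_zero]
    · simp only [ht]
      rw [gmul_gmul (by simpa using h), hc]
  -- The double sum is antisymmetric because the θ anticommute and the covariant derivatives
  -- commute; being equal to its negative, it vanishes over ℝ.
  have h2 : (2 : ℝ) • B.nablaSigma (B.nablaSigma ψ) = 0 := by
    rw [two_smul, hsum]
    nth_rewrite 2 [Finset.sum_comm]
    rw [← Finset.sum_add_distrib]
    refine Finset.sum_eq_zero fun i _ => ?_
    rw [← Finset.sum_add_distrib]
    refine Finset.sum_eq_zero fun j _ => ?_
    rw [hanti i j, neg_add_cancel]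
  exact (smul_eq_zero.1 h2).resolve_left two_ne_zero

theorem covState_mem_supported {w : Ghost d → ℤ} {T : Set ℤ} (i : Fin d) {ψ : State U}
    (hψ : ψ ∈ supported U w T) : B.covState i ψ ∈ supported U w T := fun S hS => by
  rw [covState_apply, hψ S hS, map_zero]

theorem nablaSigma_mem_supported {w : Ghost d → ℤ} {T T' : Set ℤ}
    (h : ∀ t ∈ T, ∀ i, t + w (theta i) ∈ T') {ψ : State U} (hψ : ψ ∈ supported U w T) :
    B.nablaSigma ψ ∈ supported U w T' := by
  rw [nablaSigma_apply]
  exact sum_mem fun i _ =>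
    gmul_mem_supported (fun t ht => h t ht i) (B.covState_mem_supported i hψ)

theorem nablaSigma_mem_tracelessSections {ψ : State U} (hψ : ψ ∈ tracelessSections U) :
    B.nablaSigma ψ ∈ tracelessSections U := by
  rw [nablaSigma_apply]
  refine sum_mem fun i _ => gmul_mem_tracelessSections (by simp) (by simp) (by simp)
    (mem_tracelessSections_of_component hψ (fun S hS => by rw [covState_apply, hS, map_zero])
      fun S => ?_)
  exact B.covDer_mem_tracelessFiber i (((mem_tracelessSections_iff ψ).1 hψ).2.2.2 S)

theorem nablaSigma_smul (f : Smooth U) (ψ : State U) :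
    B.nablaSigma (f • ψ) = f • B.nablaSigma ψ + ∑ i, partialX i f • gmul (theta i) ψ := by
  have h (i : Fin d) : B.covState i (f • ψ) = f • B.covState i ψ + partialX i f • ψ := by
    funext S
    exact B.covDer_smul i f (ψ S)
  simp only [nablaSigma_apply, h, map_add, map_smul, Finset.sum_add_distrib, Finset.smul_sum]

/-! ### The BRST operators -/

/-- The operator `h - 2 + 2 b† ∂/∂b† + 2 ν ∂/∂ν`. -/
def numOp : Module.End (Smooth U) (State U) :=
  onState B.opH - 2 + 2 * (gmul bdag * gder bdag) + 2 * (gmul nu * gder nu)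

theorem numOp_apply (ψ : State U) : B.numOp ψ = onState B.opH ψ - (2 : ℤ) • ψ +
    (2 : ℤ) • gmul bdag (gder bdag ψ) + (2 : ℤ) • gmul nu (gder nu ψ) := by
  simp [numOp, two_smul, Module.End.ofNat_apply]

/-- The terms of the BRST operator that are inverted in the reduction. -/
def omegaZero : Module.End (Smooth U) (State U) :=
  gmul mu * B.numOp + gmul nu * onState B.opSbd

theorem omegaZero_apply (ψ : State U) :
    B.omegaZero ψ = gmul mu (B.numOp ψ) + gmul nu (onState B.opSbd ψ) := rfl

/-- The terms containing μ as a factor combine to μN, which separates the part to be inverted from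
the perturbation. -/
theorem omegaTilde_eq : B.omegaTilde =
    B.omegaZero + (onState opSd * gder bdag + gmul nu * gder bdag * gder mu) := by
  rw [omegaTilde, omegaZero, numOp]
  noncomm_ring

theorem omegaTildeT_apply (ψ : State U) : B.omegaTildeT ψ = B.omegaZero ψ +
    (B.nablaSigma ψ + onState opSd (gder bdag ψ) + gmul nu (gder bdag (gder mu ψ))) := by
  have h : B.omegaTildeT ψ = B.nablaSigma ψ + B.omegaTilde ψ := rfl
  rw [h, omegaTilde_eq]
  simp only [LinearMap.add_apply, Module.End.mul_apply]
  abel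

theorem omegaHatT_apply (ψ : State U) :
    B.omegaHatT ψ = B.nablaSigma ψ + onState opSd (gder bdag ψ) := rfl

theorem omegaHatT_omegaHatT (ψ : State U) : B.omegaHatT (B.omegaHatT ψ) = 0 := by
  simp only [omegaHatT_apply, map_add, nablaSigma_nablaSigma, nablaSigma_onState B B.covDer_opSd,
    nablaSigma_gder B (g := bdag) (by simp), onState_gder, gder_gder_self, map_zero]
  abel

/-- All products are brought to a fixed order of ghosts and operators with the sl(2) relations. The
ghost term ν∂_{b†}∂_μ compensates the contribution of [S†, S̄†] = h, and the terms quadratic in b†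
or ν compensate the weights ±2 of S† and S̄†. -/
theorem omegaTildeT_omegaTildeT (ψ : State U) : B.omegaTildeT (B.omegaTildeT ψ) = 0 := by
  have n1 := fun ψ => B.nablaSigma_gmul (g := mu) (by simp) ψ
  have n2 := fun ψ => B.nablaSigma_gmul (g := nu) (by simp) ψ
  have n3 := fun ψ => B.nablaSigma_gmul (g := bdag) (by simp) ψ
  have n4 := fun ψ => B.nablaSigma_gder (g := mu) (by simp) ψ
  have n5 := fun ψ => B.nablaSigma_gder (g := nu) (by simp) ψ
  have n6 := fun ψ => B.nablaSigma_gder (g := bdag) (by simp) ψ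
  have c1 := fun ψ : State U => gmul_gmul (g := nu) (g' := mu) (by simp) ψ
  have c2 := fun ψ : State U => gmul_gmul (g := bdag) (g' := mu) (by simp) ψ
  have c3 := fun ψ : State U => gmul_gmul (g := bdag) (g' := nu) (by simp) ψ
  have c4 := fun ψ : State U => gder_gder (g := nu) (g' := mu) (by simp) ψ
  have c5 := fun ψ : State U => gder_gder (g := bdag) (g' := mu) (by simp) ψ
  have c6 := fun ψ : State U => gder_gder (g := bdag) (g' := nu) (by simp) ψ
  have a1 := fun ψ : State U => gder_gmul (g := nu) (g' := mu) (by simp) ψ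
  have a2 := fun ψ : State U => gder_gmul (g := bdag) (g' := mu) (by simp) ψ
  have a3 := fun ψ : State U => gder_gmul (g := bdag) (g' := nu) (by simp) ψ
  have a4 := fun ψ : State U => gder_gmul (g := mu) (g' := nu) (by simp) ψ
  have a5 := fun ψ : State U => gder_gmul (g := mu) (g' := bdag) (by simp) ψ
  have a6 := fun ψ : State U => gder_gmul (g := nu) (g' := bdag) (by simp) ψ
  have s0 : ∀ (g : Ghost d) (ψ : State U), gmul g (gmul g ψ) = 0 := gmul_gmul_self
  simp only [omegaTildeT_apply, omegaZero_apply, numOp_apply, map_add, map_sub, map_neg, map_zsmul,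
    nablaSigma_nablaSigma, nablaSigma_onState B B.covDer_opSd, nablaSigma_onState B B.covDer_opH,
    nablaSigma_onState B B.covDer_opSbd, onState_gder, onState_gmul, onState_opSd_opSbd,
    onState_opH_opSd, onState_opH_opSbd, n1, n2, n3, n4, n5, n6, c1, c2, c3, c4, c5, c6, a1, a2,
    a3, a4, a5, a6, s0, gder_gder_self, gder_gmul_self, map_zero, neg_zero, smul_zero, neg_neg,
    smul_neg]
  abel

end Background

end BRST

/-! ### Differential operators -/

section DiffOp

variable {R : Type*} [CommRing R] [Algebra ℝ R]
variable {M N P : Type*} [AddCommGroup M] [Module ℝ M] [Module R M] [IsScalarTower ℝ R M]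
  [AddCommGroup N] [Module ℝ N] [Module R N] [IsScalarTower ℝ R N]
  [AddCommGroup P] [Module ℝ P] [Module R P] [IsScalarTower ℝ R P]

theorem commFn_apply (f : R) (D : M →ₗ[ℝ] N) (x : M) :
    commFn R f D x = D (f • x) - f • D x := rfl

theorem IsDiffOp.zero (k : ℕ) : IsDiffOp R k (0 : M →ₗ[ℝ] N) := by
  induction k with
  | zero =>
    intro f
    ext x
    simp [commFn_apply]
  | succ k ih =>
    intro f
    have : commFn R f (0 : M →ₗ[ℝ] N) = 0 := by
      ext x
      simp [commFn_apply]
    rwa [this]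

theorem IsDiffOp.succ {k : ℕ} {D : M →ₗ[ℝ] N} (h : IsDiffOp R k D) : IsDiffOp R (k + 1) D := by
  induction k generalizing D with
  | zero =>
    intro f
    rw [h f]
    exact IsDiffOp.zero 0
  | succ k ih => exact fun f => ih (h f)

theorem IsDiffOp.mono {k m : ℕ} (hkm : k ≤ m) {D : M →ₗ[ℝ] N} (h : IsDiffOp R k D) :
    IsDiffOp R m D := by
  induction hkm with
  | refl => exact h
  | step _ ih => exact ih.succ

theorem commFn_add (f : R) (D D' : M →ₗ[ℝ] N) :
    commFn R f (D + D') = commFn R f D + commFn R f D' := by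
  ext x
  simp only [commFn_apply, LinearMap.add_apply, smul_add]
  abel

theorem IsDiffOp.add {k : ℕ} {D D' : M →ₗ[ℝ] N} (h : IsDiffOp R k D) (h' : IsDiffOp R k D') :
    IsDiffOp R k (D + D') := by
  induction k generalizing D D' with
  | zero =>
    intro f
    rw [commFn_add, h f, h' f, add_zero]
  | succ k ih =>
    intro f
    rw [commFn_add]
    exact ih (h f) (h' f)

theorem IsDiffOp.of_linear (D : M →ₗ[ℝ] N) (h : ∀ (f : R) (x : M), D (f • x) = f • D x) (k : ℕ) :
    IsDiffOp R k D := by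
  refine IsDiffOp.mono (Nat.zero_le k) fun f => ?_
  ext x
  rw [commFn_apply, h, sub_self]
  rfl

theorem commFn_comp (f : R) (D : N →ₗ[ℝ] P) (D' : M →ₗ[ℝ] N) :
    commFn R f (D ∘ₗ D') = commFn R f D ∘ₗ D' + D ∘ₗ commFn R f D' := by
  ext x
  simp only [commFn_apply, LinearMap.add_apply, LinearMap.comp_apply, map_sub]
  abel

/-- Induction on the total order: a commutator with a function acts as a derivation on the composite
and lowers the order of one factor. -/
theorem IsDiffOp.comp {k m : ℕ} {D : N →ₗ[ℝ] P} {D' : M →ₗ[ℝ] N} (h : IsDiffOp R k D)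
    (h' : IsDiffOp R m D') : IsDiffOp R (k + m) (D ∘ₗ D') := by
  obtain ⟨n, hn⟩ : ∃ n, n = k + m := ⟨_, rfl⟩
  rw [← hn]
  induction n generalizing k m D D' with
  | zero =>
    obtain ⟨rfl, rfl⟩ : k = 0 ∧ m = 0 := by omega
    intro f
    rw [commFn_comp, h f, h' f, LinearMap.comp_zero, LinearMap.zero_comp, add_zero]
  | succ n ih =>
    intro f
    rw [commFn_comp]
    refine IsDiffOp.add ?_ ?_
    · cases k with
      | zero =>
        rw [h f, LinearMap.zero_comp]
        exact IsDiffOp.zero n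
      | succ k => exact ih (h f) h' (by omega)
    · cases m with
      | zero =>
        rw [h' f, LinearMap.comp_zero]
        exact IsDiffOp.zero n
      | succ m => exact ih h (h' f) (by omega)

/-- Used to test the order of operators with values in a submodule inside the ambient module. -/
theorem IsDiffOp.of_injective {k : ℕ} {D : M →ₗ[ℝ] N} (i : N →ₗ[ℝ] P)
    (hi : ∀ (f : R) (x : N), i (f • x) = f • i x) (hinj : Function.Injective i)
    (h : IsDiffOp R k (i ∘ₗ D)) : IsDiffOp R k D := by
  have hc (f : R) (D : M →ₗ[ℝ] N) : commFn R f (i ∘ₗ D) = i ∘ₗ commFn R f D := by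
    ext x
    simp [commFn_apply, hi]
  induction k generalizing D with
  | zero =>
    intro f
    have := h f
    rw [hc] at this
    ext x
    exact hinj ((LinearMap.congr_fun this x).trans (map_zero i).symm)
  | succ k ih =>
    intro f
    have := h f
    rw [hc] at this
    exact ih this

theorem IsDiffOp.exists_sum_pow {T : N →ₗ[ℝ] N} (hT : ∃ k, IsDiffOp R k T) {D : M →ₗ[ℝ] N}
    (hD : ∃ k, IsDiffOp R k D) (n : ℕ) :
    ∃ k, IsDiffOp R k (∑ i ∈ Finset.range n, (T ^ i : Module.End ℝ N) ∘ₗ D) := by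
  have hpow (i : ℕ) : ∃ k, IsDiffOp R k ((T ^ i : Module.End ℝ N) ∘ₗ D) := by
    induction i with
    | zero =>
      obtain ⟨k, hk⟩ := hD
      exact ⟨k, by rwa [pow_zero, Module.End.one_eq_id, LinearMap.id_comp]⟩
    | succ i ih =>
      obtain ⟨k, hk⟩ := hT
      obtain ⟨m, hm⟩ := ih
      exact ⟨k + m, by
        rw [pow_succ', Module.End.mul_eq_comp, LinearMap.comp_assoc]
        exact hk.comp hm⟩
  induction n with
  | zero => exact ⟨0, by simpa using IsDiffOp.zero 0⟩
  | succ n ih =>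
    obtain ⟨k, hk⟩ := ih
    obtain ⟨m, hm⟩ := hpow n
    refine ⟨max k m, ?_⟩
    rw [Finset.sum_range_succ]
    exact (hk.mono (le_max_left k m)).add (hm.mono (le_max_right k m))

end DiffOp

/-! ### Reduction by a contracting homotopy -/

section Homotopy

variable {R : Type*} [CommRing R] [Algebra ℝ R]
variable {N E : Type*} [AddCommGroup N] [Module ℝ N] [Module R N] [IsScalarTower ℝ R N]
  [AddCommGroup E] [Module ℝ E] [Module R E] [IsScalarTower ℝ R E]

/-- The image of a homogeneous operator is generated by the images of homogeneous elements. -/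
theorem eq_iSup_inf_of_graded {gr : ℤ → Submodule R N} (hgr : ⨆ n, gr n = ⊤)
    (T : Module.End R N) (s : ℤ) (hT : ∀ n, ∀ x ∈ gr n, T x ∈ gr (n + s)) :
    LinearMap.range T = ⨆ n, LinearMap.range T ⊓ gr n := by
  refine le_antisymm ?_ (iSup_le fun n => inf_le_left)
  have h : ⨆ n, gr n ≤ (⨆ n, LinearMap.range T ⊓ gr n).comap T :=
    iSup_le fun n x hx => Submodule.mem_iSup_of_mem (n + s) ⟨⟨x, rfl⟩, hT n x hx⟩
  rw [hgr] at h
  rintro _ ⟨x, rfl⟩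
  exact h trivial

/-- Here δ and k are mutually inverse isomorphisms between F = im k and G = im δ, and E is their
common kernel. Since T = 1 - kΩ is nilpotent on F, kΩ is invertible there, with inverse the finite
sum of the powers of T; this inverts the component of Ω from F to G. -/
theorem isConsistentReduction_of_homotopy {grN : ℤ → Submodule R N} {grE : ℤ → Submodule R E}
    {Ω : N →ₗ[ℝ] N} {Ω' : E →ₗ[ℝ] E} {ι : E →ₗ[R] N} (hι : Function.Injective ι)
    (hgr : ⨆ n, grN n = ⊤) (hgrE : ∀ n, grE n = (grN n).comap ι) (δ k : Module.End R N)
    (hrange : ∀ x, (∃ e, ι e = x) ↔ δ x = 0 ∧ k x = 0) (hδδ : ∀ x, δ (δ x) = 0)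
    (hkk : ∀ x, k (k x) = 0) (hδkδ : ∀ x, δ (k (δ x)) = δ x) (hkδk : ∀ x, k (δ (k x)) = k x)
    (hδgr : ∀ n, ∀ x ∈ grN n, δ x ∈ grN (n + 1)) (hkgr : ∀ n, ∀ x ∈ grN n, k x ∈ grN (n + -1))
    (hΩ : ∃ m, IsDiffOp R m Ω) (T : Module.End ℝ N) (hT : ∀ x, T x = x - k (Ω x)) (n : ℕ)
    (hnil : ∀ x, (T ^ n) (k x) = 0) (hE : ∀ e, Ω (ι e) = ι (Ω' e)) :
    IsConsistentReduction grN Ω grE Ω' ι := by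
  set F := LinearMap.range k with hF
  set G := LinearMap.range δ with hG
  have hker (e : E) : δ (ι e) = 0 ∧ k (ι e) = 0 := (hrange _).1 ⟨e, rfl⟩
  have kF (f : F) : k f = 0 := by
    obtain ⟨_, y, rfl⟩ := f
    exact hkk y
  have δG (g : G) : δ g = 0 := by
    obtain ⟨_, y, rfl⟩ := g
    exact hδδ y
  have kδF (f : F) : k (δ f) = f := by
    obtain ⟨_, y, rfl⟩ := f
    exact hkδk y
  have δkG (g : G) : δ (k g) = g := by
    obtain ⟨_, y, rfl⟩ := g
    exact hδkδ y
  let sumMap : (E × F × G) →ₗ[R] N :=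
    LinearMap.coprod ι (LinearMap.coprod F.subtype G.subtype)
  have sumMap_apply (x : E × F × G) : sumMap x = ι x.1 + (x.2.1 : N) + (x.2.2 : N) := by
    simp [sumMap, add_assoc]
  -- kδ and δk are the projections to F and G; the relations δδ = kk = 0 annihilate the other
  -- summands.
  have comp1 (x : E × F × G) : k (δ (sumMap x)) = x.2.1 := by
    rw [sumMap_apply, map_add δ, map_add δ, δG, (hker _).1, zero_add, add_zero, kδF]
  have comp2 (x : E × F × G) : δ (k (sumMap x)) = x.2.2 := by
    rw [sumMap_apply, map_add k, map_add k, (hker _).2, kF, zero_add, zero_add, δkG]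
  have hbij : Function.Bijective sumMap := by
    constructor
    · rw [injective_iff_map_eq_zero]
      intro x hx
      have h1 := comp1 x
      have h2 := comp2 x
      rw [hx, map_zero, map_zero] at h1 h2
      have h0 := sumMap_apply x
      rw [hx, ← h1, ← h2, add_zero, add_zero] at h0
      have h3 : x.1 = 0 := hι (h0.symm.trans (map_zero ι).symm)
      exact Prod.ext h3 (Prod.ext (Subtype.ext h1.symm) (Subtype.ext h2.symm))
    · intro x
      -- What remains after subtracting the F and G components is annihilated by δ and k.
      obtain ⟨e, he⟩ := (hrange (x - k (δ x) - δ (k x))).2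
        ⟨by rw [map_sub, map_sub, hδkδ, hδδ]; simp, by rw [map_sub, map_sub, hkk, hkδk]; simp⟩
      refine ⟨(e, ⟨k (δ x), _, rfl⟩, ⟨δ (k x), _, rfl⟩), ?_⟩
      rw [sumMap_apply, he]
      abel
  let dec : N ≃ₗ[R] E × F × G := (LinearEquiv.ofBijective sumMap hbij).symm
  have hsymm (x : E × F × G) : dec.symm x = ι x.1 + (x.2.1 : N) + (x.2.2 : N) := sumMap_apply x
  have dec2 (x : N) : ((dec x).2.2 : N) = δ (k x) := by
    rw [← comp2]
    exact congrArg (fun y => δ (k y)) (dec.symm_apply_apply x)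
  have decι (e : E) : dec (ι e) = (e, 0, 0) := by
    rw [← dec.eq_symm_apply, hsymm]
    simp
  have hTF (i : ℕ) (x : N) : ∃ y, (T ^ i) (k x) = k y := by
    induction i with
    | zero => exact ⟨x, rfl⟩
    | succ i ih =>
      obtain ⟨y, hy⟩ := ih
      refine ⟨y - Ω (k y), ?_⟩
      rw [pow_succ', Module.End.mul_apply, hy, hT, map_sub]
  -- The Neumann series for (kΩ)⁻¹k, finite because T^n annihilates im k.
  let K0 : N →ₗ[ℝ] N := ∑ i ∈ Finset.range n, (T ^ i : Module.End ℝ N) ∘ₗ k.restrictScalars ℝ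
  have hK0 (x : N) : K0 x = ∑ i ∈ Finset.range n, (T ^ i) (k x) := by
    simp [K0]
  have hK0F (x : N) : K0 x ∈ F := by
    rw [hK0]
    refine sum_mem fun i _ => ?_
    obtain ⟨y, hy⟩ := hTF i x
    exact ⟨y, hy.symm⟩
  let K : G →ₗ[ℝ] F :=
    { toFun := fun g => ⟨K0 g, hK0F g⟩
      map_add' := fun g g' => Subtype.ext (map_add K0 (g : N) g')
      map_smul' := fun c g => Subtype.ext (map_smul K0 c (g : N)) }
  have hK (g : G) : (K g : N) = K0 g := rfl
  have geom (x : N) : K0 x - T (K0 x) = k x := by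
    have h := Finset.sum_range_sub' (fun i => (T ^ i) (k x)) n
    rw [hnil, sub_zero, pow_zero, Module.End.one_apply] at h
    rw [← h, hK0, map_sum, ← Finset.sum_sub_distrib]
    simp only [pow_succ', Module.End.mul_apply]
  have kΩK (x : N) : k (Ω (K0 x)) = k x := by
    rw [← geom x, hT]
    abel
  refine ⟨F, G, dec, K, hsymm, hgrE, eq_iSup_inf_of_graded hgr k (-1) hkgr,
    eq_iSup_inf_of_graded hgr δ 1 hδgr, ?_, fun f => ?_, fun g => ?_, fun e => ?_⟩
  · have hk : ∃ m, IsDiffOp R m (k.restrictScalars ℝ : N →ₗ[ℝ] N) :=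
      ⟨0, IsDiffOp.of_linear _ (fun f x => map_smul k f x) 0⟩
    have hTd : ∃ m, IsDiffOp R m (T : N →ₗ[ℝ] N) := by
      obtain ⟨m, hm⟩ := hΩ
      refine ⟨0 + m, ?_⟩
      have : T = LinearMap.id + (-k).restrictScalars ℝ ∘ₗ Ω := by
        ext x
        simp [hT, sub_eq_add_neg]
      rw [this]
      exact (IsDiffOp.of_linear _ (fun _ _ => rfl) _).add
        (IsDiffOp.comp (IsDiffOp.of_linear _ (fun f x => map_smul (-k) f x) 0) hm)
    obtain ⟨m, hm⟩ := IsDiffOp.exists_sum_pow hTd hk n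
    refine ⟨m + 0, IsDiffOp.of_injective (F.subtype.restrictScalars ℝ) (fun _ _ => rfl)
      Subtype.val_injective ?_⟩
    exact IsDiffOp.comp hm (D' := G.subtype.restrictScalars ℝ)
      (IsDiffOp.of_linear _ (fun _ _ => rfl) 0)
  · refine Subtype.ext ?_
    obtain ⟨_, y, rfl⟩ := f
    rw [hK, dec2, hK0]
    have h := Finset.sum_range_sub' (fun i => (T ^ i) (k y)) n
    rw [hnil, sub_zero, pow_zero, Module.End.one_apply] at h
    refine Eq.trans (Finset.sum_congr rfl fun i _ => ?_) h
    -- On F one has kδkΩ = kΩ = 1 - T, so the sum telescopes.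
    rw [pow_succ, Module.End.mul_apply, ← map_sub, hT, sub_sub_cancel, hkδk]
  · refine Subtype.ext ?_
    rw [dec2, hK, kΩK, δkG]
  -- Ω maps the image of E to itself, so its G component there is zero and the correction term drops
  -- out.
  · rw [hE, decι, map_zero, ZeroMemClass.coe_zero, map_zero, map_zero, Prod.fst_zero, sub_zero]

end Homotopy

/-! ### The contracting homotopy of two anticommuting differentials -/

section Koszul

/-- Data for the homotopy of the differential `a N + B`, where `a, a'` are a Grassmann odd variable
and its derivative, `J` is a right inverse of `N`, and `Λ` is a right inverse of `B` on the kernel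
of `N` in the range of the projection `q`. -/
structure HomotopyData (R M : Type*) [CommRing R] [AddCommGroup M] [Module R M] where
  (a a' N B J Λ q P : Module.End R M)
  a_a : ∀ x, a (a x) = 0
  a'_a' : ∀ x, a' (a' x) = 0
  a_a' : ∀ x, a (a' x) = x - a' (a x)
  N_a : ∀ x, N (a x) = a (N x)
  N_a' : ∀ x, N (a' x) = a' (N x)
  J_a : ∀ x, J (a x) = a (J x)
  J_a' : ∀ x, J (a' x) = a' (J x)
  B_a : ∀ x, B (a x) = - a (B x)
  B_a' : ∀ x, B (a' x) = - a' (B x)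
  Λ_a : ∀ x, Λ (a x) = - a (Λ x)
  Λ_a' : ∀ x, Λ (a' x) = - a' (Λ x)
  q_a : ∀ x, q (a x) = a (q x)
  q_a' : ∀ x, q (a' x) = a' (q x)
  J_N : ∀ x, J (N x) = x - P x
  N_J : ∀ x, N (J x) = x
  N_B : ∀ x, N (B x) = B (N x)
  B_B : ∀ x, B (B x) = 0
  B_J_B : ∀ x, B (J (B x)) = 0
  N_Λ_P : ∀ x, N (Λ (P x)) = 0
  B_Λ_P : ∀ x, B (Λ (P x)) = q (P x)
  q_P : ∀ x, q (P x) = P (q x)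
  q_B : ∀ x, q (B x) = B x
  Λ_P_Λ : ∀ x, Λ (P (Λ x)) = 0
  Λ_q : ∀ x, Λ (q x) = Λ x

namespace HomotopyData

variable {R M : Type*} [CommRing R] [AddCommGroup M] [Module R M] (H : HomotopyData R M)

theorem P_eq (x : M) : H.P x = x - H.J (H.N x) := by rw [J_N, sub_sub_cancel]

theorem P_a (x : M) : H.P (H.a x) = H.a (H.P x) := by rw [P_eq, P_eq, N_a, J_a, map_sub]

theorem P_a' (x : M) : H.P (H.a' x) = H.a' (H.P x) := by rw [P_eq, P_eq, N_a', J_a', map_sub]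

theorem P_J (x : M) : H.P (H.J x) = 0 := by rw [P_eq, N_J, sub_self]

theorem N_P (x : M) : H.N (H.P x) = 0 := by rw [P_eq, map_sub, N_J, sub_self]

theorem P_B_J (x : M) : H.P (H.B (H.J x)) = H.B (H.J x) - H.J (H.B x) := by
  rw [P_eq, N_B, N_J]

theorem Λ_P_q (x : M) : H.Λ (H.P (H.q x)) = H.Λ (H.P x) := by rw [← q_P, Λ_q]

/-- The differential. -/
def diff : Module.End R M := H.a * H.N + H.B

/-- The homotopy. -/
def hom : Module.End R M :=
  H.a' * H.J + H.a' * H.a * H.Λ * H.P - H.a' * H.Λ * H.P * H.B * H.J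

theorem diff_apply (x : M) : H.diff x = H.a (H.N x) + H.B x := rfl

theorem hom_apply (x : M) : H.hom x =
    H.a' (H.J x) + H.a' (H.a (H.Λ (H.P x))) - H.a' (H.Λ (H.P (H.B (H.J x)))) := rfl

theorem diff_diff (x : M) : H.diff (H.diff x) = 0 := by
  simp only [diff_apply, map_add, N_a, N_B, B_a, B_B, a_a, add_zero]
  abel

theorem hom_hom (x : M) : H.hom (H.hom x) = 0 := by
  simp only [hom_apply, map_add, map_sub, map_neg, map_zero, P_a, P_a', Λ_a, Λ_a', J_a, J_a', B_a,
    B_a', a'_a', a_a', a_a, P_J, Λ_P_Λ, sub_zero, zero_sub, neg_neg, add_zero, zero_add, neg_zero]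

/-- The homotopy is built in two stages. The map a'J contracts aN onto the a-independent elements of
ker N, where Λ contracts B onto the part without q-range. The last term of `hom` is the first order
perturbation of the projection by B; higher orders vanish because a' squares to zero. -/
theorem diff_hom_add (x : M) : H.diff (H.hom x) + H.hom (H.diff x) =
    x - H.a' (H.a (H.P x - H.P (H.q x) - H.Λ (H.P (H.B (H.P x))))) := by
  simp only [diff_apply, hom_apply, map_add, map_sub, map_neg, map_zero, N_a, N_a', P_a, P_a', Λ_a,
    Λ_a', J_a, J_a', B_a, B_a', a'_a', a_a', a_a, q_a, q_a', J_N, N_J, N_B, B_B, B_J_B, N_Λ_P,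
    B_Λ_P, q_P, q_B, Λ_P_Λ, sub_zero, zero_sub, neg_neg, add_zero, zero_add, neg_zero]
  simp only [P_B_J, map_sub]
  abel

/-- The correction in `diff_hom_add` vanishes on the image of `diff`: a'a annihilates its a-part,
and qB = B, BB = 0, BJB = 0 dispose of its B-part. -/
theorem diff_hom_diff (x : M) : H.diff (H.hom (H.diff x)) = H.diff x := by
  have h := H.diff_hom_add (H.diff x)
  rw [diff_diff, map_zero, add_zero] at h
  rw [h]
  simp only [diff_apply, map_add, map_sub, P_a, q_a, q_B, B_a, map_neg, Λ_a, a_a, map_zero]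
  simp only [P_eq, map_sub, map_zero, N_B, B_B, B_J_B]
  simp

theorem hom_diff_hom (x : M) : H.hom (H.diff (H.hom x)) = H.hom x := by
  have h := congrArg H.hom (H.diff_hom_add x)
  rw [map_add, hom_hom, add_zero] at h
  rw [h, map_sub, sub_eq_self]
  simp only [hom_apply, map_add, map_sub, map_neg, map_zero, P_a, P_a', Λ_a, Λ_a', J_a, J_a', B_a,
    B_a', a'_a', a_a', a_a, P_J, Λ_P_Λ, sub_zero, zero_sub, neg_neg, add_zero, zero_add, neg_zero]
  have hPP (y : M) : H.P (H.P y) = H.P y := by rw [P_eq, N_P, map_zero, sub_zero]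
  simp only [hPP, Λ_P_q, Λ_P_Λ]
  simp

theorem diff_hom_eq_zero_iff (x : M) : H.diff x = 0 ∧ H.hom x = 0 ↔
    H.a' x = 0 ∧ H.q x = 0 ∧ H.N x = 0 ∧ H.B x = 0 := by
  constructor
  · rintro ⟨h1, h2⟩
    have h := H.diff_hom_add x
    rw [h1, h2, map_zero, map_zero, add_zero] at h
    -- With both left-hand terms zero, `diff_hom_add` writes x as an element of the image of a'.
    have ha : H.a' x = 0 := by
      rw [sub_eq_zero.1 h.symm, a'_a']
    have hN : H.N x = 0 := by
      have h3 := congrArg H.a' h1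
      rwa [diff_apply, map_add, map_zero, ← neg_eq_iff_eq_neg.2 (H.B_a' x), ha, map_zero, neg_zero,
        add_zero, ← sub_eq_iff_eq_add'.2 (eq_add_of_sub_eq (H.a_a' (H.N x)).symm), ← N_a', ha,
        map_zero, map_zero, sub_zero] at h3
    have hB : H.B x = 0 := by rwa [diff_apply, hN, map_zero, zero_add] at h1
    have hP : H.P x = x := by rw [P_eq, hN, map_zero, sub_zero]
    refine ⟨ha, ?_, hN, hB⟩
    rw [hP, hB, map_zero, map_zero, sub_zero, ← q_P, hP, map_sub, map_sub] at h
    have haa (y : M) : H.a' (H.a y) = y - H.a (H.a' y) := by rw [a_a', sub_sub_cancel]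
    rw [haa, haa, ha, ← q_a', ha, map_zero, map_zero, sub_zero, map_zero, sub_zero, sub_sub_cancel] at h
    exact h.symm
  · rintro ⟨ha, hq, hN, hB⟩
    have hP : H.P x = x := by rw [P_eq, hN, map_zero, sub_zero]
    refine ⟨by rw [diff_apply, hN, hB, map_zero, add_zero], ?_⟩
    have h3 : H.a' (H.Λ (H.P (H.B (H.J x)))) = H.Λ (H.P (H.B (H.J (H.a' x)))) := by
      simp only [J_a', B_a', P_a', Λ_a', map_neg, neg_neg]
    rw [hom_apply, ← J_a', h3, ha, hP, ← Λ_q, hq]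
    simp

end HomotopyData

end Koszul

/-! ### The homotopy for μN + νS̄† on traceless sections. -/

section ConcreteHomotopy

variable {d : ℕ} {U : TopologicalSpace.Opens (Fin d → ℝ)}

open Ghost

/-- The eigenvalue of `2 - 2 b† ∂/∂b† - 2 ν ∂/∂ν` on the monomial labelled by `S`. -/
def nWeight (S : Finset (Ghost d)) : ℤ := bWeight S - if nu ∈ S then 2 else 0

theorem nWeight_insert_mu (S : Finset (Ghost d)) : nWeight (insert mu S) = nWeight S := by
  simp [nWeight, bWeight]

theorem nWeight_insert_nu {S : Finset (Ghost d)} (h : nu ∉ S) :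
    nWeight (insert nu S) = nWeight S - 2 := by
  simp [nWeight, bWeight, h]

/-- A family of operators indexed by weights, acting on the components of a state. -/
def weightOp (J : ℤ → Module.End (Smooth U) (Fiber U)) : Module.End (Smooth U) (State U) :=
  diagOp fun S => J (nWeight S)

theorem weightOp_apply (J : ℤ → Module.End (Smooth U) (Fiber U)) (ψ : State U)
    (S : Finset (Ghost d)) : weightOp J ψ S = J (nWeight S) (ψ S) := rfl

theorem weightOp_gmul_mu (J : ℤ → Module.End (Smooth U) (Fiber U)) (ψ : State U) :
    weightOp J (gmul mu ψ) = gmul mu (weightOp J ψ) :=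
  diagOp_gmul (fun S _ => by rw [nWeight_insert_mu]) ψ

theorem weightOp_gder_mu (J : ℤ → Module.End (Smooth U) (Fiber U)) (ψ : State U) :
    weightOp J (gder mu ψ) = gder mu (weightOp J ψ) :=
  diagOp_gder (fun S _ => by rw [nWeight_insert_mu]) ψ

namespace Background

variable {l : ℝ} (B : Background U l)

theorem numOp_eq_weightOp :
    B.numOp = weightOp fun m => B.opH - (m : Module.End (Smooth U) (Fiber U)) := by
  refine LinearMap.ext fun ψ => funext fun S => ?_
  rw [numOp_apply, weightOp_apply, LinearMap.sub_apply, Module.End.intCast_apply, Pi.add_apply,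
    Pi.add_apply, Pi.sub_apply, Pi.smul_apply, Pi.smul_apply, Pi.smul_apply, gmul_gder_self_apply,
    gmul_gder_self_apply, onState_apply, nWeight, bWeight]
  split_ifs <;> simp

theorem numOp_component (ψ : State U) (S : Finset (Ghost d)) :
    B.numOp ψ S = B.opH (ψ S) - nWeight S • ψ S := by
  rw [numOp_eq_weightOp, weightOp_apply, LinearMap.sub_apply, Module.End.intCast_apply]

theorem mem_weightFiber_iff (m : ℤ) (φ : Fiber U) :
    φ ∈ B.weightFiber m ↔ φ ∈ tracelessFiber U ∧ B.opH φ = m • φ := by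
  rw [weightFiber, Submodule.mem_inf, LinearMap.mem_ker, LinearMap.sub_apply, sub_eq_zero,
    Module.End.intCast_apply]

/-- In the kernel of N, a component containing ν has h-eigenvalue two less than the corresponding
one without ν. This is the shift by which S̄† lowers h. -/
theorem gder_nu_mem_weightFiber {ψ : State U} (hψ : ψ ∈ tracelessSections U)
    (h : B.numOp ψ = 0) (S : Finset (Ghost d)) : gder nu ψ S ∈ B.weightFiber (nWeight S - 2) := by
  by_cases hS : nu ∈ S
  · rw [gder_apply_mem hS]
    exact zero_mem _
  · rw [gder_apply_notMem hS]
    refine zsmul_mem ?_ _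
    rw [mem_weightFiber_iff, ← nWeight_insert_nu hS]
    refine ⟨((mem_tracelessSections_iff ψ).1 hψ).2.2.2 _, ?_⟩
    have := congrFun h (insert nu S)
    rwa [numOp_component, Pi.zero_apply, sub_eq_zero] at this

/-- S̄† lowers h by 2, and the added ν raises 2ν∂_ν by 2. -/
theorem numOp_gmul_nu (ψ : State U) :
    B.numOp (gmul nu (onState B.opSbd ψ)) = gmul nu (onState B.opSbd (B.numOp ψ)) := by
  have c1 := fun ψ : State U => gmul_gmul (g := bdag) (g' := nu) (by simp) ψ
  have c2 := fun ψ : State U => gder_gmul (g := bdag) (g' := nu) (by simp) ψ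
  simp only [numOp_apply, onState_gmul, onState_gder, onState_opH_opSbd, gder_gmul_self,
    gmul_gmul_self, c1, c2, map_add, map_sub, map_neg, map_zsmul, neg_neg, smul_zero, sub_zero]
  abel

theorem numOp_mem_tracelessSections {ψ : State U} (hψ : ψ ∈ tracelessSections U) :
    B.numOp ψ ∈ tracelessSections U := by
  rw [numOp_eq_weightOp]
  refine diagOp_mem_tracelessSections (fun S φ hφ => ?_) hψ
  rw [LinearMap.sub_apply, Module.End.intCast_apply]
  exact sub_mem (B.opH_mem_tracelessFiber hφ) (zsmul_mem hφ _)

/-- The right inverses of `h - m` and `S̄†`. -/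
structure RightInverses where
  (J L : ℤ → Module.End (Smooth U) (Fiber U))
  J_mem : ∀ m, ∀ φ ∈ tracelessFiber U, J m φ ∈ tracelessFiber U
  H_J : ∀ m : ℤ, ∀ φ ∈ tracelessFiber U, (B.opH - (m : Module.End (Smooth U) (Fiber U))) (J m φ) = φ
  L_mem : ∀ m, ∀ φ ∈ tracelessFiber U, L m φ ∈ tracelessFiber U
  L_mem_weight : ∀ m, ∀ φ ∈ B.weightFiber (m - 2), L m φ ∈ B.weightFiber m
  Sbd_L : ∀ m, ∀ φ ∈ B.weightFiber (m - 2), B.opSbd (L m φ) = φ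

theorem nonempty_rightInverses (hd : 3 ≤ d) (hl : 0 < l) : Nonempty B.RightInverses := by
  obtain ⟨J, L, h⟩ := B.exists_rightInverses hd hl
  exact ⟨⟨J, L, fun m φ hφ => ((h m).1 φ hφ).1, fun m φ hφ => ((h m).1 φ hφ).2, fun m => (h m).2.1,
    fun m φ hφ => ((h m).2.2 φ hφ).1, fun m φ hφ => ((h m).2.2 φ hφ).2⟩⟩

namespace RightInverses

variable {B}
variable (K : B.RightInverses)

/-- The projection to the kernel of the operator `numOp`. -/
def proj : Module.End (Smooth U) (State U) := 1 - weightOp K.J * B.numOp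

theorem proj_apply (ψ : State U) : K.proj ψ = ψ - weightOp K.J (B.numOp ψ) := rfl

/-- The right inverse of `ν S̄†`. -/
def lift : Module.End (Smooth U) (State U) := weightOp K.L * gder nu

theorem lift_apply (ψ : State U) : K.lift ψ = weightOp K.L (gder nu ψ) := rfl

theorem weightOp_J_mem {ψ : State U} (hψ : ψ ∈ tracelessSections U) :
    weightOp K.J ψ ∈ tracelessSections U :=
  diagOp_mem_tracelessSections (fun S => K.J_mem (nWeight S)) hψ

theorem lift_mem {ψ : State U} (hψ : ψ ∈ tracelessSections U) :
    K.lift ψ ∈ tracelessSections U :=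
  diagOp_mem_tracelessSections (fun S => K.L_mem (nWeight S)) (gder_mem_tracelessSections nu hψ)

theorem proj_mem {ψ : State U} (hψ : ψ ∈ tracelessSections U) :
    K.proj ψ ∈ tracelessSections U :=
  sub_mem hψ (K.weightOp_J_mem (B.numOp_mem_tracelessSections hψ))

theorem numOp_J {ψ : State U} (hψ : ψ ∈ tracelessSections U) :
    B.numOp (weightOp K.J ψ) = ψ := by
  funext S
  rw [numOp_eq_weightOp]
  exact K.H_J _ _ (((mem_tracelessSections_iff ψ).1 hψ).2.2.2 S)

theorem numOp_proj {ψ : State U} (hψ : ψ ∈ tracelessSections U) : B.numOp (K.proj ψ) = 0 := by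
  rw [proj_apply, map_sub, K.numOp_J (B.numOp_mem_tracelessSections hψ), sub_self]

theorem numOp_lift {ψ : State U} (hψ : ψ ∈ tracelessSections U) (h : B.numOp ψ = 0) :
    B.numOp (K.lift ψ) = 0 := by
  funext S
  rw [numOp_component, sub_eq_zero.2]
  · rfl
  · exact ((B.mem_weightFiber_iff _ _).1
      (K.L_mem_weight _ _ (B.gder_nu_mem_weightFiber hψ h S))).2

theorem opSbd_lift {ψ : State U} (hψ : ψ ∈ tracelessSections U) (h : B.numOp ψ = 0) :
    onState B.opSbd (K.lift ψ) = gder nu ψ :=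
  funext fun S => K.Sbd_L _ _ (B.gder_nu_mem_weightFiber hψ h S)

/-- The image of `lift` is independent of ν, the projection acts component by component, and the
second `lift` differentiates by ν. -/
theorem lift_proj_lift (ψ : State U) : K.lift (K.proj (K.lift ψ)) = 0 := by
  have h1 : gder nu (K.lift ψ) = 0 := gder_diagOp_gder _ nu ψ
  have h2 : gder nu (weightOp K.J (B.numOp (K.lift ψ))) = 0 := by
    rw [numOp_eq_weightOp]
    exact gder_diagOp_gder (fun S => K.J (nWeight S) *
      ((B.opH - (nWeight S : Module.End (Smooth U) (Fiber U))) * K.L (nWeight S))) nu ψ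
  rw [lift_apply, proj_apply, map_sub, h1, h2, sub_zero, map_zero]

theorem gmul_gder_proj (ψ : State U) :
    gmul nu (gder nu (K.proj ψ)) = K.proj (gmul nu (gder nu ψ)) := by
  funext S
  rw [gmul_gder_self_apply, proj_apply, proj_apply, Pi.sub_apply, Pi.sub_apply, weightOp_apply,
    weightOp_apply, numOp_component, numOp_component, gmul_gder_self_apply]
  split_ifs <;> simp

/-- The homotopy for the operator `omegaZero` on the traceless sections. -/
def homotopyData : HomotopyData (Smooth U) (tracelessSections U) where
  a := (gmul mu).restrict fun _ h => gmul_mem_tracelessSections (by simp) (by simp) (by simp) h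
  a' := (gder mu).restrict fun _ h => gder_mem_tracelessSections mu h
  N := B.numOp.restrict fun _ h => B.numOp_mem_tracelessSections h
  B := (gmul nu * onState B.opSbd).restrict fun _ h =>
    gmul_mem_tracelessSections (by simp) (by simp) (by simp)
      (onState_mem_tracelessSections (fun _ => B.opSbd_mem_tracelessFiber) h)
  J := (weightOp K.J).restrict fun _ h => K.weightOp_J_mem h
  Λ := K.lift.restrict fun _ h => K.lift_mem h
  q := (gmul nu * gder nu).restrict fun _ h =>
    gmul_mem_tracelessSections (by simp) (by simp) (by simp) (gder_mem_tracelessSections nu h)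
  P := K.proj.restrict fun _ h => K.proj_mem h
  a_a x := Subtype.ext (gmul_gmul_self mu _)
  a'_a' x := Subtype.ext (gder_gder_self mu _)
  a_a' x := Subtype.ext (eq_sub_of_add_eq' (eq_sub_iff_add_eq.1 (gder_gmul_self mu _)))
  N_a x := Subtype.ext (by
    simp only [LinearMap.restrict_apply, numOp_eq_weightOp]
    exact weightOp_gmul_mu _ _)
  N_a' x := Subtype.ext (by
    simp only [LinearMap.restrict_apply, numOp_eq_weightOp]
    exact weightOp_gder_mu _ _)
  J_a x := Subtype.ext (weightOp_gmul_mu _ _)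
  J_a' x := Subtype.ext (weightOp_gder_mu _ _)
  B_a x := Subtype.ext ((congrArg (gmul nu) (onState_gmul _ mu _)).trans
    (gmul_gmul (by simp) _))
  B_a' x := Subtype.ext ((congrArg (gmul nu) (onState_gder _ mu _)).trans
    (neg_eq_iff_eq_neg.1 (gder_gmul (by simp) _).symm))
  Λ_a x := Subtype.ext ((congrArg (weightOp K.L) (gder_gmul (by simp) _)).trans
    ((map_neg _ _).trans (congrArg Neg.neg (weightOp_gmul_mu _ _))))
  Λ_a' x := Subtype.ext ((congrArg (weightOp K.L) (gder_gder (by simp) _)).trans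
    ((map_neg _ _).trans (congrArg Neg.neg (weightOp_gder_mu _ _))))
  q_a x := Subtype.ext (by
    simp only [LinearMap.restrict_apply, Module.End.mul_apply]
    rw [gder_gmul (by simp), map_neg, gmul_gmul (by simp), neg_neg])
  q_a' x := Subtype.ext (by
    simp only [LinearMap.restrict_apply, Module.End.mul_apply]
    rw [gder_gder (by simp), map_neg, gder_gmul (by simp)])
  J_N x := Subtype.ext (sub_sub_cancel _ _).symm
  N_J x := Subtype.ext (K.numOp_J x.2)
  N_B x := Subtype.ext (by
    simp only [LinearMap.restrict_apply, Module.End.mul_apply]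
    exact B.numOp_gmul_nu _)
  B_B x := Subtype.ext (by
    simp only [LinearMap.restrict_apply, Module.End.mul_apply]
    rw [onState_gmul, gmul_gmul_self]
    rfl)
  B_J_B x := Subtype.ext (by
    simp only [LinearMap.restrict_apply, Module.End.mul_apply]
    rw [← onState_gmul, weightOp, gmul_diagOp_gmul, map_zero]
    rfl)
  N_Λ_P x := Subtype.ext (K.numOp_lift (K.proj_mem x.2) (K.numOp_proj x.2))
  B_Λ_P x := Subtype.ext (congrArg (gmul nu) (K.opSbd_lift (K.proj_mem x.2) (K.numOp_proj x.2)))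
  q_P x := Subtype.ext (K.gmul_gder_proj _)
  q_B x := Subtype.ext (by
    simp only [LinearMap.restrict_apply, Module.End.mul_apply]
    rw [gder_gmul_self, map_sub, gmul_gmul_self, sub_zero])
  Λ_P_Λ x := Subtype.ext (K.lift_proj_lift _)
  Λ_q x := Subtype.ext (by
    simp only [LinearMap.restrict_apply, Module.End.mul_apply, lift_apply]
    rw [gder_gmul_self, gder_gder_self, map_zero, sub_zero])

end RightInverses

end Background

end ConcreteHomotopy

/-! ### Both operators define BRST systems. -/

section Systems

variable {d : ℕ} {U : TopologicalSpace.Opens (Fin d → ℝ)}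

open Ghost

/-- There are finitely many ghosts, so a section is the finite sum of its Grassmann components, each
of definite ghost number. -/
theorem iSup_ghostGr_eq_top (M : Submodule (Smooth U) (State U))
    (hM : ∀ ψ ∈ M, ∀ S, (Pi.single S (ψ S) : State U) ∈ M) :
    ⨆ n, (ghostGr U n).comap M.subtype = ⊤ := by
  have hfin : Finite (Ghost d) := by
    refine Finite.of_injective (β := Fin (6 + d)) (fun g => ⟨g.rank, ?_⟩) fun g g' h =>
      Ghost.rank_injective (congrArg Fin.val h)
    cases g <;> simp [rank] <;> omega
  have := Fintype.ofFinite (Ghost d)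
  rw [eq_top_iff]
  rintro ψ -
  have hsum : ψ = ∑ S, (⟨Pi.single S (ψ.1 S), hM ψ.1 ψ.2 S⟩ : M) := by
    refine Subtype.ext ?_
    rw [AddSubmonoidClass.coe_finsetSum]
    exact (Finset.univ_sum_single ψ.1).symm
  rw [hsum]
  refine sum_mem fun S _ => Submodule.mem_iSup_of_mem (∑ g ∈ S, g.gh) ?_
  intro S' hS'
  have : S' ≠ S := fun h => hS' (by rw [h])
  exact Pi.single_eq_of_ne this _

theorem single_mem_tracelessSections {ψ : State U} (hψ : ψ ∈ tracelessSections U)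
    (S : Finset (Ghost d)) : (Pi.single S (ψ S) : State U) ∈ tracelessSections U := by
  refine mem_tracelessSections_of_component hψ (fun S' h => ?_) fun S' => ?_
  · by_cases h' : S' = S
    · subst h'
      rw [Pi.single_eq_same, h]
    · exact Pi.single_eq_of_ne h' _
  · by_cases h' : S' = S
    · subst h'
      rw [Pi.single_eq_same]
      exact ((mem_tracelessSections_iff ψ).1 hψ).2.2.2 _
    · rw [Pi.single_eq_of_ne h']
      exact zero_mem _

namespace Background

variable {l : ℝ} (B : Background U l)

theorem single_mem_intermediateSections {ψ : State U} (hψ : ψ ∈ B.intermediateSections)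
    (S : Finset (Ghost d)) : (Pi.single S (ψ S) : State U) ∈ B.intermediateSections := by
  have key : ∀ S', (Pi.single S (ψ S) : State U) S' = if S' = S then ψ S' else 0 := by
    intro S'
    by_cases h' : S' = S
    · subst h'
      simp
    · rw [Pi.single_eq_of_ne h', if_neg h']
  simp only [mem_intermediateSections_iff, gder_eq_zero_iff, key] at hψ ⊢
  obtain ⟨h1, h2, h3, h4, h5, h6⟩ := hψ
  refine ⟨fun S' h => ?_, fun S' h => ?_, fun S' h => ?_, fun S' h => ?_, fun S' h => ?_,
    fun S' => ?_⟩
  · rw [h1 S' h, ite_self]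
  · rw [h2 S' h, ite_self]
  · rw [h3 S' h, ite_self]
  · rw [h4 S' h, ite_self]
  · rw [h5 S' h, ite_self]
  · split_ifs
    · exact h6 S'
    · exact zero_mem _

/-- The part of the BRST operator that raises the number of `θ` minus the number of `b†`. -/
def omegaPlus : State U →ₗ[ℝ] State U :=
  B.nablaSigma + (onState opSd * gder bdag + gmul nu * gder bdag * gder mu).restrictScalars ℝ

theorem omegaPlus_apply (ψ : State U) : B.omegaPlus ψ =
    B.nablaSigma ψ + onState opSd (gder bdag ψ) + gmul nu (gder bdag (gder mu ψ)) :=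
  (add_assoc _ _ _).symm

theorem omegaTildeT_eq (ψ : State U) : B.omegaTildeT ψ = B.omegaZero ψ + B.omegaPlus ψ := by
  rw [omegaTildeT_apply, omegaPlus_apply]

theorem omegaPlus_mem_tracelessSections {ψ : State U} (hψ : ψ ∈ tracelessSections U) :
    B.omegaPlus ψ ∈ tracelessSections U := by
  rw [omegaPlus_apply]
  exact add_mem (add_mem (B.nablaSigma_mem_tracelessSections hψ)
    (onState_mem_tracelessSections (fun _ => opSd_mem_tracelessFiber)
      (gder_mem_tracelessSections _ hψ)))
    (gmul_mem_tracelessSections (by simp) (by simp) (by simp)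
      (gder_mem_tracelessSections _ (gder_mem_tracelessSections _ hψ)))

theorem omegaZero_mem_tracelessSections {ψ : State U} (hψ : ψ ∈ tracelessSections U) :
    B.omegaZero ψ ∈ tracelessSections U := by
  rw [omegaZero_apply]
  exact add_mem (gmul_mem_tracelessSections (by simp) (by simp) (by simp)
      (B.numOp_mem_tracelessSections hψ))
    (gmul_mem_tracelessSections (by simp) (by simp) (by simp)
      (onState_mem_tracelessSections (fun _ => B.opSbd_mem_tracelessFiber) hψ))

theorem omegaTildeT_mem_tracelessSections (ψ : State U) (hψ : ψ ∈ tracelessSections U) :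
    B.omegaTildeT ψ ∈ tracelessSections U := by
  rw [omegaTildeT_eq]
  exact add_mem (B.omegaZero_mem_tracelessSections hψ) (B.omegaPlus_mem_tracelessSections hψ)

theorem numOp_mem_supported {w : Ghost d → ℤ} {T : Set ℤ} {ψ : State U}
    (hψ : ψ ∈ supported U w T) : B.numOp ψ ∈ supported U w T := by
  rw [numOp_eq_weightOp]
  exact diagOp_mem_supported _ hψ

theorem omegaZero_mem_supported {w : Ghost d → ℤ} {T T' : Set ℤ}
    (h1 : ∀ t ∈ T, t + w mu ∈ T') (h2 : ∀ t ∈ T, t + w nu ∈ T') {ψ : State U}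
    (hψ : ψ ∈ supported U w T) : B.omegaZero ψ ∈ supported U w T' :=
  add_mem (gmul_mem_supported h1 (B.numOp_mem_supported hψ))
    (gmul_mem_supported h2 (onState_mem_supported _ hψ))

theorem omegaPlus_mem_supported {w : Ghost d → ℤ} {T T' : Set ℤ}
    (h1 : ∀ t ∈ T, ∀ i, t + w (theta i) ∈ T') (h2 : ∀ t ∈ T, t - w bdag ∈ T')
    (h3 : ∀ t ∈ T, t - w mu - w bdag + w nu ∈ T') {ψ : State U}
    (hψ : ψ ∈ supported U w T) : B.omegaPlus ψ ∈ supported U w T' := by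
  rw [omegaPlus_apply]
  refine add_mem (add_mem (B.nablaSigma_mem_supported h1 hψ)
    (onState_mem_supported _ (gder_mem_supported h2 hψ))) ?_
  refine gmul_mem_supported (T := {t | t + w nu ∈ T'}) (fun t ht => ht)
    (gder_mem_supported (T := {t | t - w bdag + w nu ∈ T'}) (fun t ht => ht)
      (gder_mem_supported (fun t ht => h3 t ht) hψ))

theorem omegaTildeT_mem_ghostGr (n : ℤ) {ψ : State U} (hψ : ψ ∈ ghostGr U n) :
    B.omegaTildeT ψ ∈ ghostGr U (n + 1) := by
  rw [ghostGr_eq_supported] at hψ ⊢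
  rw [omegaTildeT_eq]
  refine add_mem (B.omegaZero_mem_supported ?_ ?_ hψ) (B.omegaPlus_mem_supported ?_ ?_ ?_ hψ) <;>
    simp [gh]

theorem omegaHatT_mem_ghostGr (n : ℤ) {ψ : State U} (hψ : ψ ∈ ghostGr U n) :
    B.omegaHatT ψ ∈ ghostGr U (n + 1) := by
  rw [ghostGr_eq_supported] at hψ ⊢
  rw [omegaHatT_apply]
  refine add_mem (B.nablaSigma_mem_supported ?_ hψ)
    (onState_mem_supported _ (gder_mem_supported ?_ hψ)) <;> simp [gh]

/-- The commutator of ∇ + σ with a function f is multiplication by θ^μ∂_μ f, which is linear over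
functions. -/
theorem isDiffOp_nablaSigma_add (D : Module.End (Smooth U) (State U)) :
    IsDiffOp (Smooth U) 1 (B.nablaSigma + D.restrictScalars ℝ) := by
  refine IsDiffOp.add (fun f => ?_) (IsDiffOp.of_linear _ (fun f ψ => map_smul D f ψ) 1)
  refine IsDiffOp.of_linear _ (fun g ψ => ?_) 0
  have h (ψ : State U) : commFn (Smooth U) f B.nablaSigma ψ =
      ∑ i, partialX i f • gmul (theta i) ψ := by
    rw [commFn_apply, nablaSigma_smul, add_sub_cancel_left]
  simp only [h, map_smul, Finset.smul_sum, smul_comm g]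

theorem isDiffOp_restrictOp {M : Submodule (Smooth U) (State U)} {Ω : State U →ₗ[ℝ] State U}
    (h : ∀ φ ∈ M, Ω φ ∈ M) {k : ℕ} (hΩ : IsDiffOp (Smooth U) k Ω) :
    IsDiffOp (Smooth U) k (restrictOp M Ω h) := by
  refine IsDiffOp.of_injective (M.subtype.restrictScalars ℝ) (fun _ _ => rfl)
    Subtype.val_injective ?_
  exact IsDiffOp.comp hΩ (D' := M.subtype.restrictScalars ℝ)
      (IsDiffOp.of_linear _ (fun _ _ => rfl) 0)

theorem isBRSTSystem_tracelessSections
    (hT : ∀ φ ∈ tracelessSections U, B.omegaTildeT φ ∈ tracelessSections U) :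
    IsBRSTSystem (fun n => (ghostGr U n).comap (tracelessSections U).subtype)
      (restrictOp (tracelessSections U) B.omegaTildeT hT) where
  graded := iSup_ghostGr_eq_top _ fun _ h => single_mem_tracelessSections h
  diffOp := ⟨1, isDiffOp_restrictOp hT (B.isDiffOp_nablaSigma_add B.omegaTilde)⟩
  ghost n _ hφ := B.omegaTildeT_mem_ghostGr n hφ
  nilpotent φ := Subtype.ext (B.omegaTildeT_omegaTildeT φ.1)

/-- S† raises h by 2 while ∂_{b†} lowers 2b†∂_{b†} by 2, so the number condition persists. For S̄†,
the commutator with S† is h, which vanishes on ∂_{b†}ψ. -/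
theorem omegaHatT_mem_intermediateSections (ψ : State U) (hψ : ψ ∈ B.intermediateSections) :
    B.omegaHatT ψ ∈ B.intermediateSections := by
  simp only [intermediateSections, Submodule.mem_inf, LinearMap.mem_ker] at hψ ⊢
  obtain ⟨⟨⟨⟨h1, h2⟩, h3⟩, h4⟩, h5⟩ := hψ
  have expand (ψ : State U) : (onState B.opH - 2 + 2 * (gmul bdag * gder bdag) :
      Module.End (Smooth U) (State U)) ψ =
      onState B.opH ψ - (2 : ℤ) • ψ + (2 : ℤ) • gmul bdag (gder bdag ψ) := by
    simp [two_smul, Module.End.ofNat_apply]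
  rw [expand] at h4 ⊢
  have n3 := fun ψ => B.nablaSigma_gmul (g := bdag) (by simp) ψ
  have n6 := fun ψ => B.nablaSigma_gder (g := bdag) (by simp) ψ
  -- Differentiating the number condition by b† cancels the constant -2.
  have hH : onState B.opH (gder bdag ψ) = 0 := by
    have := congrArg (gder bdag) h4
    simp only [map_add, map_sub, map_zsmul, gder_gmul_self, gder_gder_self, map_zero, sub_zero]
      at this
    rw [onState_gder, ← this]
    abel
  have hgder (g : Ghost d) (hg : ∀ i, theta i ≠ g) (h : gder g ψ = 0) :
      gder g (B.omegaHatT ψ) = 0 := by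
    have e1 : gder g (B.nablaSigma ψ) = 0 := by
      rw [← neg_eq_iff_eq_neg.2 (B.nablaSigma_gder hg ψ), h, map_zero, neg_zero]
    rw [omegaHatT_apply, map_add, e1, zero_add, ← onState_gder]
    by_cases hb : g = bdag
    · rw [hb, gder_gder_self, map_zero]
    · rw [gder_gder hb, h, map_zero, neg_zero, map_zero]
  refine ⟨⟨⟨⟨?_, hgder mu (by simp) h2⟩, hgder nu (by simp) h3⟩, ?_⟩, ?_⟩
  · exact add_mem (B.nablaSigma_mem_tracelessSections h1)
      (onState_mem_tracelessSections (fun _ => opSd_mem_tracelessFiber)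
        (gder_mem_tracelessSections _ h1))
  · have e1 := congrArg B.nablaSigma h4
    have e2 := congrArg (onState opSd) hH
    simp only [map_add, map_sub, map_zsmul, nablaSigma_onState B B.covDer_opH, n3, n6, map_neg,
      neg_neg, map_zero, onState_gder] at e1 e2
    simp only [omegaHatT_apply, map_add, onState_opH_opSd, onState_gder, gder_gder_self,
      map_zsmul, add_zero, e2, zero_add]
    rw [← e1]
    abel
  · have e1 := congrArg B.nablaSigma h5
    rw [nablaSigma_onState B B.covDer_opSbd, map_zero] at e1
    have e2 := onState_opSd_opSbd B (gder bdag ψ)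
    rw [hH, onState_gder, h5, map_zero, map_zero, add_zero] at e2
    rw [omegaHatT_apply, map_add, e1, ← e2, add_zero]

theorem isBRSTSystem_intermediateSections
    (hI : ∀ φ ∈ B.intermediateSections, B.omegaHatT φ ∈ B.intermediateSections) :
    IsBRSTSystem (fun n => (ghostGr U n).comap B.intermediateSections.subtype)
      (restrictOp B.intermediateSections B.omegaHatT hI) where
  graded := iSup_ghostGr_eq_top _ fun _ h => B.single_mem_intermediateSections h
  diffOp := ⟨1, isDiffOp_restrictOp hI (B.isDiffOp_nablaSigma_add _)⟩
  ghost n _ hφ := B.omegaHatT_mem_ghostGr n hφ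
  nilpotent φ := Subtype.ext (B.omegaHatT_omegaHatT φ.1)

end Background

end Systems

/-! ### Nilpotency of the perturbation and the reduction. -/

section IntermediateReduction

variable {d : ℕ} {U : TopologicalSpace.Opens (Fin d → ℝ)}

open Ghost

/-- The number of `θ` minus the number of `b†`. -/
def thetaWeight : Ghost d → ℤ
  | theta _ => 1
  | bdag => -1
  | _ => 0

theorem neg_one_le_sum_thetaWeight (S : Finset (Ghost d)) : -1 ≤ ∑ g ∈ S, thetaWeight g := by
  have h : ∑ g ∈ S, (if g = bdag then (-1 : ℤ) else 0) ≤ ∑ g ∈ S, thetaWeight g := by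
    refine Finset.sum_le_sum fun g _ => ?_
    cases g <;> simp [thetaWeight]
  refine le_trans ?_ h
  rw [Finset.sum_ite_eq']
  split_ifs <;> simp

theorem sum_thetaWeight_le (S : Finset (Ghost d)) : ∑ g ∈ S, thetaWeight g ≤ d := by
  have h : ∑ g ∈ S, thetaWeight g ≤
      ∑ g ∈ S, (if g ∈ Finset.univ.image theta then (1 : ℤ) else 0) := by
    refine Finset.sum_le_sum fun g _ => ?_
    cases g <;> simp [thetaWeight]
  refine h.trans ?_
  rw [← Finset.sum_filter, Finset.sum_const, nsmul_eq_mul, mul_one]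
  have h1 : (S.filter fun g => g ∈ Finset.univ.image theta).card ≤
      (Finset.univ.image (theta (d := d))).card :=
    Finset.card_le_card fun g hg => (Finset.mem_filter.1 hg).2
  have h2 : (Finset.univ.image (theta (d := d))).card ≤ d :=
    Finset.card_image_le.trans (by simp)
  exact_mod_cast h1.trans h2

namespace Background

variable {l : ℝ} (B : Background U l)

theorem mem_intermediateSections_iff_of_traceless {ψ : State U} (hψ : ψ ∈ tracelessSections U) :
    ψ ∈ B.intermediateSections ↔
      gder mu ψ = 0 ∧ gder nu ψ = 0 ∧ B.numOp ψ = 0 ∧ onState B.opSbd ψ = 0 := by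
  have h : B.numOp ψ = (onState B.opH - 2 + 2 * (gmul bdag * gder bdag) :
      Module.End (Smooth U) (State U)) ψ + (2 : ℤ) • gmul nu (gder nu ψ) := by
    simp [numOp, two_smul]
  simp only [intermediateSections, Submodule.mem_inf, LinearMap.mem_ker]
  constructor
  · rintro ⟨⟨⟨⟨-, h2⟩, h3⟩, h4⟩, h5⟩
    exact ⟨h2, h3, by rw [h, h4, h3, map_zero, smul_zero, add_zero], h5⟩
  · rintro ⟨h2, h3, h4, h5⟩
    rw [h, h3, map_zero, smul_zero, add_zero] at h4
    exact ⟨⟨⟨⟨hψ, h2⟩, h3⟩, h4⟩, h5⟩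

theorem omegaTildeT_eq_omegaHatT {ψ : State U} (hψ : ψ ∈ B.intermediateSections) :
    B.omegaTildeT ψ = B.omegaHatT ψ := by
  obtain ⟨h1, -, h2, h3⟩ :=
    (B.mem_intermediateSections_iff_of_traceless (B.intermediate_le hψ)).1 hψ
  rw [omegaTildeT_apply, omegaHatT_apply, omegaZero_apply, h1, h2, h3]
  simp

namespace RightInverses

variable {B}
variable (K : B.RightInverses)

theorem coe_diff (x : tracelessSections U) :
    (K.homotopyData.diff x : State U) = B.omegaZero x := rfl

theorem coe_hom (x : tracelessSections U) : (K.homotopyData.hom x : State U) =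
    gder mu (weightOp K.J x) + gder mu (gmul mu (K.lift (K.proj x))) -
      gder mu (K.lift (K.proj (gmul nu (onState B.opSbd (weightOp K.J x))))) := rfl

/-- Each term of the homotopy removes on balance one μ or ν. Taking c = 1 gives its ghost number -1,
and c = 0 shows that it preserves the number of θ minus that of b†. -/
theorem hom_mem_supported {w : Ghost d → ℤ} {T T' : Set ℤ} {c : ℤ} (hmu : w mu = c)
    (hnu : w nu = c) (hT : ∀ t ∈ T, t - c ∈ T') {x : tracelessSections U}
    (hx : (x : State U) ∈ supported U w T) :
    (K.homotopyData.hom x : State U) ∈ supported U w T' := by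
  have hmu' : ∀ {ψ : State U}, ψ ∈ supported U w T → gder mu ψ ∈ supported U w T' :=
    fun h => gder_mem_supported (by rwa [hmu]) h
  have hJ : ∀ {V : Set ℤ} {ψ : State U}, ψ ∈ supported U w V →
      weightOp K.J ψ ∈ supported U w V := fun h => diagOp_mem_supported _ h
  have hP : ∀ {V : Set ℤ} {ψ : State U}, ψ ∈ supported U w V → K.proj ψ ∈ supported U w V :=
    fun h => sub_mem h (hJ (B.numOp_mem_supported h))
  have hL : ∀ {ψ : State U} {V : Set ℤ}, ψ ∈ supported U w V →
      K.lift ψ ∈ supported U w {t | t + c ∈ V} := fun h =>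
    diagOp_mem_supported _ (gder_mem_supported (by simp [hnu]) h)
  rw [coe_hom]
  refine sub_mem (add_mem (hmu' (hJ hx)) (hmu' ?_)) (hmu' ?_)
  · exact gmul_mem_supported (by simp [hmu]) (hL (hP hx))
  · have h1 : gmul nu (onState B.opSbd (weightOp K.J (x : State U))) ∈
        supported U w {t | t - c ∈ T} :=
      gmul_mem_supported (by simp [hnu]) (onState_mem_supported _ (hJ hx))
    have h2 := hL (hP h1)
    simpa using h2

/-- Since kδk = k, the operator T acts on im k as -kΩ₊, where Ω₊ is `omegaPlus`. The homotopy
preserves `thetaWeight` and Ω₊ raises it by one, so i steps from the minimum -1 reach at least i -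
1. -/
theorem exists_pow_hom (T : Module.End ℝ (tracelessSections U))
    (hT : ∀ x, T x = x - K.homotopyData.hom
      (restrictOp _ B.omegaTildeT B.omegaTildeT_mem_tracelessSections x))
    (x : tracelessSections U) (i : ℕ) : ∃ y, (T ^ i) (K.homotopyData.hom x) = K.homotopyData.hom y ∧
      (K.homotopyData.hom y : State U) ∈ supported U thetaWeight (Set.Ici (i - 1)) := by
  induction i with
  | zero =>
    refine ⟨x, rfl, fun S hS => ?_⟩
    refine absurd (Set.mem_Ici.2 ?_) hS
    have := neg_one_le_sum_thetaWeight S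
    push_cast
    linarith
  | succ i ih =>
    obtain ⟨y, hy, hs⟩ := ih
    set z := K.homotopyData.hom y with hz
    have hΩ : restrictOp _ B.omegaTildeT B.omegaTildeT_mem_tracelessSections z =
        K.homotopyData.diff z + ⟨B.omegaPlus z, B.omegaPlus_mem_tracelessSections z.2⟩ :=
      Subtype.ext (B.omegaTildeT_eq z)
    refine ⟨-⟨B.omegaPlus z, B.omegaPlus_mem_tracelessSections z.2⟩, ?_, ?_⟩
    · rw [pow_succ', Module.End.mul_apply, hy, hT, hΩ, map_add, hz, HomotopyData.hom_diff_hom,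
        map_neg]
      abel
    · refine K.hom_mem_supported (c := 0) rfl rfl (T := Set.Ici (i : ℤ)) (by simp) (neg_mem ?_)
      refine B.omegaPlus_mem_supported ?_ ?_ ?_ hs <;> intro t ht <;>
        simp only [Set.mem_Ici, thetaWeight] at ht ⊢
      · intro _
        linarith
      · linarith
      · linarith

theorem coe_a' (x : tracelessSections U) : (K.homotopyData.a' x : State U) = gder mu x := rfl

theorem coe_q (x : tracelessSections U) :
    (K.homotopyData.q x : State U) = gmul nu (gder nu x) := rfl

theorem coe_N (x : tracelessSections U) : (K.homotopyData.N x : State U) = B.numOp x := rfl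

theorem coe_B (x : tracelessSections U) :
    (K.homotopyData.B x : State U) = gmul nu (onState B.opSbd x) := rfl

theorem gmul_gder_eq_zero_iff (g : Ghost d) (ψ : State U) :
    gmul g (gder g ψ) = 0 ↔ gder g ψ = 0 := by
  refine ⟨fun h => ?_, fun h => by rw [h, map_zero]⟩
  have := gder_gmul_self g (gder g ψ)
  rwa [h, gder_gder_self, map_zero, map_zero, sub_zero, eq_comm] at this

theorem gmul_eq_zero_iff {g : Ghost d} {ψ : State U} (hψ : gder g ψ = 0) :
    gmul g ψ = 0 ↔ ψ = 0 := by
  refine ⟨fun h => ?_, fun h => by rw [h, map_zero]⟩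
  have := gder_gmul_self g ψ
  rwa [h, hψ, map_zero, map_zero, sub_zero, eq_comm] at this

theorem exists_inclusion_eq_iff (x : tracelessSections U) :
    (∃ e, Submodule.inclusion B.intermediate_le e = x) ↔
      (x : State U) ∈ B.intermediateSections := by
  constructor
  · rintro ⟨e, rfl⟩
    rw [Submodule.coe_inclusion]
    exact e.2
  · exact fun h => ⟨⟨x, h⟩, Subtype.ext (Submodule.coe_inclusion _ _)⟩

/-- Once x is independent of ν, the factor ν can be cancelled from νS̄†x = 0. -/
theorem homotopy_kernel_iff (x : tracelessSections U) :
    (K.homotopyData.a' x = 0 ∧ K.homotopyData.q x = 0 ∧ K.homotopyData.N x = 0 ∧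
      K.homotopyData.B x = 0) ↔ (x : State U) ∈ B.intermediateSections := by
  rw [B.mem_intermediateSections_iff_of_traceless x.2, ← gmul_gder_eq_zero_iff nu, ← coe_a' K,
    ← coe_q K, ← coe_N K]
  have h (y : tracelessSections U) : y = 0 ↔ (y : State U) = 0 := Subtype.ext_iff
  rw [h, h, h, h]
  refine and_congr_right fun _ => and_congr_right fun h => and_congr_right fun _ => ?_
  rw [coe_B, gmul_eq_zero_iff]
  rw [coe_q, gmul_gder_eq_zero_iff] at h
  rw [← onState_gder, h, map_zero]

theorem exists_inclusion_iff (x : tracelessSections U) :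
    (∃ e, Submodule.inclusion B.intermediate_le e = x) ↔
      K.homotopyData.diff x = 0 ∧ K.homotopyData.hom x = 0 := by
  rw [exists_inclusion_eq_iff, HomotopyData.diff_hom_eq_zero_iff, homotopy_kernel_iff]

theorem diff_mem_ghostGr (n : ℤ) (x : tracelessSections U) (hx : (x : State U) ∈ ghostGr U n) :
    (K.homotopyData.diff x : State U) ∈ ghostGr U (n + 1) := by
  rw [coe_diff]
  exact B.omegaZero_mem_supported (T := {n}) (T' := {n + 1}) (by simp [gh]) (by simp [gh]) hx

theorem hom_mem_ghostGr (n : ℤ) (x : tracelessSections U) (hx : (x : State U) ∈ ghostGr U n) :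
    (K.homotopyData.hom x : State U) ∈ ghostGr U (n + -1) :=
  K.hom_mem_supported (w := gh) (c := 1) rfl rfl (T := {n}) (T' := {n + -1})
    (by simp [sub_eq_add_neg]) hx

/-- After d + 2 steps the `thetaWeight` would be at least d + 1, but only d ghosts θ exist. -/
theorem pow_hom_eq_zero (T : Module.End ℝ (tracelessSections U))
    (hT : ∀ x, T x = x - K.homotopyData.hom
      (restrictOp _ B.omegaTildeT B.omegaTildeT_mem_tracelessSections x))
    (x : tracelessSections U) : (T ^ (d + 2)) (K.homotopyData.hom x) = 0 := by
  obtain ⟨y, hy, hs⟩ := K.exists_pow_hom T hT x (d + 2)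
  rw [hy]
  refine Subtype.ext (funext fun S => hs S fun h => ?_)
  have := sum_thetaWeight_le S
  rw [Set.mem_Ici] at h
  push_cast at h
  linarith

theorem ghostGr_comap_inclusion (n : ℤ) :
    (ghostGr U n).comap B.intermediateSections.subtype =
      ((ghostGr U n).comap (tracelessSections U).subtype).comap
        (Submodule.inclusion B.intermediate_le) := by
  rw [← Submodule.comap_comp, Submodule.subtype_comp_inclusion]

/-- The operator whose powers give the inverse of the component of the BRST operator. -/
def perturbation (K : B.RightInverses) : Module.End ℝ (tracelessSections U) :=
  LinearMap.id - K.homotopyData.hom.restrictScalars ℝ ∘ₗ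
    restrictOp _ B.omegaTildeT B.omegaTildeT_mem_tracelessSections

theorem perturbation_apply (x : tracelessSections U) :
    K.perturbation x = x - K.homotopyData.hom
      (restrictOp _ B.omegaTildeT B.omegaTildeT_mem_tracelessSections x) := by
  rw [perturbation, LinearMap.sub_apply, LinearMap.comp_apply, LinearMap.id_apply,
    LinearMap.restrictScalars_apply]

theorem coe_restrictOp {M : Submodule (Smooth U) (State U)} {Ω : State U →ₗ[ℝ] State U}
    (h : ∀ φ ∈ M, Ω φ ∈ M) (x : M) : (restrictOp M Ω h x : State U) = Ω x := rfl

theorem restrictOp_inclusion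
    (hI : ∀ φ ∈ B.intermediateSections, B.omegaHatT φ ∈ B.intermediateSections)
    (e : B.intermediateSections) :
    restrictOp _ B.omegaTildeT B.omegaTildeT_mem_tracelessSections
      (Submodule.inclusion B.intermediate_le e) =
      Submodule.inclusion B.intermediate_le (restrictOp _ B.omegaHatT hI e) := by
  refine Subtype.ext ?_
  rw [Submodule.coe_inclusion, coe_restrictOp, coe_restrictOp, Submodule.coe_inclusion]
  exact B.omegaTildeT_eq_omegaHatT e.2

theorem isConsistentReduction (K : B.RightInverses)
    (hI : ∀ φ ∈ B.intermediateSections, B.omegaHatT φ ∈ B.intermediateSections) :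
    IsConsistentReduction
      (fun n => (ghostGr U n).comap (tracelessSections U).subtype)
      (restrictOp (tracelessSections U) B.omegaTildeT B.omegaTildeT_mem_tracelessSections)
      (fun n => (ghostGr U n).comap B.intermediateSections.subtype)
      (restrictOp B.intermediateSections B.omegaHatT hI)
      (Submodule.inclusion B.intermediate_le) := by
  have h := B.isBRSTSystem_tracelessSections B.omegaTildeT_mem_tracelessSections
  refine isConsistentReduction_of_homotopy (Submodule.inclusion_injective _)
    h.graded ghostGr_comap_inclusion K.homotopyData.diff
    K.homotopyData.hom K.exists_inclusion_iff K.homotopyData.diff_diff K.homotopyData.hom_hom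
    K.homotopyData.diff_hom_diff K.homotopyData.hom_diff_hom ?_ ?_
    h.diffOp K.perturbation K.perturbation_apply (d + 2)
    (K.pow_hom_eq_zero _ K.perturbation_apply) (restrictOp_inclusion hI)
  · intro n x hx
    rw [Submodule.mem_comap, Submodule.subtype_apply] at hx ⊢
    exact K.diff_mem_ghostGr n x hx
  · intro n x hx
    rw [Submodule.mem_comap, Submodule.subtype_apply] at hx ⊢
    exact K.hom_mem_ghostGr n x hx

end RightInverses

end Background

end IntermediateReduction

/-! ### Fields, equations of motion and gauge transformations. -/

section PhysicalFields

variable {d : ℕ} {U : TopologicalSpace.Opens (Fin d → ℝ)}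

open Ghost

theorem gmul_single {g : Ghost d} {S : Finset (Ghost d)} (h : g ∉ S) (φ : Fiber U) :
    gmul g (Pi.single S φ) = Pi.single (insert g S) (ghostSign g S • φ) := by
  funext S'
  by_cases h' : S' = insert g S
  · subst h'
    rw [gmul_apply_mem (Finset.mem_insert_self g S), Finset.erase_insert h, Pi.single_eq_same,
      Pi.single_eq_same, ghostSign_insert g h, orderSign_self, one_mul]
  · rw [Pi.single_eq_of_ne h']
    by_cases hg : g ∈ S'
    · have : S'.erase g ≠ S := fun e => h' (by rw [← e, Finset.insert_erase hg])
      rw [gmul_apply_mem hg, Pi.single_eq_of_ne this, smul_zero]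
    · exact gmul_apply_notMem hg _

theorem gder_single {g : Ghost d} {S : Finset (Ghost d)} (h : g ∉ S) (φ : Fiber U) :
    gder g (Pi.single S φ : State U) = 0 := by
  rw [gder_eq_zero_iff]
  intro S' hS'
  have : S' ≠ S := fun e => h (e ▸ hS')
  exact Pi.single_eq_of_ne this _

theorem single_mem_ghostGr (S : Finset (Ghost d)) (φ : Fiber U) :
    (Pi.single S φ : State U) ∈ ghostGr U (∑ g ∈ S, g.gh) := fun S' hS' =>
  Pi.single_eq_of_ne (fun e => hS' (by rw [e])) _

theorem oneForm_eq (A : Fin d → Fiber U) :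
    oneForm A = ∑ i, (Pi.single {theta i} (A i) : State U) := by
  refine Finset.sum_congr rfl fun i _ => ?_
  rw [zeroForm, gmul_single (Finset.notMem_empty _)]
  simp [ghostSign]

theorem gmul_bdag_oneForm (A : Fin d → Fiber U) :
    gmul bdag (oneForm A) = ∑ i, (Pi.single {bdag, theta i} (A i) : State U) := by
  rw [oneForm_eq, map_sum]
  refine Finset.sum_congr rfl fun i _ => ?_
  have : ghostSign bdag {theta i} = 1 := by
    rw [ghostSign, Finset.filter_singleton, if_neg (by simp [rank]; omega), Finset.card_empty, pow_zero]
  rw [gmul_single (by simp), this, one_smul]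

theorem gmul_bdag_zeroForm (φ : Fiber U) :
    gmul bdag (zeroForm φ) = (Pi.single {bdag} φ : State U) := by
  rw [zeroForm, gmul_single (Finset.notMem_empty _)]
  simp [ghostSign]

theorem gder_bdag_zeroForm (φ : Fiber U) : gder bdag (zeroForm φ) = 0 :=
  gder_single (Finset.notMem_empty _) φ

theorem gder_bdag_oneForm (A : Fin d → Fiber U) : gder bdag (oneForm A) = 0 := by
  rw [oneForm_eq, map_sum]
  exact Finset.sum_eq_zero fun i _ => gder_single (by simp) _

theorem gder_bdag_gmul_bdag {ψ : State U} (h : gder bdag ψ = 0) :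
    gder bdag (gmul bdag ψ) = ψ := by
  rw [gder_gmul_self, h, map_zero, sub_zero]

theorem onState_zeroForm (D : Module.End (Smooth U) (Fiber U)) (φ : Fiber U) :
    onState D (zeroForm φ) = zeroForm (D φ) := by
  funext S
  rw [onState_apply, zeroForm, zeroForm]
  exact Pi.apply_single (fun _ => D) (fun _ => map_zero D) ∅ φ S

/-- The ghost content of a monomial without `c₀, c†, ξ, μ, ν`. -/
theorem sum_gh_of_physical {S : Finset (Ghost d)} (h0 : c0 ∉ S) (h1 : cdag ∉ S) (h2 : xi ∉ S)
    (h3 : mu ∉ S) (h4 : nu ∉ S) : (∀ g ∈ S.erase bdag, ∃ i, g = theta i) ∧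
      ∑ g ∈ S, g.gh = (S.erase bdag).card - if bdag ∈ S then 1 else 0 := by
  have ht : ∀ g ∈ S.erase bdag, ∃ i, g = theta i := by
    intro g hg
    rw [Finset.mem_erase] at hg
    cases g <;> simp_all
  refine ⟨ht, ?_⟩
  have hs : ∑ g ∈ S.erase bdag, g.gh = (S.erase bdag).card := by
    rw [Finset.cast_card]
    refine Finset.sum_congr rfl fun g hg => ?_
    obtain ⟨i, rfl⟩ := ht g hg
    rfl
  split_ifs with hb
  · rw [← Finset.sum_erase_add _ _ hb, hs]
    rfl
  · rw [Finset.erase_eq_of_notMem hb] at hs ⊢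
    rw [hs, sub_zero]

namespace Background

variable {l : ℝ} (B : Background U l)

theorem single_mem_intermediate {S : Finset (Ghost d)} (h0 : c0 ∉ S) (h1 : cdag ∉ S)
    (h2 : xi ∉ S) (h3 : mu ∉ S) (h4 : nu ∉ S) {φ : Fiber U} (hφ : φ ∈ B.fields (bWeight S)) :
    (Pi.single S φ : State U) ∈ B.intermediateSections := by
  rw [mem_intermediateSections_iff]
  refine ⟨gder_single h0 φ, gder_single h1 φ, gder_single h2 φ, gder_single h3 φ,
    gder_single h4 φ, fun S' => ?_⟩
  by_cases h : S' = S
  · subst h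
    rwa [Pi.single_eq_same]
  · rw [Pi.single_eq_of_ne h]
    exact zero_mem _

/-- Only θ and b† survive, so the ghost number is the form degree, less one if b† occurs. This
leaves the degrees 0 without b† and 1 with b† at ghost number 0, and b† alone at ghost number -1. -/
theorem component_intermediate {ψ : State U} (hψ : ψ ∈ B.intermediateSections) {n : ℤ}
    (hn : ψ ∈ ghostGr U n) {S : Finset (Ghost d)} (hS : ψ S ≠ 0) :
    (∀ g ∈ S.erase bdag, ∃ i, g = theta i) ∧
      n = (S.erase bdag).card - if bdag ∈ S then 1 else 0 := by
  simp only [mem_intermediateSections_iff, gder_eq_zero_iff] at hψ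
  obtain ⟨h0, h1, h2, h3, h4, -⟩ := hψ
  obtain ⟨h, h'⟩ := sum_gh_of_physical (S := S) (fun h => hS (h0 S h)) (fun h => hS (h1 S h))
    (fun h => hS (h2 S h)) (fun h => hS (h3 S h)) fun h => hS (h4 S h)
  refine ⟨h, ?_⟩
  rw [← h']
  by_contra hne
  exact hS (hn S fun e => hne e.symm)

theorem physical_fields (Ψ : State U) : (Ψ ∈ B.intermediateSections ∧ Ψ ∈ ghostGr U 0) ↔
    ∃ F ∈ B.fields 2, ∃ A : Fin d → Fiber U, (∀ μ, A μ ∈ B.fields 0) ∧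
      Ψ = zeroForm F + gmul bdag (oneForm A) := by
  constructor
  · rintro ⟨h, h0⟩
    have hf := ((mem_intermediateSections_iff B Ψ).1 h).2.2.2.2.2
    refine ⟨Ψ ∅, by simpa [bWeight] using hf ∅, fun i => Ψ {bdag, theta i}, fun i => ?_, ?_⟩
    · simpa [bWeight] using hf {bdag, theta i}
    · rw [gmul_bdag_oneForm]
      funext S
      rw [Pi.add_apply, Finset.sum_apply, zeroForm]
      by_cases hS : S = ∅
      · subst hS
        rw [Pi.single_eq_same, Finset.sum_eq_zero, add_zero]
        intro i _
        exact Pi.single_eq_of_ne (Finset.insert_ne_empty _ _).symm _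
      · rw [Pi.single_eq_of_ne hS, zero_add]
        by_cases hi : ∃ i, S = {bdag, theta i}
        · obtain ⟨i, rfl⟩ := hi
          rw [Finset.sum_eq_single_of_mem i (Finset.mem_univ i), Pi.single_eq_same]
          intro j _ hj
          refine Pi.single_eq_of_ne (fun e => hj ?_) _
          have : theta i ∈ ({bdag, theta j} : Finset (Ghost d)) := by rw [← e]; simp
          simpa [eq_comm] using this
        · rw [Finset.sum_eq_zero fun i _ => Pi.single_eq_of_ne (fun e => hi ⟨i, e⟩) _]
          by_contra hne
          obtain ⟨h1, h2⟩ := B.component_intermediate h h0 hne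
          split_ifs at h2 with hb
          · have hc : (S.erase bdag).card = 1 := by omega
            obtain ⟨g, hg⟩ := Finset.card_eq_one.1 hc
            obtain ⟨i, rfl⟩ := h1 g (by rw [hg]; exact Finset.mem_singleton_self g)
            exact hi ⟨i, by rw [← hg, Finset.insert_erase hb]⟩
          · rw [Finset.erase_eq_of_notMem hb] at h2
            exact hS (Finset.card_eq_zero.1 (by omega))
  · rintro ⟨F, hF, A, hA, rfl⟩
    rw [gmul_bdag_oneForm]
    refine ⟨add_mem (B.single_mem_intermediate (by simp) (by simp) (by simp) (by simp) (by simp)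
      (by simpa [bWeight] using hF)) (sum_mem fun i _ => B.single_mem_intermediate (by simp)
        (by simp) (by simp) (by simp) (by simp) (by simpa [bWeight] using hA i)),
      add_mem (single_mem_ghostGr ∅ F) (sum_mem fun i _ => ?_)⟩
    have := single_mem_ghostGr {bdag, theta i} (A i)
    rwa [Finset.sum_pair (by simp)] at this

theorem omegaHatT_zeroForm_add (F : Fiber U) (A : Fin d → Fiber U) :
    B.omegaHatT (zeroForm F + gmul bdag (oneForm A)) =
      B.nablaSigma (zeroForm F) + onState opSd (oneForm A) -
        gmul bdag (B.nablaSigma (oneForm A)) := by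
  rw [omegaHatT_apply, map_add, map_add, gder_bdag_zeroForm, zero_add,
    gder_bdag_gmul_bdag (gder_bdag_oneForm A), nablaSigma_gmul B (by simp)]
  abel

theorem gder_bdag_nablaSigma {ψ : State U} (h : gder bdag ψ = 0) :
    gder bdag (B.nablaSigma ψ) = 0 := by
  rw [← neg_eq_iff_eq_neg.2 (B.nablaSigma_gder (g := bdag) (by simp) ψ), h, map_zero, neg_zero]

/-- The derivative by b† isolates the equation for A; the part without b† is the equation for F. -/
theorem equations_of_motion (F : Fiber U) (A : Fin d → Fiber U) :
    B.omegaHatT (zeroForm F + gmul bdag (oneForm A)) = 0 ↔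
      B.nablaSigma (oneForm A) = 0 ∧
        B.nablaSigma (zeroForm F) = - onState opSd (oneForm A) := by
  rw [omegaHatT_zeroForm_add]
  constructor
  · intro h
    have h1 := congrArg (gder bdag) h
    rw [map_sub, map_add, B.gder_bdag_nablaSigma (gder_bdag_zeroForm F), ← onState_gder,
      gder_bdag_oneForm, gder_bdag_gmul_bdag (B.gder_bdag_nablaSigma (gder_bdag_oneForm A)),
      map_zero, map_zero, add_zero, zero_sub, neg_eq_zero] at h1
    rw [h1, map_zero, sub_zero] at h
    exact ⟨h1, eq_neg_of_add_eq_zero_left h⟩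
  · rintro ⟨h1, h2⟩
    rw [h1, h2, map_zero, neg_add_cancel, sub_zero]

theorem omegaHatT_gmul_zeroForm (φ : Fiber U) :
    B.omegaHatT (gmul bdag (zeroForm φ)) = zeroForm (- opSd (-φ)) +
      gmul bdag (B.nablaSigma (zeroForm (-φ))) := by
  have h : (zeroForm (-φ) : State U) = - zeroForm φ := Pi.single_neg _ _
  rw [omegaHatT_apply, gder_bdag_gmul_bdag (gder_bdag_zeroForm φ), nablaSigma_gmul B (by simp),
    onState_zeroForm, h, map_neg, map_neg, map_neg, neg_neg, add_comm]

theorem gauge_transformations (χ : State U) :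
    (∃ Λ ∈ B.intermediateSections, Λ ∈ ghostGr U (-1) ∧ B.omegaHatT Λ = χ) ↔
      ∃ lam ∈ B.fields 0, χ = zeroForm (- opSd lam) +
        gmul bdag (B.nablaSigma (zeroForm lam)) := by
  constructor
  · rintro ⟨Λ, h, h0, rfl⟩
    have hf := ((mem_intermediateSections_iff B Λ).1 h).2.2.2.2.2 {bdag}
    -- The sign of the parameter accounts for ∇ + σ anticommuting with b†.
    refine ⟨-Λ {bdag}, neg_mem (by simpa [bWeight] using hf), ?_⟩
    rw [← omegaHatT_gmul_zeroForm, gmul_bdag_zeroForm]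
    congr 1
    funext S
    by_cases hS : S = {bdag}
    · subst hS
      rw [Pi.single_eq_same]
    · rw [Pi.single_eq_of_ne hS]
      by_contra hne
      obtain ⟨h1, h2⟩ := B.component_intermediate h h0 hne
      split_ifs at h2 with hb
      · have hc : S.erase bdag = ∅ := Finset.card_eq_zero.1 (by omega)
        exact hS (by rw [← Finset.insert_erase hb, hc]; rfl)
      · omega
  · rintro ⟨lam, hlam, rfl⟩
    refine ⟨gmul bdag (zeroForm (-lam)), ?_, ?_, ?_⟩
    · rw [gmul_bdag_zeroForm]
      exact B.single_mem_intermediate (by simp) (by simp) (by simp) (by simp) (by simp)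
        (by simpa [bWeight] using hlam)
    · rw [gmul_bdag_zeroForm]
      have := single_mem_ghostGr {bdag} (-lam)
      rwa [Finset.sum_singleton] at this
    · rw [omegaHatT_gmul_zeroForm, neg_neg]

end Background

end PhysicalFields

end AdSParent

end

open AdSParent in
theorem mainTheorem6 (d : ℕ) (hd : 3 ≤ d) (l : ℝ) (hl : 0 < l)
    (U : TopologicalSpace.Opens (Fin d → ℝ)) (B : Background U l) :
    ∃ (hT : ∀ φ ∈ tracelessSections U, B.omegaTildeT φ ∈ tracelessSections U)
      (hI : ∀ φ ∈ B.intermediateSections, B.omegaHatT φ ∈ B.intermediateSections),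
      -- both are BRST systems
      IsBRSTSystem (fun n => (ghostGr U n).comap (tracelessSections U).subtype)
        (restrictOp (tracelessSections U) B.omegaTildeT hT) ∧
      IsBRSTSystem (fun n => (ghostGr U n).comap B.intermediateSections.subtype)
        (restrictOp B.intermediateSections B.omegaHatT hI) ∧
      -- the first one can be consistently reduced to the second one
      IsConsistentReduction
        (fun n => (ghostGr U n).comap (tracelessSections U).subtype)
        (restrictOp (tracelessSections U) B.omegaTildeT hT)
        (fun n => (ghostGr U n).comap B.intermediateSections.subtype)
        (restrictOp B.intermediateSections B.omegaHatT hI)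
        (Submodule.inclusion B.intermediate_le) ∧
      -- the physical fields: a zero-form `F` and a one-form `A`
      (∀ Ψ : State U, (Ψ ∈ B.intermediateSections ∧ Ψ ∈ ghostGr U 0) ↔
        ∃ F ∈ B.fields 2, ∃ A : Fin d → Fiber U, (∀ μ, A μ ∈ B.fields 0) ∧
          Ψ = zeroForm F + gmul Ghost.bdag (oneForm A)) ∧
      -- the equations of motion
      (∀ F ∈ B.fields 2, ∀ A : Fin d → Fiber U, (∀ μ, A μ ∈ B.fields 0) →
        (B.omegaHatT (zeroForm F + gmul Ghost.bdag (oneForm A)) = 0 ↔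
          B.nablaSigma (oneForm A) = 0 ∧
          B.nablaSigma (zeroForm F) = - onState opSd (oneForm A))) ∧
      -- the gauge transformations
      (∀ χ : State U,
        (∃ Λ ∈ B.intermediateSections, Λ ∈ ghostGr U (-1) ∧ B.omegaHatT Λ = χ) ↔
        ∃ lam ∈ B.fields 0, χ = zeroForm (- opSd lam) +
          gmul Ghost.bdag (B.nablaSigma (zeroForm lam))) := by
  -- The conditions d ≥ 3 and l > 0 enter only here, through the null frame.
  obtain ⟨K⟩ := B.nonempty_rightInverses hd hl
  exact ⟨B.omegaTildeT_mem_tracelessSections, B.omegaHatT_mem_intermediateSections,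
    B.isBRSTSystem_tracelessSections _, B.isBRSTSystem_intermediateSections _,
    K.isConsistentReduction _, B.physical_fields, fun F _ A _ => B.equations_of_motion F A,
    B.gauge_transformations⟩
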